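/- **Setting.** Fix a database schema (finitely many table names, each with an arity and a set of primary-key positions) and an infinite set of constants. A database instance $\mathbf{db}$ assigns to each table name a finite relation; its size $N$ is the number of its facts. A block is a maximal set of facts of one table that agree on the primary key. A repair of $\mathbf{db}$ is obtained by selecting exactly one fact from each block. Let $q(\vec u) \text{ :- } F_1,\dots,F_n$ be a conjunctive query whose free variables $\vec u=(u_1,\dots,u_k)$ are distinct and occur in the body; atoms may contain constants. For an atom $F$, $\mathsf{vars}(F)$ is its set of variables and $\mathsf{key}(F)$ is the set of its variables at primary-key positions. The query is self-join-free if its atoms have distinct table names, and full if all its variables are free. A tuple $\vec c$ is a possible answer to $q$ on $\mathbf{db}$ if $\vec c\in q(\mathbf{db})$, and a consistent answer if $\vec c\in q(r)$ for every repair $r$ of $\mathbf{db}$. Let $\mathsf{OUT}_p$ and $\mathsf{OUT}_c$ be the sets of possible and of consistent answers. **Join trees.** A join tree of a query is an undirected tree whose nodes are its atoms, such that the common variables of any two atoms occur in all atoms on the path between them. A query is acyclic if it has a join tree. For a query $p$ with join tree $\tau$ and an atom $F$, let $F^{+,p}$ be the set of variables that are functionally determined by $\mathsf{key}(F)$ with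 respect to the dependencies $\mathsf{key}(G)\to\mathsf{vars}(G)$ for the atoms $G\neq F$ of $p$. The atom $F$ attacks $G\neq F$ in $p$ if on the path between $F$ and $G$ in $\tau$ every two adjacent atoms share a variable not in $F^{+,p}$. A rooted join tree $(\tau,R)$ of a Boolean query is a pair-pruning join tree (PPJT) if for every rooted subtree $(\tau',R')$ of $(\tau,R)$, the atom $R'$ is not attacked in the subquery whose atoms are the nodes of $\tau'$. The query $q(\vec u)$ admits a PPJT if the Boolean query $q_{[\vec u\to\vec c]}$, obtained by replacing $\vec u$ by a sequence $\vec c$ of distinct constants, has a PPJT. **Running time.** Algorithms are deterministic programs, depending on $q$ only (data complexity), for a random-access machine with unit-cost hash tables: words are constants or natural numbers; constants can be moved and compared for equality; numbers can, moreover, be incremented and decremented; memory cells are addressed by sequences of words whose length is bounded by the program; each elementary instruction or equality test costs one step. The input is an arbitrary duplicate-free listing of the facts of each table, and the output is a duplicate-free listing of the consistent answers. **Theorem.** Let $q$ be an acyclic self-join-free conjunctive query, possibly non-Boolean, that admits a PPJT. Then: 1. There are an algorithm and a constant $C$ such that for every database instance $\mathbf{db}$ the algorithm computes the set of consistent answers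 to $q$ on $\mathbf{db}$ in at most $C\cdot\max(1,N)\cdot\max(1,|\mathsf{OUT}_p|)$ steps, that is, in time $O(N\cdot|\mathsf{OUT}_p|)$ with factors that are zero read as $1$. 2. If $q$ is full, there are an algorithm and a constant $C$ such that for every database instance $\mathbf{db}$ the algorithm computes the set of consistent answers to $q$ on $\mathbf{db}$ in at most $C\cdot\max(1,N+|\mathsf{OUT}_c|)$ steps, that is, in time $O(N+|\mathsf{OUT}_c|)$. Moreover, for full $q$ and every $\mathbf{db}$, the set of consistent answers equals $q(\mathbf{db}^c)$, where $\mathbf{db}^c$ is obtained from $\mathbf{db}$ by deleting every block with at least two facts. -/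

import Mathlib

namespace CQA

/-! ### Schemas, database instances, repairs -/

/-- A database schema: table names, with arities and primary-key positions.
Finiteness of the set of table names is a hypothesis of the theorem. -/
structure Schema where
  Rel : Type*
  arity : Rel → ℕ
  key : (R : Rel) → Finset (Fin (arity R))

/-- Tuples of table `R` over the domain `D` of constants. -/
abbrev Tuple (S : Schema) (D : Type*) (R : S.Rel) : Type _ := Fin (S.arity R) → D

/-- A (possibly inconsistent) database instance: a finite relation for every table name. -/
abbrev Instance (S : Schema) (D : Type*) : Type _ := (R : S.Rel) → Finset (Tuple S D R)

/-- Two tuples of the same table are key-equal (lie in the same block). -/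
def KeyEq {S : Schema} {D : Type*} {R : S.Rel} (t t' : Tuple S D R) : Prop :=
  ∀ i ∈ S.key R, t i = t' i

namespace Instance

variable {S : Schema} {D : Type*}

/-- The size `N` of an instance: its number of facts. -/
def size [Fintype S.Rel] (db : Instance S D) : ℕ := ∑ R, (db R).card

/-- `r` is a repair of `db`: it selects exactly one tuple from each block of each relation. -/
def IsRepair (db r : Instance S D) : Prop :=
  (∀ R, r R ⊆ db R) ∧ ∀ R, ∀ t ∈ db R, ∃! t', t' ∈ r R ∧ KeyEq t' t

open Classical in
/-- The instance obtained from `db` by deleting every block with at least two tuples. -/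
noncomputable def consistentPart (db : Instance S D) : Instance S D :=
  fun R => (db R).filter fun t => ∀ t' ∈ db R, KeyEq t' t → t' = t

end Instance

/-! ### Conjunctive queries -/

/-- A term is a variable or a constant. -/
inductive Term (V D : Type*) where
  | var (v : V)
  | const (d : D)

namespace Term

variable {V D : Type*}

/-- The value of a term under a valuation of the variables. -/
def eval (θ : V → D) : Term V D → D
  | var v => θ v
  | const d => d

/-- Replace the variables in the domain of the partial map `σ` by constants. -/
def subst (σ : V → Option D) : Term V D → Term V D
  | var v => (σ v).elim (var v) const
  | const d => const d

end Term

/-- An atom `R(x, y)`: a table name and a sequence of terms; the primary-key positions are those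
of the table. -/
structure Atom (S : Schema) (V D : Type*) where
  rel : S.Rel
  args : Fin (S.arity rel) → Term V D

namespace Atom

variable {S : Schema} {V D : Type*}

/-- The variables of an atom. -/
def vars (F : Atom S V D) : Set V := {v | ∃ i, F.args i = .var v}

/-- The variables that occur at primary-key positions of an atom. -/
def keyVars (F : Atom S V D) : Set V := {v | ∃ i ∈ S.key F.rel, F.args i = .var v}

/-- Replace variables by constants in an atom. -/
def subst (σ : V → Option D) (F : Atom S V D) : Atom S V D :=
  ⟨F.rel, fun i => (F.args i).subst σ⟩

/-- Under the valuation `θ` the atom becomes a fact of `I`. -/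
def Holds (F : Atom S V D) (θ : V → D) (I : Instance S D) : Prop :=
  (fun i => (F.args i).eval θ) ∈ I F.rel

end Atom

/-- The body of a query: a family of atoms, indexed by `ι`. -/
abbrev Body (S : Schema) (V D ι : Type*) : Type _ := ι → Atom S V D

/-- A conjunctive query `q(u₁, …, u_k) :- F₁, …, F_n`. The free variables `u₁, …, u_k` are
distinct, and each of them occurs in the body. -/
structure Query (S : Schema) (V D : Type*) (k : ℕ) where
  n : ℕ
  body : Body S V D (Fin n)
  head : Fin k → V
  head_injective : Function.Injective head
  head_safe : ∀ j, ∃ i, head j ∈ (body i).vars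

/-! ### Join trees, attacks, pair-pruning join trees -/

section Trees

variable {S : Schema} {V D ι : Type*}

/-- A join tree: a tree on the atoms such that the common variables of any two atoms occur in
all atoms on the path between them. -/
def IsJoinTree (b : Body S V D ι) (τ : SimpleGraph ι) : Prop :=
  τ.IsTree ∧ ∀ (i j : ι) (p : τ.Walk i j), p.IsPath →
    ∀ l ∈ p.support, (b i).vars ∩ (b j).vars ⊆ (b l).vars

/-- `KeyClosure b F v`: the variable `v` is functionally determined by `key(F)` with respect to
the functional dependencies `key(G) → vars(G)`, for the atoms `G ≠ F` of `b`. -/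
inductive KeyClosure (b : Body S V D ι) (F : ι) : V → Prop
  | key {v : V} : v ∈ (b F).keyVars → KeyClosure b F v
  | step {v : V} (G : ι) : G ≠ F → (∀ w ∈ (b G).keyVars, KeyClosure b F w) →
      v ∈ (b G).vars → KeyClosure b F v

/-- `F` attacks `G`: on the path between `F` and `G` in the join tree `τ`, every two adjacent
atoms share a variable outside the key closure of `F`. -/
def Attacks (b : Body S V D ι) (τ : SimpleGraph ι) (F G : ι) : Prop :=
  F ≠ G ∧ ∃ p : τ.Walk F G, p.IsPath ∧
    ∀ e ∈ p.darts, ∃ v ∈ (b e.fst).vars ∩ (b e.snd).vars, ¬ KeyClosure b F v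

/-- The vertices of the subtree rooted at `R'` of the rooted tree `(τ, R)`. -/
def subtreeVerts (τ : SimpleGraph ι) (R R' : ι) : Set ι :=
  {T | ∃ p : τ.Walk R T, p.IsPath ∧ R' ∈ p.support}

/-- The subquery formed by the atoms with index in `A`. -/
def Body.restrict (b : Body S V D ι) (A : Set ι) : Body S V D A := fun i => b i

/-- The rooted tree `(τ, R)` is a pair-pruning join tree of `b`: for every rooted subtree
`(τ', R')`, the atom `R'` is unattacked in the subquery whose atoms are the nodes of `τ'`. -/
def IsPPJT (b : Body S V D ι) (τ : SimpleGraph ι) (R : ι) : Prop :=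
  IsJoinTree b τ ∧ ∀ (R' : ι) (F G : subtreeVerts τ R R'), (G : ι) = R' →
    ¬ Attacks (b.restrict (subtreeVerts τ R R')) (τ.induce (subtreeVerts τ R R')) F G

end Trees

namespace Query

variable {S : Schema} {V D : Type*} {k : ℕ}

/-- No table name occurs in two atoms. -/
def SelfJoinFree (q : Query S V D k) : Prop := Function.Injective fun i => (q.body i).rel

/-- The query has a join tree. -/
def IsAcyclic (q : Query S V D k) : Prop := ∃ τ, IsJoinTree q.body τ

/-- All variables of the query are free. -/
def IsFull (q : Query S V D k) : Prop := ∀ i, (q.body i).vars ⊆ Set.range q.head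

open Classical in
/-- The partial map that sends the free variable `u_j` to the constant `c_j`. -/
noncomputable def assign (q : Query S V D k) (c : Fin k → D) (v : V) : Option D :=
  if h : ∃ j, q.head j = v then some (c h.choose) else none

/-- The body of the Boolean query obtained by replacing each free variable `u_j` by `c_j`. -/
noncomputable def instantiate (q : Query S V D k) (c : Fin k → D) : Body S V D (Fin q.n) :=
  fun i => (q.body i).subst (q.assign c)

/-- `q` admits a pair-pruning join tree: the Boolean query obtained by replacing its free
variables by distinct constants has one. -/
def AdmitsPPJT (q : Query S V D k) : Prop :=
  ∃ c : Fin k → D, Function.Injective c ∧ ∃ τ R, IsPPJT (q.instantiate c) τ R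

/-- The set `q(I)` of answers to `q` on `I`. -/
def answers (q : Query S V D k) (I : Instance S D) : Set (Fin k → D) :=
  {c | ∃ θ : V → D, (∀ i, (q.body i).Holds θ I) ∧ ∀ j, θ (q.head j) = c j}

/-- The possible answers to `q` on `db`: the answers on `db` itself. -/
def possibleAnswers (q : Query S V D k) (db : Instance S D) : Set (Fin k → D) := q.answers db

/-- The consistent answers to `q` on `db`: the tuples that are answers on every repair. -/
def consistentAnswers (q : Query S V D k) (db : Instance S D) : Set (Fin k → D) :=
  {c | ∀ r, db.IsRepair r → c ∈ q.answers r}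

end Query

/-! ### Machine model

A random-access machine with unit-cost hash tables. A word is a constant or a natural number.
There are registers, and a memory in which every cell is addressed by a finite sequence of words.
Constants can only be moved and compared for equality; natural numbers can, moreover, be
incremented and decremented. Every instruction costs one step and names a fixed number of
registers, so it moves only a bounded number of words. Programs are structured
(sequencing, conditionals, loops); every test costs one step. -/

section Machine

/-- A machine word. -/
abbrev Word (D : Type*) : Type _ := D ⊕ ℕ

/-- An input for the machine: each relation as a list of its tuples. -/
abbrev Input (S : Schema) (D : Type*) : Type _ := (R : S.Rel) → List (Tuple S D R)

/-- The input lists the tuples of `db`, without repetitions and in any order. -/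
def Input.Lists {S : Schema} {D : Type*} (inp : Input S D) (db : Instance S D) : Prop :=
  ∀ R, (inp R).Nodup ∧ ∀ t, t ∈ inp R ↔ t ∈ db R

/-- Elementary instructions. Registers are numbered by natural numbers. -/
inductive Instr (S : Schema) (D : Type*) where
  /-- load a literal word -/
  | lit (r : ℕ) (w : Word D)
  /-- copy the second register to the first -/
  | copy (r r' : ℕ)
  /-- increment -/
  | succ (r : ℕ)
  /-- decrement -/
  | pred (r : ℕ)
  /-- the number of tuples of an input relation -/
  | size (r : ℕ) (R : S.Rel)
  /-- read attribute `j` of the tuple of `R` whose position is in register `i` -/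
  | read (r : ℕ) (R : S.Rel) (i : ℕ) (j : Fin (S.arity R))
  /-- load from the memory cell whose address is in the registers `a` -/
  | load (r : ℕ) (a : List ℕ)
  /-- store to the memory cell whose address is in the registers `a` -/
  | store (a : List ℕ) (r : ℕ)
  /-- append the contents of the registers `a` as one tuple to the output -/
  | emit (a : List ℕ)

/-- Programs. -/
inductive Program (S : Schema) (D : Type*) where
  | instr (i : Instr S D)
  | seq (P Q : Program S D)
  /-- if the two registers hold equal words, run `P`, else run `Q` -/
  | ite (r r' : ℕ) (P Q : Program S D)
  /-- as long as the two registers hold different words, run `P` -/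
  | loop (r r' : ℕ) (P : Program S D)

/-- Machine states. -/
structure State (D : Type*) where
  reg : ℕ → Word D
  mem : List (Word D) → Word D
  out : List (List (Word D))

/-- The initial state: all registers and memory cells hold the number 0, the output is empty. -/
def State.init (D : Type*) : State D := ⟨fun _ => .inr 0, fun _ => .inr 0, []⟩

variable {S : Schema} {D : Type*}

/-- Write a register. -/
def State.set (s : State D) (r : ℕ) (w : Word D) : State D :=
  { s with reg := Function.update s.reg r w }

/-- Apply a function to the number held by a word; constants give the number 0. -/
def Word.mapNat (f : ℕ → ℕ) : Word D → Word D
  | .inl _ => .inr 0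
  | .inr m => .inr (f m)

/-- Attribute `j` of the tuple of `R` at position `w`; the number 0 if there is none. -/
def Input.get (inp : Input S D) (R : S.Rel) (w : Word D) (j : Fin (S.arity R)) : Word D :=
  match w with
  | .inl _ => .inr 0
  | .inr m => ((inp R)[m]?).elim (.inr 0) fun t => .inl (t j)

open Classical in
/-- The effect of an elementary instruction. -/
noncomputable def Instr.step (inp : Input S D) (s : State D) : Instr S D → State D
  | .lit r w => s.set r w
  | .copy r r' => s.set r (s.reg r')
  | .succ r => s.set r ((s.reg r).mapNat Nat.succ)
  | .pred r => s.set r ((s.reg r).mapNat Nat.pred)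
  | .size r R => s.set r (.inr (inp R).length)
  | .read r R i j => s.set r (inp.get R (s.reg i) j)
  | .load r a => s.set r (s.mem (a.map s.reg))
  | .store a r => { s with mem := Function.update s.mem (a.map s.reg) (s.reg r) }
  | .emit a => { s with out := s.out ++ [a.map s.reg] }

/-- `Exec inp P s s' t`: started in state `s`, the program `P` halts in state `s'` after exactly
`t` steps. -/
inductive Exec (inp : Input S D) : Program S D → State D → State D → ℕ → Prop
  | instr (i : Instr S D) (s : State D) : Exec inp (.instr i) s (i.step inp s) 1
  | seq {P Q : Program S D} {s₁ s₂ s₃ : State D} {t₁ t₂ : ℕ} :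
      Exec inp P s₁ s₂ t₁ → Exec inp Q s₂ s₃ t₂ → Exec inp (.seq P Q) s₁ s₃ (t₁ + t₂)
  | ite_eq {r r' : ℕ} {P Q : Program S D} {s s' : State D} {t : ℕ} :
      s.reg r = s.reg r' → Exec inp P s s' t → Exec inp (.ite r r' P Q) s s' (t + 1)
  | ite_ne {r r' : ℕ} {P Q : Program S D} {s s' : State D} {t : ℕ} :
      s.reg r ≠ s.reg r' → Exec inp Q s s' t → Exec inp (.ite r r' P Q) s s' (t + 1)
  | loop_eq {r r' : ℕ} {P : Program S D} {s : State D} :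
      s.reg r = s.reg r' → Exec inp (.loop r r' P) s s 1
  | loop_ne {r r' : ℕ} {P : Program S D} {s₁ s₂ s₃ : State D} {t₁ t₂ : ℕ} :
      s₁.reg r ≠ s₁.reg r' → Exec inp P s₁ s₂ t₁ → Exec inp (.loop r r' P) s₂ s₃ t₂ →
      Exec inp (.loop r r' P) s₁ s₃ (t₁ + t₂ + 1)

/-- On every listing of every instance `db`, the program halts within `T db` steps, and its output
is an enumeration of the set `ans db` without repetitions. -/
def Program.Computes {k : ℕ} (P : Program S D) (ans : Instance S D → Set (Fin k → D))
    (T : Instance S D → ℕ) : Prop :=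
  ∀ (db : Instance S D) (inp : Input S D), inp.Lists db →
    ∃ (s : State D) (t : ℕ) (L : List (Fin k → D)),
      Exec inp P (State.init D) s t ∧ t ≤ T db ∧
      s.out = L.map (fun c => List.ofFn fun j => Sum.inl (c j)) ∧
      L.Nodup ∧ ∀ c, c ∈ L ↔ c ∈ ans db

end Machine

end CQA

namespace CQA

/-! ### Repairs, and exchanging a fact within its block -/

section Repairs

variable {S : Schema} {D : Type*}

/-! The combinatorial core concerns an unattacked atom `F`. Call a block of the table of `F` reified
in a repair if some valuation satisfying the subquery there maps `F` into that block. Take a repair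
`r` with the fewest reified blocks and move it towards another repair `s`, each time exchanging a
fact that a satisfying valuation uses. If an exchange made a block reified, splice the new valuation
with the old one, taking the old values on the attacked variables. The result satisfies the subquery
before the exchange and keeps the key of `F`, so the block was reified already
(`Unattacked.reified_swap_subset`). By minimality the reified blocks therefore never change, and
those of `r` are reified in every `s` (`Unattacked.mem_reified_of_minimal`). Hence, if the subquery
is certain, there is one block of `F` each of whose facts makes the remaining atoms certain
(`Unattacked.exists_block`).

In a pair-pruning join tree this applies at the root of every subtree and gives a bottom-up
recursion: a block is good if all its facts match the atom, agree on the variables shared with the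
parent, and join with a good block of each child. Semijoin reduction (for possible answers) and the
restriction to one-fact blocks (for the instance without conflicts) are recursions of the same
shape. `Pass` abstracts all three. `Pass.Fits.solves_iff` proves correctness once, and
`Pass.Fits.exec_pass` implements the recursion in linear time with hash tables, leaving behind
linked lists of the good tuples, sorted by projection. Each pass has its own number, which is part
of every address, so memory is never cleared and the results of earlier passes survive.

For the bound in terms of possible answers, the free variables are fixed one at a time. Given values
for some of them, one possible-answer pass rooted at an atom that contains the next variable finds
exactly the values that extend to a possible answer. Each is visited once, so every recursive call
has a possible answer below it to pay for its linear cost (`exists_enumeratesFrom_cons`). Once all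
free variables are fixed, the certainty pass decides the candidate (`exists_enumeratesFrom_nil`).

For a full query an answer determines all the facts it uses, so none of them can have a rival in its
block (`Query.consistentAnswers_eq_of_isFull`). After the one-fact-block pass, a top-down walk
through the linked lists has no dead ends (`Pass.Fits.noDeadEnd`), so it costs a constant per answer
(`exists_computes_of_isFull`). -/

theorem KeyEq.refl {R : S.Rel} (t : Tuple S D R) : KeyEq t t := fun _ _ => rfl

theorem KeyEq.symm {R : S.Rel} {t t' : Tuple S D R} (h : KeyEq t t') : KeyEq t' t :=
  fun i hi => (h i hi).symm

theorem KeyEq.trans {R : S.Rel} {t t' t'' : Tuple S D R} (h : KeyEq t t') (h' : KeyEq t' t'') :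
    KeyEq t t'' :=
  fun i hi => (h i hi).trans (h' i hi)

theorem Instance.isRepair_iff {db r : Instance S D} :
    db.IsRepair r ↔ (∀ R, r R ⊆ db R) ∧ (∀ R, ∀ t ∈ db R, ∃ t' ∈ r R, KeyEq t' t) ∧
      ∀ R, ∀ t ∈ r R, ∀ t' ∈ r R, KeyEq t t' → t = t' := by
  constructor
  · rintro ⟨h₁, h₂⟩
    refine ⟨h₁, fun R t ht => ?_, fun R t ht t' ht' h => ?_⟩
    · obtain ⟨t', ⟨h, h'⟩, -⟩ := h₂ R t ht
      exact ⟨t', h, h'⟩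
    · obtain ⟨u, -, hu⟩ := h₂ R t' (h₁ R ht')
      rw [hu t ⟨ht, h⟩, hu t' ⟨ht', KeyEq.refl t'⟩]
  · rintro ⟨h₁, h₂, h₃⟩
    refine ⟨h₁, fun R t ht => ?_⟩
    obtain ⟨t', h, h'⟩ := h₂ R t ht
    exact ⟨t', ⟨h, h'⟩, fun u hu => h₃ R u hu.1 t' h (hu.2.trans h'.symm)⟩

open Classical in
/-- Replace the fact `a` of table `R` by `a'`. -/
noncomputable def Instance.swap (r : Instance S D) (R : S.Rel) (a a' : Tuple S D R) :
    Instance S D :=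
  Function.update r R (insert a' ((r R).erase a))

theorem Instance.mem_swap_self {r : Instance S D} {R : S.Rel} {a a' t : Tuple S D R} :
    t ∈ r.swap R a a' R ↔ t = a' ∨ (t ≠ a ∧ t ∈ r R) := by
  simp [Instance.swap]

theorem Instance.swap_of_ne {r : Instance S D} {R R' : S.Rel} {a a' : Tuple S D R} (h : R' ≠ R) :
    r.swap R a a' R' = r R' := by
  simp [Instance.swap, h]

theorem Instance.IsRepair.swap {db r : Instance S D} (hr : db.IsRepair r) {R : S.Rel}
    {a a' : Tuple S D R} (ha : a ∈ r R) (ha' : a' ∈ db R) (h : KeyEq a' a) :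
    db.IsRepair (r.swap R a a') := by
  rw [Instance.isRepair_iff] at hr ⊢
  obtain ⟨h₁, h₂, h₃⟩ := hr
  refine ⟨fun R' t ht => ?_, fun R' t ht => ?_, fun R' t ht t' ht' htt' => ?_⟩
  · by_cases hR : R' = R
    · subst hR
      rcases Instance.mem_swap_self.1 ht with rfl | ht
      exacts [ha', h₁ _ ht.2]
    · rw [Instance.swap_of_ne hR] at ht
      exact h₁ _ ht
  · by_cases hR : R' = R
    · subst hR
      obtain ⟨u, hu, hut⟩ := h₂ _ t ht
      by_cases hua : u = a
      · subst hua
        exact ⟨a', Instance.mem_swap_self.2 (.inl rfl), h.trans hut⟩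
      · exact ⟨u, Instance.mem_swap_self.2 (.inr ⟨hua, hu⟩), hut⟩
    · rw [Instance.swap_of_ne hR]
      exact h₂ _ t ht
  · by_cases hR : R' = R
    · subst hR
      rcases Instance.mem_swap_self.1 ht with hu | hu <;>
        rcases Instance.mem_swap_self.1 ht' with hu' | hu'
      · rw [hu, hu']
      · exact absurd (h₃ _ _ hu'.2 _ ha (htt'.symm.trans (hu ▸ h))) hu'.1
      · exact absurd (h₃ _ _ hu.2 _ ha (htt'.trans (hu' ▸ h))) hu.1
      · exact h₃ _ _ hu.2 _ hu'.2 htt'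
    · rw [Instance.swap_of_ne hR] at ht ht'
      exact h₃ _ _ ht _ ht' htt'

theorem Instance.exists_isRepair (db : Instance S D) : ∃ r, db.IsRepair r := by
  classical
  have key : ∀ R, ∃ f : Tuple S D R → Tuple S D R, ∀ t ∈ db R, f t ∈ db R ∧ KeyEq (f t) t ∧
      ∀ t' ∈ db R, KeyEq t t' → f t = f t' := by
    intro R
    -- The choice depends only on the predicate of lying in the block of `t`. Key-equal tuples give
    -- the same predicate, hence the same chosen fact.
    refine ⟨fun t => if h : ∃ u, u ∈ db R ∧ KeyEq u t then h.choose else t, fun t ht => ?_⟩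
    have h : ∃ u, u ∈ db R ∧ KeyEq u t := ⟨t, ht, KeyEq.refl t⟩
    refine ⟨?_, ?_, fun t' _ htt' => ?_⟩
    · simpa only [dif_pos h] using h.choose_spec.1
    · simpa only [dif_pos h] using h.choose_spec.2
    · have : (fun u => u ∈ db R ∧ KeyEq u t) = fun u => u ∈ db R ∧ KeyEq u t' := by
        funext u
        exact propext ⟨fun hu => ⟨hu.1, hu.2.trans htt'⟩, fun hu => ⟨hu.1, hu.2.trans htt'.symm⟩⟩
      have h' : ∃ u, u ∈ db R ∧ KeyEq u t' := by simpa only [← this] using h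
      simp only [dif_pos h, dif_pos h']
      congr 1
  choose f hf using key
  refine ⟨fun R => (db R).image (f R), Instance.isRepair_iff.2 ⟨fun R t ht => ?_,
    fun R t ht => ⟨f R t, Finset.mem_image_of_mem _ ht, (hf R t ht).2.1⟩,
    fun R t ht t' ht' h => ?_⟩⟩
  · obtain ⟨u, hu, rfl⟩ := Finset.mem_image.1 ht
    exact (hf R u hu).1
  · obtain ⟨u, hu, rfl⟩ := Finset.mem_image.1 ht
    obtain ⟨u', hu', rfl⟩ := Finset.mem_image.1 ht'
    exact (hf R u hu).2.2 u' hu'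
      (((hf R u hu).2.1.symm.trans h).trans (hf R u' hu').2.1)

theorem Instance.mem_consistentPart {db : Instance S D} {R : S.Rel} {t : Tuple S D R} :
    t ∈ db.consistentPart R ↔ t ∈ db R ∧ ∀ t' ∈ db R, KeyEq t' t → t' = t := by
  simp [Instance.consistentPart]

theorem Instance.consistentPart_subset_repair {db r : Instance S D} (hr : db.IsRepair r)
    (R : S.Rel) : db.consistentPart R ⊆ r R := by
  intro t ht
  obtain ⟨h, h'⟩ := Instance.mem_consistentPart.1 ht
  obtain ⟨t', ⟨ht', hk⟩, -⟩ := hr.2 R t h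
  rwa [← h' t' (hr.1 R ht') hk]

end Repairs

/-! ### Facts of atoms under valuations; consistent answers of full queries -/

section Valuations

variable {S : Schema} {V D : Type*}

/-- The fact that an atom becomes under a valuation. -/
def Atom.fact (F : Atom S V D) (θ : V → D) : Tuple S D F.rel := fun i => (F.args i).eval θ

theorem Atom.fact_congr {F : Atom S V D} {θ μ : V → D} (h : ∀ v ∈ F.vars, θ v = μ v) :
    F.fact θ = F.fact μ := by
  funext i
  rcases hi : F.args i with v | d
  · simpa [Atom.fact, hi, Term.eval] using h v ⟨i, hi⟩
  · simp [Atom.fact, hi, Term.eval]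

theorem Atom.eqOn_of_fact_eq {F : Atom S V D} {θ μ : V → D} (h : F.fact θ = F.fact μ) {v : V}
    (hv : v ∈ F.vars) : θ v = μ v := by
  obtain ⟨i, hi⟩ := hv
  simpa [Atom.fact, hi, Term.eval] using congrFun h i

theorem Atom.keyEq_fact {F : Atom S V D} {θ μ : V → D} (h : ∀ v ∈ F.keyVars, θ v = μ v) :
    KeyEq (F.fact θ) (F.fact μ) := by
  intro i hi
  rcases hv : F.args i with v | d
  · simpa [Atom.fact, hv, Term.eval] using h v ⟨i, hi, hv⟩
  · simp [Atom.fact, hv, Term.eval]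

theorem Atom.eqOn_key_of_keyEq {F : Atom S V D} {θ μ : V → D} (h : KeyEq (F.fact θ) (F.fact μ))
    {v : V} (hv : v ∈ F.keyVars) : θ v = μ v := by
  obtain ⟨i, hi, hv⟩ := hv
  simpa [Atom.fact, hv, Term.eval] using h i hi

theorem Atom.keyVars_subset_vars (F : Atom S V D) : F.keyVars ⊆ F.vars :=
  fun _ ⟨i, _, h⟩ => ⟨i, h⟩

theorem Atom.holds_iff {F : Atom S V D} {θ : V → D} {I : Instance S D} :
    F.Holds θ I ↔ F.fact θ ∈ I F.rel := Iff.rfl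

/-- An answer to a full query fixes the value of every variable of the body, so all its witnesses,
in all repairs, use the same facts. If one of these facts had a key-equal rival, exchanging the two
would give a repair that lacks a fact the answer needs. -/
theorem Query.consistentAnswers_eq_of_isFull {k : ℕ} (q : Query S V D k) (hq : q.IsFull)
    (db : Instance S D) : q.consistentAnswers db = q.answers db.consistentPart := by
  ext c
  constructor
  · intro hc
    obtain ⟨r, hr⟩ := db.exists_isRepair
    obtain ⟨θ, hθ, hθc⟩ := hc r hr
    refine ⟨θ, fun i => ?_, hθc⟩
    rw [Atom.holds_iff, Instance.mem_consistentPart]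
    refine ⟨hr.1 _ (hθ i), fun t ht hk => ?_⟩
    by_contra hne
    obtain ⟨μ, hμ, hμc⟩ := hc _ (hr.swap (hθ i) ht hk)
    have hμθ : (q.body i).fact μ = (q.body i).fact θ := by
      refine Atom.fact_congr fun v hv => ?_
      obtain ⟨j, rfl⟩ := hq i hv
      rw [hθc, hμc]
    have := hμ i
    rw [Atom.holds_iff, hμθ] at this
    rcases Instance.mem_swap_self.1 this with h | h
    · exact hne h.symm
    · exact h.1 rfl
  · rintro ⟨θ, hθ, hθc⟩ r hr
    exact ⟨θ, fun i => Instance.consistentPart_subset_repair hr _ (hθ i), hθc⟩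

end Valuations

/-! ### Unattacked atoms: the minimal-repair argument -/

section Unattacked

variable {S : Schema} {V D ι : Type*}

/-- The atom `F` of the subquery `A` is unattacked, where `vs` and `ks` are the variables and key
variables of the atoms: every `G ∈ A` has a set `C` of variables determined by its key and a set
`X` of attacked variables such that the variables outside `C` of an atom are all attacked as soon
as one variable is. -/
def Unattacked (vs ks : ι → Set V) (A : Set ι) (F : ι) : Prop :=
  ∀ G ∈ A, ∃ C X : Set V,
    (∀ E : Set V, ks G ⊆ E → (∀ H ∈ A, H ≠ G → ks H ⊆ E → vs H ⊆ E) → C ⊆ E) ∧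
    (∀ H ∈ A, ∀ v ∈ vs H, v ∈ X → vs H ⊆ X ∪ C) ∧ vs G ⊆ X ∪ C ∧
    (G ≠ F → Disjoint (vs F) X) ∧ Disjoint (ks F) X

open Classical in
/-- The facts of the table of `F` whose block is used when the atoms in `A` are satisfied in `r`
by a valuation that agrees with `γ` on `P`. -/
noncomputable def reified (b : Body S V D ι) (A : Set ι) (F : ι) (P : Set V) (γ : V → D)
    (db r : Instance S D) : Finset (Tuple S D (b F).rel) :=
  (db (b F).rel).filter fun t => ∃ θ : V → D, (∀ v ∈ P, θ v = γ v) ∧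
    (∀ x ∈ A, (b x).Holds θ r) ∧ KeyEq ((b F).fact θ) t

theorem mem_reified {b : Body S V D ι} {A : Set ι} {F : ι} {P : Set V} {γ : V → D}
    {db r : Instance S D} {t : Tuple S D (b F).rel} :
    t ∈ reified b A F P γ db r ↔ t ∈ db (b F).rel ∧ ∃ θ : V → D, (∀ v ∈ P, θ v = γ v) ∧
      (∀ x ∈ A, (b x).Holds θ r) ∧ KeyEq ((b F).fact θ) t := by
  simp [reified]

variable {b : Body S V D ι} {A : Set ι} {F : ι} {U P : Set V} {γ : V → D} {db : Instance S D}

/-- Exchanging a relevant fact for a key-equal one does not enlarge the set of reified blocks. -/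
theorem Unattacked.reified_swap_subset (hsjf : Function.Injective fun i => (b i).rel)
    (hun : Unattacked (fun i => (b i).vars \ U) (fun i => (b i).keyVars \ U) A F)
    (hP : U ⊆ P) {r : Instance S D} (hr : db.IsRepair r) {θ : V → D} (hθP : ∀ v ∈ P, θ v = γ v)
    (hθ : ∀ x ∈ A, (b x).Holds θ r) {G : ι} (hG : G ∈ A) {a' : Tuple S D (b G).rel}
    (ha' : KeyEq a' ((b G).fact θ)) :
    reified b A F P γ db (r.swap (b G).rel ((b G).fact θ) a') ⊆ reified b A F P γ db r := by
  intro t ht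
  rw [mem_reified] at ht ⊢
  obtain ⟨htdb, μ, hμP, hμ, hμt⟩ := ht
  refine ⟨htdb, ?_⟩
  have hμne : ∀ x ∈ A, x ≠ G → (b x).Holds μ r := by
    intro x hx hxG
    have := hμ x hx
    rwa [Atom.holds_iff, Instance.swap_of_ne fun h => hxG (hsjf h)] at this
  -- Only a valuation that uses the new fact `a'` can fail in `r`; any other one serves there
  -- unchanged.
  by_cases hμG : (b G).fact μ = a'
  swap
  · refine ⟨μ, hμP, fun x hx => ?_, hμt⟩
    by_cases hxG : x = G
    · subst hxG
      rcases Instance.mem_swap_self.1 (hμ x hx) with h | h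
      exacts [absurd h hμG, h.2]
    · exact hμne x hx hxG
  obtain ⟨C, X, hC, hX, hGX, hFX, hkX⟩ := hun G hG
  have hU : ∀ v ∈ U, μ v = θ v := fun v hv => by rw [hμP v (hP hv), hθP v (hP hv)]
  -- Since `a'` is in the block of the old fact, `μ` and `θ` agree on the key of `G`. The other
  -- atoms hold under both valuations in the same repair `r`, which has one fact per key, so the
  -- agreement spreads along the dependencies to `C`.
  have hCE : C ⊆ {v | μ v = θ v} := by
    refine hC _ (fun v hv => ?_) fun H hH hHG hk v hv => ?_
    · exact Atom.eqOn_key_of_keyEq (hμG ▸ ha') hv.1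
    · refine Atom.eqOn_of_fact_eq ?_ hv.1
      refine (Instance.isRepair_iff.1 hr).2.2 _ _ (hμne H hH hHG) _ (hθ H hH) ?_
      refine Atom.keyEq_fact fun w hw => ?_
      by_cases hwU : w ∈ U
      exacts [hU w hwU, hk ⟨hw, hwU⟩]
  classical
  -- The spliced valuation. An atom that meets `X` has its variables in `X ∪ C` (apart from `U`),
  -- where `ν` equals `θ`; an atom that avoids `X` sees only `μ`. The atom `G` is handled by `θ`, so
  -- `a'` is not needed, and the key of `F` avoids `X`, so the block is the one that `μ` reified.
  set ν : V → D := fun v => if v ∈ X then θ v else μ v with hν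
  have hνX : ∀ v, v ∈ X ∪ C → ν v = θ v := by
    intro v hv
    by_cases hvX : v ∈ X
    · simp [hν, hvX]
    · simpa [hν, hvX] using hCE (hv.resolve_left hvX)
  have hνU : ∀ v, μ v = θ v → ν v = θ v ∧ ν v = μ v := by
    intro v hv
    by_cases hvX : v ∈ X <;> simp [hν, hvX, hv]
  have hνall : ∀ H, (b H).vars \ U ⊆ X ∪ C → (b H).fact ν = (b H).fact θ := by
    intro H hH
    refine Atom.fact_congr fun v hv => ?_
    by_cases hvU : v ∈ U
    exacts [(hνU v (hU v hvU)).1, hνX v (hH ⟨hv, hvU⟩)]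
  have hνnone : ∀ W : Set V, Disjoint (W \ U) X → ∀ v ∈ W, ν v = μ v := by
    intro W hW v hv
    by_cases hvU : v ∈ U
    · exact (hνU v (hU v hvU)).2
    · have : v ∉ X := fun h => Set.disjoint_left.1 hW ⟨hv, hvU⟩ h
      simp [hν, this]
  refine ⟨ν, fun v hv => ?_, fun H hH => ?_, ?_⟩
  · rw [(hνU v (by rw [hμP v hv, hθP v hv])).2, hμP v hv]
  · rw [Atom.holds_iff]
    by_cases hHG : H = G
    · subst hHG
      rw [hνall H hGX]
      exact hθ H hH
    by_cases hHX : Disjoint ((b H).vars \ U) X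
    · rw [Atom.fact_congr (hνnone _ hHX)]
      exact hμne H hH hHG
    · obtain ⟨v, hv, hvX⟩ := Set.not_disjoint_iff.1 hHX
      rw [hνall H (hX H hH v hv hvX)]
      exact hθ H hH
  · refine KeyEq.trans (Atom.keyEq_fact (hνnone _ hkX)) hμt

variable [Fintype S.Rel]

open Classical in
/-- A block that is reified in a repair with the fewest reified blocks is reified in all repairs. -/
theorem Unattacked.mem_reified_of_minimal (hsjf : Function.Injective fun i => (b i).rel)
    (hun : Unattacked (fun i => (b i).vars \ U) (fun i => (b i).keyVars \ U) A F)
    (hP : U ⊆ P) {s : Instance S D} (hs : db.IsRepair s) {t : Tuple S D (b F).rel} (m : ℕ) :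
    ∀ r : Instance S D, db.IsRepair r → ∑ R, (s R \ r R).card ≤ m →
      (∀ r', db.IsRepair r' → (reified b A F P γ db r).card ≤ (reified b A F P γ db r').card) →
      t ∈ reified b A F P γ db r → t ∈ reified b A F P γ db s := by
  -- The measure counts the facts of `s` that `r` lacks. Each exchange puts a fact of `s` in place
  -- of a fact outside `s`.
  induction m with
  | zero =>
    intro r hr hm _ ht
    have hsub : ∀ R, s R ⊆ r R := by
      intro R
      have := Finset.sum_eq_zero_iff.1 (Nat.le_zero.1 hm) R (Finset.mem_univ R)
      rwa [Finset.card_eq_zero, Finset.sdiff_eq_empty_iff_subset] at this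
    have : s = r := by
      funext R
      refine (hsub R).antisymm fun u hu => ?_
      obtain ⟨u', hu', hk⟩ := (Instance.isRepair_iff.1 hs).2.1 R u (hr.1 R hu)
      rwa [← (Instance.isRepair_iff.1 hr).2.2 R u' (hsub R hu') u hu hk]
    rwa [this]
  | succ m ih =>
    intro r hr hm hmin ht
    obtain ⟨htdb, θ, hθP, hθ, hθt⟩ := mem_reified.1 ht
    by_cases hall : ∀ x ∈ A, (b x).Holds θ s
    · exact mem_reified.2 ⟨htdb, θ, hθP, hall, hθt⟩
    push Not at hall
    obtain ⟨G, hG, hGs⟩ := hall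
    obtain ⟨a', ha', hk⟩ := (Instance.isRepair_iff.1 hs).2.1 _ _ (hr.1 _ (hθ G hG))
    have hr' : db.IsRepair (r.swap (b G).rel ((b G).fact θ) a') :=
      hr.swap (hθ G hG) (hs.1 _ ha') hk
    have hsub := hun.reified_swap_subset hsjf hP hr hθP hθ hG hk
    -- The exchange cannot enlarge the set and minimality forbids shrinking it, so the new repair
    -- reifies the same blocks and is again minimal.
    have heq := Finset.eq_of_subset_of_card_le hsub (hmin _ hr')
    have ha'r : a' ∉ r (b G).rel := by
      intro h
      have := (Instance.isRepair_iff.1 hr).2.2 _ _ h _ (hθ G hG) hk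
      rw [this] at ha'
      exact hGs ha'
    refine ih _ hr' ?_ (fun r' hr' => ?_) ?_
    · refine Nat.le_of_lt_succ (lt_of_lt_of_le (Finset.sum_lt_sum (fun R _ => ?_)
        ⟨(b G).rel, Finset.mem_univ _, Finset.card_lt_card ?_⟩) hm)
      · refine Finset.card_le_card fun u hu => ?_
        rw [Finset.mem_sdiff] at hu ⊢
        refine ⟨hu.1, fun hur => hu.2 ?_⟩
        by_cases hR : R = (b G).rel
        · subst hR
          refine Instance.mem_swap_self.2 (.inr ⟨?_, hur⟩)
          rintro rfl
          exact hGs hu.1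
        · rwa [Instance.swap_of_ne hR]
      · rw [Finset.ssubset_iff_of_subset]
        · refine ⟨a', Finset.mem_sdiff.2 ⟨ha', ha'r⟩, fun h => ?_⟩
          exact (Finset.mem_sdiff.1 h).2 (Instance.mem_swap_self.2 (.inl rfl))
        · intro u hu
          rw [Finset.mem_sdiff] at hu ⊢
          refine ⟨hu.1, fun hur => hu.2 (Instance.mem_swap_self.2 (.inr ⟨?_, hur⟩))⟩
          rintro rfl
          exact hGs hu.1
    · rw [heq]
      exact hmin r' hr'
    · rwa [heq]

/-- If the subquery `A` with an unattacked atom `F` is certain, then some block of `F` is such that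
each of its facts makes the remaining atoms certain. -/
theorem Unattacked.exists_block (hsjf : Function.Injective fun i => (b i).rel)
    (hF : F ∈ A) (hun : Unattacked (fun i => (b i).vars \ U) (fun i => (b i).keyVars \ U) A F)
    (hP : U ⊆ P)
    (hcert : ∀ r, db.IsRepair r → ∃ θ : V → D, (∀ v ∈ P, θ v = γ v) ∧
      ∀ x ∈ A, (b x).Holds θ r) :
    ∃ t ∈ db (b F).rel, ∀ t' ∈ db (b F).rel, KeyEq t' t → ∀ r, db.IsRepair r →
      ∃ θ : V → D, (∀ v ∈ P, θ v = γ v) ∧ (b F).fact θ = t' ∧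
        ∀ x ∈ A, x ≠ F → (b x).Holds θ r := by
  classical
  obtain ⟨r, hr, hmin⟩ : ∃ r, db.IsRepair r ∧ ∀ r', db.IsRepair r' →
      (reified b A F P γ db r).card ≤ (reified b A F P γ db r').card := by
    have hne : {r | db.IsRepair r}.Nonempty := db.exists_isRepair
    exact ⟨Function.argminOn (fun r => (reified b A F P γ db r).card) _ hne,
      Function.argminOn_mem (fun r => (reified b A F P γ db r).card) {r | db.IsRepair r} hne,
      fun r' hr' => Function.argminOn_le (fun r => (reified b A F P γ db r).card)
        {r | db.IsRepair r} hr'⟩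
  obtain ⟨θ, hθP, hθ⟩ := hcert r hr
  have ht := hr.1 _ (hθ F hF)
  refine ⟨(b F).fact θ, ht, fun t' ht' hk s hs => ?_⟩
  obtain ⟨u, hu, huk⟩ := (Instance.isRepair_iff.1 hs).2.1 _ _ ht'
  -- Force `t'` into `s`. The block is still reified, and now `t'` is its only fact in the repair,
  -- so the witness maps `F` to `t'`. The other atoms belong to other tables, which the exchange did
  -- not touch.
  have hs' := hs.swap hu ht' huk.symm
  obtain ⟨-, μ, hμP, hμ, hμk⟩ := mem_reified.1 (hun.mem_reified_of_minimal (γ := γ) hsjf hP hs'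
    _ r hr le_rfl hmin (mem_reified.2 ⟨ht, θ, hθP, hθ, KeyEq.refl _⟩))
  refine ⟨μ, hμP, ?_, fun x hx hxF => ?_⟩
  · refine (Instance.isRepair_iff.1 hs').2.2 _ _ (hμ F hF) _ (Instance.mem_swap_self.2 (.inl rfl))
      (hμk.trans hk.symm)
  · have := hμ x hx
    rwa [Atom.holds_iff, Instance.swap_of_ne fun h => hxF (hsjf h)] at this

end Unattacked

/-! ### Rooted join trees in parent form, and attacks as reachability -/

section Trees

/-- The list enumerates every element before its parent is out of sight: the parent of an element
does not occur from that element on. -/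
def TopDown {ι : Type*} (root : ι) (par : ι → ι) : List ι → Prop
  | [] => True
  | i :: l => i ∉ l ∧ (i ≠ root → par i ∉ i :: l) ∧ TopDown root par l

/-- A rooted join tree for atoms with variable sets `vs`, given by parents and subtrees. -/
structure RootedJoinTree {V ι : Type*} (vs : ι → Set V) where
  root : ι
  par : ι → ι
  sub : ι → Set ι
  depth : ι → ℕ
  order : List ι
  mem_order : ∀ i, i ∈ order
  topDown : TopDown root par order
  depth_par_lt : ∀ i, i ≠ root → depth (par i) < depth i
  mem_sub_root : ∀ x, x ∈ sub root
  mem_sub_self : ∀ i, i ∈ sub i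
  sub_child_subset : ∀ j, j ≠ root → sub j ⊆ sub (par j)
  par_notMem_sub : ∀ j, j ≠ root → par j ∉ sub j
  exists_child : ∀ i, ∀ x ∈ sub i, x ≠ i → ∃ j, j ≠ root ∧ par j = i ∧ x ∈ sub j
  sub_antisymm : ∀ i j, i ∈ sub j → j ∈ sub i → i = j
  sub_disjoint : ∀ i j, i ≠ root → j ≠ root → par i = par j → i ≠ j → ∀ x ∈ sub i, x ∉ sub j
  sep : ∀ j, j ≠ root → ∀ x ∈ sub j, ∀ y, y ∉ sub j → ∀ v ∈ vs x, v ∈ vs y →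
    v ∈ vs j ∧ v ∈ vs (par j)

/-- Sort by depth: a parent has strictly smaller depth than its child, so it cannot occur later. -/
theorem exists_topDown {ι : Type*} [Fintype ι] (root : ι) (par : ι → ι) (depth : ι → ℕ)
    (h : ∀ i, i ≠ root → depth (par i) < depth i) :
    ∃ l : List ι, (∀ i, i ∈ l) ∧ TopDown root par l := by
  classical
  let l := (Finset.univ : Finset ι).toList.insertionSort fun i j => depth i ≤ depth j
  have hl : l.Perm (Finset.univ : Finset ι).toList := List.perm_insertionSort _ _
  have hsort : l.Pairwise fun i j => depth i ≤ depth j :=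
    List.pairwise_insertionSort _ _
  have hnd : l.Nodup := hl.nodup_iff.2 (Finset.nodup_toList _)
  refine ⟨l, fun i => hl.mem_iff.2 (by simp), ?_⟩
  clear_value l
  clear hl
  induction l with
  | nil => trivial
  | cons i l ih =>
    rw [List.pairwise_cons] at hsort
    rw [List.nodup_cons] at hnd
    refine ⟨hnd.1, fun hi hmem => ?_, ih hsort.2 hnd.2⟩
    have := h i hi
    rcases List.mem_cons.1 hmem with h' | h'
    · rw [h'] at this
      exact lt_irrefl _ this
    · exact absurd (hsort.1 _ h') (by omega)

variable {V ι : Type*} {τ : SimpleGraph ι} {vs : ι → Set V}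

theorem mem_subtreeVerts_iff {R i x : ι} (hτ : τ.IsTree) {p : τ.Walk R x} (hp : p.IsPath) :
    x ∈ subtreeVerts τ R i ↔ i ∈ p.support := by
  constructor
  · rintro ⟨q, hq, hi⟩
    rwa [(hτ.existsUnique_path R x).unique hp hq]
  · exact fun h => ⟨p, hp, h⟩

/-- The parent is the penultimate vertex of the unique path from the root, and the depth is the
length of that path. Cutting off the last vertex leaves the path to the parent, which gives a
recursion for membership in a subtree; the later arguments about subtrees use this recursion rather
than paths. -/
theorem exists_parent (hτ : τ.IsTree) (R : ι) : ∃ (par : ι → ι) (depth : ι → ℕ),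
    (∀ i, i ≠ R → depth (par i) < depth i) ∧
    (∀ i x, x ∈ subtreeVerts τ R i ↔ x = i ∨ x ≠ R ∧ par x ∈ subtreeVerts τ R i) ∧
    (∀ i, i ≠ R → par i ∉ subtreeVerts τ R i) ∧
    (∀ x, x ∈ subtreeVerts τ R R) ∧
    (∀ x y, τ.Adj x y → (x ≠ R ∧ par x = y) ∨ (y ≠ R ∧ par y = x)) := by
  classical
  choose P hP huniq using fun i => hτ.existsUnique_path R i
  have hmem : ∀ i x, x ∈ subtreeVerts τ R i ↔ i ∈ (P x).support :=
    fun i x => mem_subtreeVerts_iff hτ (hP x)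
  have hnil : ∀ i, i ≠ R → ¬ (P i).Nil := fun i hi h => hi h.eq.symm
  have hdrop : ∀ i, (P i).dropLast = P (P i).penultimate :=
    fun i => huniq _ _ (hP i).dropLast
  have hsupp : ∀ i, i ≠ R → (P i).support = (P (P i).penultimate).support ++ [i] := by
    intro i hi
    rw [← hdrop i, SimpleGraph.Walk.support_dropLast_concat (hnil i hi)]
  have hself : ∀ i, i ∈ (P i).support := fun i => SimpleGraph.Walk.end_mem_support _
  have hpar : ∀ i, i ≠ R → i ∉ (P (P i).penultimate).support := by
    intro i hi h
    have := (SimpleGraph.Walk.isPath_def _).1 (hP i)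
    rw [hsupp i hi, List.nodup_append] at this
    exact this.2.2 i h i (by simp) rfl
  have hconcat : ∀ x y (h : τ.Adj x y), y ∉ (P x).support → y ≠ R ∧ (P y).penultimate = x := by
    intro x y h hy
    have hc : (P x).concat h = P y := huniq _ _ ((hP x).concat hy h)
    refine ⟨?_, ?_⟩
    · rintro rfl
      exact hy (SimpleGraph.Walk.start_mem_support _)
    · rw [← hc, SimpleGraph.Walk.penultimate_concat]
  refine ⟨fun i => (P i).penultimate, fun i => (P i).length, fun i hi => ?_, fun i x => ?_,
    fun i hi => ?_, fun x => ?_, fun x y h => ?_⟩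
  · have := congrArg List.length (hsupp i hi)
    simp only [SimpleGraph.Walk.length_support, List.length_append, List.length_cons,
      List.length_nil] at this
    change (P (P i).penultimate).length < (P i).length
    omega
  · rw [hmem, hmem]
    constructor
    · intro h
      by_cases hx : x = i
      · exact .inl hx
      · have hxR : x ≠ R := by
          rintro rfl
          have : P x = .nil := (huniq x _ SimpleGraph.Walk.IsPath.nil).symm
          rw [this] at h
          simp at h
          exact hx h.symm
        rw [hsupp x hxR] at h
        simp only [List.mem_append, List.mem_singleton] at h
        exact .inr ⟨hxR, h.resolve_right fun h => hx h.symm⟩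
    · rintro (rfl | ⟨hxR, h⟩)
      · exact hself x
      · rw [hsupp x hxR]
        exact List.mem_append_left _ h
  · rw [hmem]
    exact hpar i hi
  · rw [hmem]
    exact SimpleGraph.Walk.start_mem_support _
  -- If `y` is not on the path to `x`, appending the edge gives the path to `y`, so `x` is its
  -- parent. Otherwise the path to `y` is an initial segment of the path to the parent of `x` and
  -- avoids `x`, so the same argument applies with the roles exchanged.
  · by_cases hy : y ∈ (P x).support
    · left
      apply hconcat y x h.symm
      intro hx
      have hyx : y ≠ x := h.ne'
      by_cases hxR : x = R
      · subst hxR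
        have : P x = .nil := (huniq x _ SimpleGraph.Walk.IsPath.nil).symm
        rw [this] at hy
        simp at hy
        exact hyx hy
      have hy' : y ∈ (P (P x).penultimate).support := by
        rw [hsupp x hxR] at hy
        simpa [hyx] using hy
      have htake : (P (P x).penultimate).takeUntil y hy' = P y :=
        huniq _ _ ((hP _).takeUntil hy')
      rw [← htake] at hx
      exact hpar x hxR (SimpleGraph.Walk.support_takeUntil_subset_support _ _ hx)
    · exact .inr (hconcat x y h hy)

theorem walk_crosses {τ : SimpleGraph ι} {A : Set ι} {x y : ι} (p : τ.Walk x y) (hx : x ∈ A)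
    (hy : y ∉ A) : ∃ a ∈ A, ∃ c, c ∉ A ∧ τ.Adj a c ∧ a ∈ p.support ∧ c ∈ p.support := by
  induction p with
  | nil => exact absurd hx hy
  | @cons u v w h p ih =>
    by_cases hv : v ∈ A
    · obtain ⟨a, ha, c, hc, hac, h₁, h₂⟩ := ih hv hy
      exact ⟨a, ha, c, hc, hac, by simp [h₁], by simp [h₂]⟩
    · exact ⟨u, hx, v, hv, h, by simp, by simp⟩

/-- The only edge between a rooted subtree and its complement joins the root of the subtree to its
parent, so a walk that leaves the subtree visits both. -/
theorem walk_sep {R : ι} {par : ι → ι}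
    (hsub : ∀ i x, x ∈ subtreeVerts τ R i ↔ x = i ∨ x ≠ R ∧ par x ∈ subtreeVerts τ R i)
    (hadj : ∀ x y, τ.Adj x y → (x ≠ R ∧ par x = y) ∨ (y ≠ R ∧ par y = x))
    {j x y : ι} (hx : x ∈ subtreeVerts τ R j) (hy : y ∉ subtreeVerts τ R j) (p : τ.Walk x y) :
    j ∈ p.support ∧ par j ∈ p.support := by
  obtain ⟨a, ha, c, hc, hac, h₁, h₂⟩ := walk_crosses p hx hy
  rcases hadj a c hac with ⟨haR, rfl⟩ | ⟨hcR, rfl⟩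
  · rcases (hsub j a).1 ha with rfl | ⟨_, h⟩
    exacts [⟨h₁, h₂⟩, absurd h hc]
  · exact absurd ((hsub j c).2 (.inr ⟨hcR, ha⟩)) hc

/-- A path between two vertices of a rooted subtree stays in it. -/
theorem path_support_subset (hτ : τ.IsTree) {R i x y : ι} (hx : x ∈ subtreeVerts τ R i)
    (hy : y ∈ subtreeVerts τ R i) {p : τ.Walk x y} (hp : p.IsPath) :
    ∀ z ∈ p.support, z ∈ subtreeVerts τ R i := by
  classical
  obtain ⟨par, depth, -, hsub, -, -, hadj⟩ := exists_parent hτ R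
  intro z hz
  by_contra hzi
  -- Cut the path at a vertex `z` outside the subtree. Both halves would then pass through `i ≠ z`,
  -- and a path cannot repeat a vertex.
  have h₁ := (walk_sep hsub hadj hx hzi (p.takeUntil z hz)).1
  have h₂ := (walk_sep hsub hadj hy hzi (p.dropUntil z hz).reverse).1
  rw [SimpleGraph.Walk.support_reverse, List.mem_reverse] at h₂
  have hiz : i ≠ z := by
    rintro rfl
    exact hzi ((hsub i i).2 (.inl rfl))
  have hnd := (SimpleGraph.Walk.isPath_def _).1 hp
  rw [← SimpleGraph.Walk.take_spec p hz, SimpleGraph.Walk.support_append, List.nodup_append] at hnd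
  refine hnd.2.2 i h₁ i ?_ rfl
  rw [← SimpleGraph.Walk.cons_tail_support] at h₂
  exact (List.mem_cons.1 h₂).resolve_left hiz

/-- The structure of the subtrees follows from the recursion for membership, by induction on depth.
Separation comes from the join-tree condition: a path from inside the subtree of `j` to the outside
runs through `j` and its parent, which must both contain the common variable. -/
theorem exists_rootedJoinTree [Fintype ι] (hτ : τ.IsTree)
    (hvs : ∀ (i j : ι) (p : τ.Walk i j), p.IsPath → ∀ l ∈ p.support, vs i ∩ vs j ⊆ vs l) (R : ι) :
    ∃ J : RootedJoinTree vs, J.root = R ∧ J.sub = subtreeVerts τ R := by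
  obtain ⟨par, depth, hdepth, hsub, hpar, hroot, hadj⟩ := exists_parent hτ R
  obtain ⟨l, hl, htd⟩ := exists_topDown R par depth hdepth
  have hself : ∀ i, i ∈ subtreeVerts τ R i := fun i => (hsub i i).2 (.inl rfl)
  have hle : ∀ m i x, depth x ≤ m → x ∈ subtreeVerts τ R i → x = i ∨ depth i < depth x := by
    intro m
    induction m with
    | zero =>
      intro i x hx h
      rcases (hsub i x).1 h with h | ⟨hxR, -⟩
      · exact .inl h
      · have := hdepth x hxR
        omega
    | succ m ih =>
      intro i x hx h
      rcases (hsub i x).1 h with h | ⟨hxR, h⟩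
      · exact .inl h
      · have := hdepth x hxR
        rcases ih i (par x) (by omega) h with h | h
        · right
          rwa [← h]
        · right
          omega
  have hanti : ∀ i j, i ∈ subtreeVerts τ R j → j ∈ subtreeVerts τ R i → i = j := by
    intro i j h₁ h₂
    rcases hle _ _ _ le_rfl h₁ with h | h
    · exact h
    rcases hle _ _ _ le_rfl h₂ with h' | h'
    · exact h'.symm
    · omega
  have hchild : ∀ m i x, depth x ≤ m → x ∈ subtreeVerts τ R i → x ≠ i →
      ∃ j, j ≠ R ∧ par j = i ∧ x ∈ subtreeVerts τ R j := by
    intro m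
    induction m with
    | zero =>
      intro i x hx h hxi
      rcases (hsub i x).1 h with h | ⟨hxR, -⟩
      · exact absurd h hxi
      · have := hdepth x hxR
        omega
    | succ m ih =>
      intro i x hx h hxi
      rcases (hsub i x).1 h with h | ⟨hxR, h⟩
      · exact absurd h hxi
      · by_cases hpi : par x = i
        · exact ⟨x, hxR, hpi, hself x⟩
        · have := hdepth x hxR
          obtain ⟨j, hj, hji, hxj⟩ := ih i (par x) (by omega) h hpi
          exact ⟨j, hj, hji, (hsub j x).2 (.inr ⟨hxR, hxj⟩)⟩
  have hsibl : ∀ m i j, i ≠ R → j ≠ R → par i = par j → i ≠ j → ∀ x, depth x ≤ m →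
      x ∈ subtreeVerts τ R i → x ∉ subtreeVerts τ R j := by
    intro m i j hi hj hij hne x
    induction m generalizing x with
    | zero =>
      intro hx h _
      rcases (hsub i x).1 h with rfl | ⟨hxR, -⟩
      · have := hdepth x hi
        omega
      · have := hdepth x hxR
        omega
    | succ m ih =>
      intro hx h h'
      rcases (hsub i x).1 h with rfl | ⟨hxR, h⟩
      · rcases (hsub j x).1 h' with rfl | ⟨_, h'⟩
        · exact hne rfl
        · exact hpar j hj (hij ▸ h')
      · rcases (hsub j x).1 h' with rfl | ⟨_, h'⟩
        · exact hpar i hi (hij ▸ h)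
        · exact ih (par x) (by have := hdepth x hxR; omega) h h'
  refine ⟨⟨R, par, subtreeVerts τ R, depth, l, hl, htd, hdepth, hroot, hself, ?_, hpar,
    fun i x => hchild _ i x le_rfl, hanti, fun i j hi hj hij hne x => hsibl _ i j hi hj hij hne x
    le_rfl, ?_⟩, rfl, rfl⟩
  · intro j hj x
    have : ∀ m x, depth x ≤ m → x ∈ subtreeVerts τ R j → x ∈ subtreeVerts τ R (par j) := by
      intro m
      induction m with
      | zero =>
        intro x hx h
        rcases (hsub j x).1 h with rfl | ⟨hxR, -⟩
        · exact (hsub _ _).2 (.inr ⟨hj, hself _⟩)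
        · have := hdepth x hxR
          omega
      | succ m ih =>
        intro x hx h
        rcases (hsub j x).1 h with rfl | ⟨hxR, h⟩
        · exact (hsub _ _).2 (.inr ⟨hj, hself _⟩)
        · have := hdepth x hxR
          exact (hsub _ _).2 (.inr ⟨hxR, ih _ (by omega) h⟩)
    exact this _ x le_rfl
  · intro j hj x hx y hy v hvx hvy
    obtain ⟨p, hp⟩ := (hτ.existsUnique_path x y).exists
    obtain ⟨h₁, h₂⟩ := walk_sep hsub hadj hx hy p
    exact ⟨hvs x y p hp _ h₁ ⟨hvx, hvy⟩, hvs x y p hp _ h₂ ⟨hvx, hvy⟩⟩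

theorem reflTransGen_of_walk {A : Set ι} {r : A → A → Prop} {W : Set V}
    (hr : ∀ x y : A, τ.Adj x y → (vs x ∩ vs y ∩ W).Nonempty → r x y) {v : V} (hv : v ∈ W) {x y : ι}
    (p : τ.Walk x y) (hA : ∀ z ∈ p.support, z ∈ A) (hp : ∀ z ∈ p.support, v ∈ vs z) (hx : x ∈ A)
    (hy : y ∈ A) : Relation.ReflTransGen r ⟨x, hx⟩ ⟨y, hy⟩ := by
  induction p with
  | nil => exact .refl
  | @cons u w y h p ih =>
    have hw : w ∈ A := hA w (by simp)
    refine .head (hr ⟨u, hx⟩ ⟨w, hw⟩ h ⟨v, ⟨hp u (by simp), hp w (by simp)⟩, hv⟩)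
      (ih (fun z hz => hA z (by simp [hz])) (fun z hz => hp z (by simp [hz])) hw hy)

variable {S : Schema} {D : Type*} {b : Body S V D ι}

/-- An attack requires a path, while reachability only gives a walk. Bypassing its cycles uses only
edges of the walk, so each of them still shares a variable outside the closure. -/
theorem attacks_of_reflTransGen {F G : ι} (hne : F ≠ G)
    (h : Relation.ReflTransGen (fun x y => τ.Adj x y ∧
      ∃ v ∈ (b x).vars ∩ (b y).vars, ¬ KeyClosure b F v) F G) : Attacks b τ F G := by
  classical
  have : ∀ H, Relation.ReflTransGen (fun x y => τ.Adj x y ∧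
      ∃ v ∈ (b x).vars ∩ (b y).vars, ¬ KeyClosure b F v) F H →
      ∃ p : τ.Walk F H, ∀ e ∈ p.darts, ∃ v ∈ (b e.fst).vars ∩ (b e.snd).vars,
        ¬ KeyClosure b F v := by
    intro H hH
    induction hH with
    | refl => exact ⟨.nil, by simp⟩
    | @tail x y _ hxy ih =>
      obtain ⟨p, hp⟩ := ih
      refine ⟨p.concat hxy.1, fun e he => ?_⟩
      rw [SimpleGraph.Walk.darts_concat, List.concat_eq_append, List.mem_append,
        List.mem_singleton] at he
      rcases he with he | rfl
      exacts [hp e he, hxy.2]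
  obtain ⟨p, hp⟩ := this G h
  exact ⟨hne, p.bypass, p.bypass_isPath, fun e he => hp e (p.darts_bypass_subset_darts he)⟩

/-- Let `C` be the key closure of `G` within the subtree, and `X` the variables outside `C` that
occur in an atom reachable from `G` along edges sharing a variable outside `C`. By the join-tree
property, a variable of `X` makes every atom of the subtree that contains it reachable, which gives
the closure property of `X`. A variable of the root `i ≠ G` in `X` would make `G` attack `i`. -/
theorem unattacked_subtreeVerts (hτ : IsJoinTree b τ) {R i : ι}
    (h : ∀ F G : subtreeVerts τ R i, (G : ι) = i →
      ¬ Attacks (b.restrict (subtreeVerts τ R i)) (τ.induce (subtreeVerts τ R i)) F G)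
    (hi : i ∈ subtreeVerts τ R i) :
    Unattacked (fun x => (b x).vars) (fun x => (b x).keyVars) (subtreeVerts τ R i) i := by
  intro G hG
  set A := subtreeVerts τ R i with hA
  let C : Set V := {v | KeyClosure (b.restrict A) ⟨G, hG⟩ v}
  let r : A → A → Prop := fun x y => (τ.induce A).Adj x y ∧
    ∃ v ∈ ((b.restrict A) x).vars ∩ ((b.restrict A) y).vars,
      ¬ KeyClosure (b.restrict A) ⟨G, hG⟩ v
  let X : Set V := {v | v ∉ C ∧ ∃ H : A, v ∈ (b H).vars ∧ Relation.ReflTransGen r ⟨G, hG⟩ H}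
  have hchain : ∀ v ∈ X, ∀ H (hH : H ∈ A), v ∈ (b H).vars →
      Relation.ReflTransGen r ⟨G, hG⟩ ⟨H, hH⟩ := by
    rintro v ⟨hvC, ⟨H₀, hH₀⟩, hv₀, hr₀⟩ H hH hv
    obtain ⟨p, hp⟩ := (hτ.1.existsUnique_path H₀ H).exists
    refine hr₀.trans (reflTransGen_of_walk (τ := τ) (vs := fun x => (b x).vars) (W := Cᶜ) ?_ hvC p
      (path_support_subset hτ.1 hH₀ hH hp) (fun z hz => hτ.2 _ _ p hp z hz ⟨hv₀, hv⟩) _ _)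
    rintro x y hxy ⟨w, hw, hwC⟩
    exact ⟨hxy, w, hw, hwC⟩
  have hroot : G ≠ i → Disjoint (b i).vars X := by
    intro hGi
    rw [Set.disjoint_left]
    intro v hv hvX
    exact h ⟨G, hG⟩ ⟨i, hi⟩ rfl (attacks_of_reflTransGen (fun h => hGi (congrArg Subtype.val h))
      (hchain v hvX i hi hv))
  refine ⟨C, X, fun E hE hstep v hv => ?_, fun H hH v hv hvX w hw => ?_, fun v hv => ?_, hroot,
    ?_⟩
  · induction hv with
    | key hv => exact hE hv
    | step H hH hk hv ih =>
      exact hstep H H.2 (fun h => hH (Subtype.ext h)) (fun w hw => ih w hw) hv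
  · by_cases hwC : w ∈ C
    · exact .inr hwC
    · exact .inl ⟨hwC, ⟨H, hH⟩, hw, hchain v hvX H hH hv⟩
  · by_cases hvC : v ∈ C
    · exact .inr hvC
    · exact .inl ⟨hvC, ⟨G, hG⟩, hv, .refl⟩
  -- An atom does not attack itself, so this case needs another reason: its key lies in `C`, and `X`
  -- is disjoint from `C`.
  · by_cases hGi : G = i
    · rw [Set.disjoint_left]
      intro v hv hvX
      subst hGi
      exact hvX.1 (.key hv)
    · exact (hroot hGi).mono_left (Atom.keyVars_subset_vars _)

end Trees

/-! ### Replacing the free variables by constants -/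

section Instantiate

variable {S : Schema} {V D : Type*} {k : ℕ} (q : Query S V D k) (c : Fin k → D)

theorem Query.subst_assign_eq_var {x : Term V D} {v : V} :
    x.subst (q.assign c) = .var v ↔ x = .var v ∧ v ∉ Set.range q.head := by
  rcases x with w | d
  · by_cases h : ∃ j, q.head j = w
    · simp only [Term.subst, Query.assign, dif_pos h, Option.elim, reduceCtorEq, false_iff, not_and]
      rintro h'
      cases h'
      simpa using h
    · simp only [Term.subst, Query.assign, dif_neg h, Option.elim]
      constructor
      · rintro h'
        cases h'
        exact ⟨rfl, by simpa using h⟩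
      · exact fun h => h.1
  · simp [Term.subst]

/-- The particular constants leave no trace here: only the removal of the head variables counts.
This is why a tree obtained for one tuple of distinct constants serves for all values of the free
variables. -/
theorem Query.vars_instantiate (i : Fin q.n) :
    (q.instantiate c i).vars = (q.body i).vars \ Set.range q.head := by
  ext v
  simp [Query.instantiate, Atom.subst, Atom.vars, q.subst_assign_eq_var]

theorem Query.keyVars_instantiate (i : Fin q.n) :
    (q.instantiate c i).keyVars = (q.body i).keyVars \ Set.range q.head := by
  ext v
  simp only [Query.instantiate, Atom.subst, Atom.keyVars, q.subst_assign_eq_var]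
  simp
  tauto

/-- A pair-pruning join tree in parent form. -/
theorem Query.AdmitsPPJT.exists_rootedJoinTree {q : Query S V D k} (h : q.AdmitsPPJT) :
    ∃ J : RootedJoinTree fun i => (q.body i).vars \ Set.range q.head,
      ∀ i, Unattacked (fun i => (q.body i).vars \ Set.range q.head)
        (fun i => (q.body i).keyVars \ Set.range q.head) (J.sub i) i := by
  obtain ⟨c, -, τ, R, hτ, h⟩ := h
  have hvs : (fun i => (q.instantiate c i).vars) = fun i => (q.body i).vars \ Set.range q.head :=
    funext (q.vars_instantiate c)
  have hks : (fun i => (q.instantiate c i).keyVars) =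
      fun i => (q.body i).keyVars \ Set.range q.head :=
    funext (q.keyVars_instantiate c)
  rw [← hvs, ← hks]
  obtain ⟨J, -, hJ⟩ := CQA.exists_rootedJoinTree hτ.1 hτ.2 R
  refine ⟨J, fun i => ?_⟩
  have hi := J.mem_sub_self i
  rw [hJ] at hi ⊢
  exact unattacked_subtreeVerts hτ (h i) hi

/-- A join tree of an acyclic query can be rooted anywhere, and remains a join tree when variables
are replaced by constants. -/
theorem Query.IsAcyclic.exists_rootedJoinTree {q : Query S V D k} (h : q.IsAcyclic) (U : Set V)
    (i : Fin q.n) : ∃ J : RootedJoinTree fun i => (q.body i).vars \ U, J.root = i := by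
  obtain ⟨τ, hτ⟩ := h
  obtain ⟨J, hJ, -⟩ := CQA.exists_rootedJoinTree (vs := fun i => (q.body i).vars \ U) hτ.1
    (fun i j p hp l hl v hv => ⟨hτ.2 i j p hp l hl ⟨hv.1.1, hv.2.1⟩, hv.1.2⟩) i
  exact ⟨J, hJ⟩

theorem Query.IsAcyclic.nonempty {q : Query S V D k} (h : q.IsAcyclic) : Nonempty (Fin q.n) := by
  obtain ⟨τ, hτ⟩ := h
  exact hτ.1.1.nonempty

end Instantiate

/-! ### Matching a tuple against an atom -/

section Matching

variable {S : Schema} {V D : Type*}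

open Classical in
/-- The constant at a position of the variable `v` in a tuple of the table of `F`. -/
noncomputable def Atom.look (F : Atom S V D) (t : Tuple S D F.rel) (v : V) : Word D :=
  if h : ∃ p, F.args p = .var v then .inl (t h.choose) else .inr 0

theorem Atom.look_fact {F : Atom S V D} {θ : V → D} {v : V} (hv : v ∈ F.vars) :
    F.look (F.fact θ) v = .inl (θ v) := by
  have h : ∃ p, F.args p = .var v := hv
  rw [Atom.look, dif_pos h]
  simp [Atom.fact, h.choose_spec, Term.eval]

/-- The tuple `t` is obtained from the atom by a valuation that agrees with `γ` on `U`. -/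
def Atom.Matches (F : Atom S V D) (U : Set V) (γ : V → D) (t : Tuple S D F.rel) : Prop :=
  ∀ p, (∀ d, F.args p = .const d → t p = d) ∧
    ∀ v, F.args p = .var v → F.look t v = .inl (t p) ∧ (v ∈ U → γ v = t p)

/-- `Atom.look` reads a variable at one chosen occurrence. Comparing each occurrence with that
value, and constants and fixed variables with their prescribed values, reduces the existence of a
valuation to equality tests at the positions of the tuple. -/
theorem Atom.matches_iff {F : Atom S V D} {U : Set V} {γ : V → D} {t : Tuple S D F.rel} :
    F.Matches U γ t ↔ ∃ θ : V → D, (∀ v ∈ U, θ v = γ v) ∧ F.fact θ = t := by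
  classical
  constructor
  · intro h
    refine ⟨fun v => if h : ∃ p, F.args p = .var v then t h.choose else γ v, fun v hv => ?_, ?_⟩
    · by_cases hv' : ∃ p, F.args p = .var v
      · simp only [dif_pos hv']
        exact (((h _).2 v hv'.choose_spec).2 hv).symm
      · simp only [dif_neg hv']
    · funext p
      rcases hp : F.args p with v | d
      · have hv : ∃ p, F.args p = .var v := ⟨p, hp⟩
        have := ((h p).2 v hp).1
        rw [Atom.look, dif_pos hv] at this
        simpa [Atom.fact, hp, Term.eval, hv] using this
      · simp [Atom.fact, hp, Term.eval, (h p).1 d hp]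
  · rintro ⟨θ, hθ, rfl⟩ p
    refine ⟨fun d hd => by simp [Atom.fact, hd, Term.eval], fun v hv => ?_⟩
    have hp : F.fact θ p = θ v := by simp [Atom.fact, hv, Term.eval]
    exact ⟨by rw [Atom.look_fact ⟨p, hv⟩, hp], fun hU => by rw [hp, hθ v hU]⟩

theorem Atom.finite_vars (F : Atom S V D) : F.vars.Finite := by
  refine ((Set.finite_range F.args).preimage (f := Term.var)
    (fun _ _ _ _ h => by cases h; rfl)).subset ?_
  rintro v ⟨p, hp⟩
  exact ⟨p, hp⟩

end Matching

/-! ### Bottom-up passes along a join tree and their correctness -/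

section Pass

variable {S : Schema} {V D : Type*} {n : ℕ}

/-- The parameters of a bottom-up pass over the atoms of a query: the variables `U` that are fixed,
the positions `K` that define blocks, the positions `W` on which the tuples of a good block agree,
the children of an atom, and the variables `sh` that an atom passes on. -/
structure Pass (b : Body S V D (Fin n)) where
  U : Set V
  K : (i : Fin n) → Finset (Fin (S.arity (b i).rel))
  W : (i : Fin n) → Finset (Fin (S.arity (b i).rel))
  children : Fin n → List (Fin n)
  sh : Fin n → List V

variable {b : Body S V D (Fin n)}

/-- The key of a tuple. -/
def Pass.SameKey (C : Pass b) (i : Fin n) (t' t : Tuple S D (b i).rel) : Prop :=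
  ∀ p ∈ C.K i, t' p = t p

/-- The part of a tuple that is passed on to the parent. -/
noncomputable def Pass.proj (C : Pass b) (i : Fin n) (t : Tuple S D (b i).rel) : List (Word D) :=
  (C.sh i).map ((b i).look t)

/-- All tuples in the block of `t` match the atom, agree on `W`, and join with the children. -/
def Pass.Good (C : Pass b) (γ : V → D) (g : Fin n → List (Word D) → Prop) (db : Instance S D)
    (i : Fin n) (t : Tuple S D (b i).rel) : Prop :=
  ∀ t' ∈ db (b i).rel, C.SameKey i t' t → (b i).Matches C.U γ t' ∧ (∀ p ∈ C.W i, t' p = t p) ∧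
    ∀ j ∈ C.children i, g j ((C.sh j).map ((b i).look t'))

/-- The family `g` is the result of the bottom-up pass. -/
def Pass.Solves (C : Pass b) (γ : V → D) (g : Fin n → List (Word D) → Prop) (db : Instance S D) :
    Prop :=
  ∀ i ws, g i ws ↔ ∃ t ∈ db (b i).rel, C.proj i t = ws ∧ C.Good γ g db i t

/-- All instances in `Rs` satisfy the atoms of the subtree of `i`, for the given values `γ` of the
fixed variables and `δ` of the variables that are passed on. -/
def Pass.Sat (C : Pass b) (A : Set (Fin n)) (γ δ : V → D) (i : Fin n) (r : Instance S D) : Prop :=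
  ∃ θ : V → D, (∀ v ∈ C.U, θ v = γ v) ∧ (∀ v ∈ C.sh i, θ v = δ v) ∧ ∀ x ∈ A, (b x).Holds θ r

/-- The pass runs along the tree `J` and is correct at each single atom, for the set `Rs` of
instances. -/
structure Pass.Fits (C : Pass b) (J : RootedJoinTree fun i => (b i).vars \ C.U) (γ : V → D)
    (db : Instance S D) (Rs : Set (Instance S D)) : Prop where
  mem_children : ∀ i j, j ∈ C.children i ↔ j ≠ J.root ∧ J.par j = i
  mem_sh : ∀ i, i ≠ J.root → ∀ v, v ∈ C.sh i ↔ v ∈ (b i).vars ∧ v ∈ (b (J.par i)).vars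
  sh_root : ∀ v ∈ C.sh J.root, v ∈ (b J.root).vars
  agree : ∀ i (t t' : Tuple S D (b i).rel), C.SameKey i t' t → (∀ p ∈ C.W i, t' p = t p) →
    (b i).Matches C.U γ t' → C.proj i t' = C.proj i t
  sound : ∀ i, ∀ t ∈ db (b i).rel, (∀ t' ∈ db (b i).rel, C.SameKey i t' t →
    ∀ p ∈ C.W i, t' p = t p) → ∀ r ∈ Rs, ∃ t' ∈ r (b i).rel, t' ∈ db (b i).rel ∧ C.SameKey i t' t
  complete : ∀ i δ, (∀ r ∈ Rs, C.Sat (J.sub i) γ δ i r) → ∃ t ∈ db (b i).rel,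
    ∀ t' ∈ db (b i).rel, C.SameKey i t' t → (∀ p ∈ C.W i, t' p = t p) ∧ ∀ r ∈ Rs, ∃ θ : V → D,
      (∀ v ∈ C.U, θ v = γ v) ∧ (∀ v ∈ C.sh i, θ v = δ v) ∧ (b i).fact θ = t' ∧
        ∀ x ∈ J.sub i, x ≠ i → (b x).Holds θ r
  nonempty : Rs.Nonempty

variable {C : Pass b} {J : RootedJoinTree fun i => (b i).vars \ C.U} {γ : V → D}
  {db : Instance S D} {Rs : Set (Instance S D)}

theorem Pass.Fits.mem_vars (h : C.Fits J γ db Rs) {i : Fin n} {v : V} (hv : v ∈ C.sh i) :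
    v ∈ (b i).vars := by
  by_cases hi : i = J.root
  · subst hi
    exact h.sh_root v hv
  · exact ((h.mem_sh i hi v).1 hv).1

theorem Pass.Fits.proj_fact (h : C.Fits J γ db Rs) (i : Fin n) (θ : V → D) :
    C.proj i ((b i).fact θ) = (C.sh i).map fun v => .inl (θ v) :=
  List.map_congr_left fun _ hv => Atom.look_fact (h.mem_vars hv)

theorem Pass.Fits.look_child (h : C.Fits J γ db Rs) {i j : Fin n} (hj : j ∈ C.children i)
    (θ : V → D) :
    (C.sh j).map ((b i).look ((b i).fact θ)) = (C.sh j).map fun v => .inl (θ v) := by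
  obtain ⟨hj', rfl⟩ := (h.mem_children i j).1 hj
  exact List.map_congr_left fun v hv => Atom.look_fact ((h.mem_sh j hj' v).1 hv).2

/-- Valuations for the subtrees of the children extend a valuation for the parent. -/
theorem Pass.Fits.glue (h : C.Fits J γ db Rs) {r : Instance S D} {i : Fin n} {θ₀ : V → D}
    (hθ₀ : ∀ v ∈ C.U, θ₀ v = γ v) (hi : (b i).Holds θ₀ r)
    (hch : ∀ j ∈ C.children i, C.Sat (J.sub j) γ θ₀ j r) :
    ∃ θ : V → D, (∀ v ∈ C.U, θ v = γ v) ∧ (∀ v ∈ (b i).vars, θ v = θ₀ v) ∧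
      ∀ x ∈ J.sub i, (b x).Holds θ r := by
  classical
  have : Nonempty (V → D) := ⟨θ₀⟩
  choose! Θ hΘ using hch
  -- Elsewhere the value is taken from some child whose subtree contains the variable. By separation
  -- a variable that occurs in the subtrees of two children also occurs in `i`, so the choice of the
  -- child is unambiguous.
  let θ : V → D := fun v => if v ∈ (b i).vars ∨ v ∈ C.U then θ₀ v else
    if h : ∃ j ∈ C.children i, ∃ x ∈ J.sub j, v ∈ (b x).vars then Θ h.choose v else θ₀ v
  have hθi : ∀ v ∈ (b i).vars, θ v = θ₀ v := fun v hv => by simp [θ, hv]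
  refine ⟨θ, fun v hv => by simp [θ, hv, hθ₀ v hv], hθi, fun x hx => ?_⟩
  by_cases hxi : x = i
  · subst hxi
    rw [Atom.holds_iff, Atom.fact_congr hθi]
    exact hi
  obtain ⟨j, hjr, hji, hxj⟩ := J.exists_child i x hx hxi
  have hj : j ∈ C.children i := (h.mem_children i j).2 ⟨hjr, hji⟩
  have : ∀ v ∈ (b x).vars, θ v = Θ j v := by
    intro v hv
    by_cases hvU : v ∈ C.U
    · simp [θ, hvU, hθ₀ v hvU, (hΘ j hj).1 v hvU]
    by_cases hvi : v ∈ (b i).vars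
    · rw [hθi v hvi]
      refine ((hΘ j hj).2.1 v ((h.mem_sh j hjr v).2 ?_)).symm
      have := J.sep j hjr x hxj i (hji ▸ J.par_notMem_sub j hjr) v ⟨hv, hvU⟩ ⟨hvi, hvU⟩
      exact ⟨this.1.1, this.2.1⟩
    · have hex : ∃ j ∈ C.children i, ∃ x ∈ J.sub j, v ∈ (b x).vars := ⟨j, hj, x, hxj, hv⟩
      have hθv : θ v = Θ hex.choose v := by simp [θ, hvi, hvU, hex]
      rw [hθv]
      obtain ⟨hj', y, hy, hvy⟩ := hex.choose_spec
      by_cases hjj : hex.choose = j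
      · rw [hjj]
      · obtain ⟨hr', hp'⟩ := (h.mem_children i _).1 hj'
        have hyj := J.sub_disjoint _ j hr' hjr (hp'.trans hji.symm) hjj y hy
        have := (J.sep j hjr x hxj y hyj v ⟨hv, hvU⟩ ⟨hvy, hvU⟩).2.1
        rw [hji] at this
        exact absurd this hvi
  rw [Atom.holds_iff, Atom.fact_congr this]
  exact (hΘ j hj).2.2 x hxj

/-- By induction on the size of the subtree. If a block is good, each instance in `Rs` contains one
of its facts by `sound`; the induction hypothesis satisfies the subtrees of the children, and
`Pass.Fits.glue` combines the valuations. Conversely, `complete` provides one block that works for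
all instances simultaneously, and each of its facts leaves the subtrees of the children satisfied in
every instance. -/
theorem Pass.Fits.solves_iff (h : C.Fits J γ db Rs) {g : Fin n → List (Word D) → Prop}
    (hg : C.Solves γ g db) (i : Fin n) (δ : V → D) :
    g i ((C.sh i).map fun v => .inl (δ v)) ↔ ∀ r ∈ Rs, C.Sat (J.sub i) γ δ i r := by
  induction hm : (J.sub i).ncard using Nat.strong_induction_on generalizing i δ with
  | _ m ih =>
  have ih' : ∀ j ∈ C.children i, ∀ δ, g j ((C.sh j).map fun v => .inl (δ v)) ↔
      ∀ r ∈ Rs, C.Sat (J.sub j) γ δ j r := by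
    intro j hj δ
    obtain ⟨hjr, hji⟩ := (h.mem_children i j).1 hj
    refine ih _ ?_ j δ rfl
    rw [← hm, ← hji]
    exact Set.ncard_lt_ncard ⟨J.sub_child_subset j hjr, fun hs =>
      J.par_notMem_sub j hjr (hs (J.mem_sub_self _))⟩ (Set.toFinite _)
  rw [hg]
  constructor
  · rintro ⟨t, ht, hproj, hgood⟩ r hr
    obtain ⟨t', ht'r, ht', hk⟩ := h.sound i t ht (fun t' ht' hk => (hgood t' ht' hk).2.1) r hr
    obtain ⟨hmatch, hW, hch⟩ := hgood t' ht' hk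
    have hproj' := h.agree i t t' hk hW hmatch
    obtain ⟨θ₀, hθ₀, rfl⟩ := Atom.matches_iff.1 hmatch
    obtain ⟨θ, hθU, hθi, hθ⟩ := h.glue (r := r) hθ₀ ht'r fun j hj => by
      have := hch j hj
      rw [h.look_child hj, ih' j hj] at this
      exact this r hr
    refine ⟨θ, hθU, fun v hv => ?_, hθ⟩
    rw [hθi v (h.mem_vars hv)]
    rw [hproj, h.proj_fact] at hproj'
    simpa using List.map_inj_left.1 hproj' v hv
  · intro hsat
    obtain ⟨t, ht, hblock⟩ := h.complete i δ hsat
    obtain ⟨r₀, hr₀⟩ := h.nonempty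
    refine ⟨t, ht, ?_, fun t' ht' hk => ?_⟩
    · obtain ⟨θ, -, hθδ, rfl, -⟩ := (hblock t ht fun _ _ => rfl).2 r₀ hr₀
      rw [h.proj_fact]
      exact List.map_congr_left fun v hv => by rw [hθδ v hv]
    · obtain ⟨hW, hall⟩ := hblock t' ht' hk
      obtain ⟨θ, hθU, -, hθt, -⟩ := hall r₀ hr₀
      subst hθt
      refine ⟨Atom.matches_iff.2 ⟨θ, hθU, rfl⟩, hW, fun j hj => ?_⟩
      rw [h.look_child hj, ih' j hj]
      intro r hr
      obtain ⟨μ, hμU, -, hμt, hμ⟩ := hall r hr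
      obtain ⟨hjr, rfl⟩ := (h.mem_children i j).1 hj
      refine ⟨μ, hμU, fun v hv => ?_, fun x hx => ?_⟩
      · exact Atom.eqOn_of_fact_eq hμt ((h.mem_sh j hjr v).1 hv).2
      · refine hμ x (J.sub_child_subset j hjr hx) ?_
        rintro rfl
        exact J.par_notMem_sub j hjr hx

open Classical in
/-- A pass along a rooted join tree. -/
noncomputable def Pass.ofTree (U : Set V) (J : RootedJoinTree fun i => (b i).vars \ U)
    (shRoot : List V) (K W : (i : Fin n) → List V → Finset (Fin (S.arity (b i).rel))) : Pass b :=
  let sh : Fin n → List V := fun i => if i = J.root then shRoot else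
    (((b i).finite_vars.inter_of_left (b (J.par i)).vars).toFinset).toList
  { U := U
    K := fun i => K i (sh i)
    W := fun i => W i (sh i)
    children := fun i => (List.finRange n).filter fun j => j ≠ J.root ∧ J.par j = i
    sh := sh }

theorem Pass.ofTree_mem_children {U : Set V} {J : RootedJoinTree fun i => (b i).vars \ U}
    {shRoot : List V} {K W : (i : Fin n) → List V → Finset (Fin (S.arity (b i).rel))}
    (i j : Fin n) : j ∈ (Pass.ofTree U J shRoot K W).children i ↔ j ≠ J.root ∧ J.par j = i := by
  simp [Pass.ofTree]

theorem Pass.ofTree_mem_sh {U : Set V} {J : RootedJoinTree fun i => (b i).vars \ U}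
    {shRoot : List V} {K W : (i : Fin n) → List V → Finset (Fin (S.arity (b i).rel))}
    (i : Fin n) (hi : i ≠ J.root) (v : V) : v ∈ (Pass.ofTree U J shRoot K W).sh i ↔
      v ∈ (b i).vars ∧ v ∈ (b (J.par i)).vars := by
  simp [Pass.ofTree, hi]

theorem Pass.ofTree_sh_root {U : Set V} {J : RootedJoinTree fun i => (b i).vars \ U}
    {shRoot : List V} {K W : (i : Fin n) → List V → Finset (Fin (S.arity (b i).rel))} :
    (Pass.ofTree U J shRoot K W).sh J.root = shRoot := by
  simp [Pass.ofTree]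

/-- The pass that computes possible answers: every tuple is a block. -/
noncomputable def Pass.possible (U : Set V) (J : RootedJoinTree fun i => (b i).vars \ U)
    (shRoot : List V) : Pass b :=
  Pass.ofTree U J shRoot (fun _ _ => Finset.univ) (fun _ _ => ∅)

open Classical in
/-- The pass that decides whether the query is certain. -/
noncomputable def Pass.certain (U : Set V) (J : RootedJoinTree fun i => (b i).vars \ U) :
    Pass b :=
  Pass.ofTree U J [] (fun i _ => S.key (b i).rel)
    (fun i l => Finset.univ.filter fun p => ∃ v ∈ l, (b i).args p = .var v)

theorem Pass.mem_W_certain {U : Set V} {J : RootedJoinTree fun i => (b i).vars \ U} {i : Fin n}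
    {p : Fin (S.arity (b i).rel)} :
    p ∈ (Pass.certain U J).W i ↔ ∃ v ∈ (Pass.certain U J).sh i, (b i).args p = .var v := by
  simp [Pass.certain, Pass.ofTree]

/-- The pass that keeps only blocks with a single tuple. -/
noncomputable def Pass.singleton (U : Set V) (J : RootedJoinTree fun i => (b i).vars \ U) :
    Pass b :=
  Pass.ofTree U J [] (fun i _ => S.key (b i).rel) (fun _ _ => Finset.univ)

/-- With every tuple a block of its own and `db` as the only instance, the pass is the semijoin
reduction towards the root. -/
theorem Pass.fits_possible (U : Set V) (J : RootedJoinTree fun i => (b i).vars \ U)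
    (shRoot : List V) (hroot : ∀ v ∈ shRoot, v ∈ (b J.root).vars) (γ : V → D)
    (db : Instance S D) : (Pass.possible U J shRoot).Fits J γ db {db} where
  mem_children := Pass.ofTree_mem_children
  mem_sh := Pass.ofTree_mem_sh
  sh_root := by
    intro v hv
    exact hroot v (by simpa [Pass.possible, Pass.ofTree] using hv)
  agree := by
    intro i t t' hk _ _
    rw [show t' = t from funext fun p => hk p (Finset.mem_univ p)]
  sound := by
    rintro i t ht - r rfl
    exact ⟨t, ht, ht, fun _ _ => rfl⟩
  complete := by
    intro i δ h
    obtain ⟨θ, hU, hsh, hθ⟩ := h db rfl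
    refine ⟨(b i).fact θ, hθ i (J.mem_sub_self i), fun t' _ hk => ?_⟩
    have : t' = (b i).fact θ := funext fun p => hk p (Finset.mem_univ p)
    refine ⟨fun p _ => by rw [this], ?_⟩
    rintro r rfl
    exact ⟨θ, hU, hsh, this.symm, fun x hx _ => hθ x hx⟩
  nonempty := ⟨db, rfl⟩

/-- Blocks are formed by key and their tuples must agree everywhere, so a good block consists of a
single tuple, which is a fact of `db.consistentPart`. -/
theorem Pass.fits_singleton (U : Set V) (J : RootedJoinTree fun i => (b i).vars \ U) (γ : V → D)
    (db : Instance S D) : (Pass.singleton U J).Fits J γ db {db.consistentPart} where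
  mem_children := Pass.ofTree_mem_children
  mem_sh := Pass.ofTree_mem_sh
  sh_root := by
    intro v hv
    exact absurd (Pass.ofTree_sh_root (b := b) ▸ hv) List.not_mem_nil
  agree := by
    intro i t t' _ hW _
    rw [show t' = t from funext fun p => hW p (Finset.mem_univ p)]
  sound := by
    rintro i t ht hW r rfl
    exact ⟨t, Instance.mem_consistentPart.2 ⟨ht, fun t' ht' hk =>
      funext fun p => hW t' ht' hk p (Finset.mem_univ p)⟩, ht, fun _ _ => rfl⟩
  complete := by
    intro i δ h
    obtain ⟨θ, hU, hsh, hθ⟩ := h _ rfl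
    obtain ⟨ht, hu⟩ := Instance.mem_consistentPart.1 (hθ i (J.mem_sub_self i))
    refine ⟨(b i).fact θ, ht, fun t' ht' hk => ?_⟩
    have : t' = (b i).fact θ := hu t' ht' hk
    refine ⟨fun p _ => by rw [this], ?_⟩
    rintro r rfl
    exact ⟨θ, hU, hsh, this.symm, fun x hx _ => hθ x hx⟩
  nonempty := ⟨_, rfl⟩

/-- The field `complete` is `Unattacked.exists_block` with the fixed and the shared variables held
constant. Every fact of the block found there extends to a valuation with the prescribed shared
values, which is why the block agrees on the positions in `W`. -/
theorem Pass.fits_certain [Fintype S.Rel] (hsjf : Function.Injective fun i => (b i).rel)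
    (U : Set V) (J : RootedJoinTree fun i => (b i).vars \ U)
    (hun : ∀ i, Unattacked (fun i => (b i).vars \ U) (fun i => (b i).keyVars \ U) (J.sub i) i)
    (γ : V → D) (db : Instance S D) :
    (Pass.certain U J).Fits J γ db {r | db.IsRepair r} where
  mem_children := Pass.ofTree_mem_children
  mem_sh := Pass.ofTree_mem_sh
  sh_root := by
    intro v hv
    exact absurd (Pass.ofTree_sh_root (b := b) ▸ hv) List.not_mem_nil
  agree := by
    intro i t t' _ hW _
    refine List.map_congr_left fun v hv => ?_
    rw [Atom.look, Atom.look]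
    split_ifs with h
    · congr 1
      exact hW _ (Pass.mem_W_certain.2 ⟨v, hv, h.choose_spec⟩)
    · rfl
  sound := by
    rintro i t ht - r hr
    obtain ⟨t', ht', hk⟩ := (Instance.isRepair_iff.1 hr).2.1 _ t ht
    exact ⟨t', ht', hr.1 _ ht', hk⟩
  complete := by
    classical
    intro i δ h
    obtain ⟨r₀, hr₀⟩ := db.exists_isRepair
    set C := Pass.certain U J
    -- `Unattacked.exists_block` takes one valuation on one set, so `γ` on `U` and `δ` on the shared
    -- variables are merged. They must coincide on the overlap; `hγδ` reads this off a witness in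
    -- one repair.
    have hP : ∀ θ : V → D, (∀ v ∈ U ∪ {v | v ∈ C.sh i},
        θ v = (fun v => if v ∈ U then γ v else δ v) v) ∧ (∀ v ∈ U, v ∈ C.sh i → γ v = δ v) ↔
        (∀ v ∈ U, θ v = γ v) ∧ ∀ v ∈ C.sh i, θ v = δ v := by
      intro θ
      constructor
      · rintro ⟨h₁, h₂⟩
        refine ⟨fun v hv => by simpa [hv] using h₁ v (.inl hv), fun v hv => ?_⟩
        have := h₁ v (.inr hv)
        by_cases hvU : v ∈ U
        · simp only [hvU, if_true] at this
          rw [this, h₂ v hvU hv]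
        · simpa [hvU] using this
      · rintro ⟨h₁, h₂⟩
        refine ⟨fun v hv => ?_, fun v hv hv' => by rw [← h₁ v hv, h₂ v hv']⟩
        by_cases hvU : v ∈ U
        · simpa [hvU] using h₁ v hvU
        · simpa [hvU] using h₂ v (hv.resolve_left hvU)
    have hγδ : ∀ v ∈ U, v ∈ C.sh i → γ v = δ v := by
      obtain ⟨θ, h₁, h₂, -⟩ := h r₀ hr₀
      exact ((hP θ).2 ⟨h₁, h₂⟩).2
    obtain ⟨t, ht, hblock⟩ := (hun i).exists_block hsjf (J.mem_sub_self i)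
      (P := U ∪ {v | v ∈ C.sh i}) (γ := fun v => if v ∈ U then γ v else δ v) (db := db)
      Set.subset_union_left (fun r hr => by
        obtain ⟨θ, h₁, h₂, hθ⟩ := h r hr
        exact ⟨θ, ((hP θ).2 ⟨h₁, h₂⟩).1, hθ⟩)
    have hblock' : ∀ t' ∈ db (b i).rel, KeyEq t' t → ∀ r, db.IsRepair r → ∃ θ : V → D,
        (∀ v ∈ U, θ v = γ v) ∧ (∀ v ∈ C.sh i, θ v = δ v) ∧ (b i).fact θ = t' ∧
        ∀ x ∈ J.sub i, x ≠ i → (b x).Holds θ r := by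
      intro t' ht' hk r hr
      obtain ⟨θ, h₁, h₂, h₃⟩ := hblock t' ht' hk r hr
      have := (hP θ).1 ⟨h₁, hγδ⟩
      exact ⟨θ, this.1, this.2, h₂, h₃⟩
    refine ⟨t, ht, fun t' ht' hk => ⟨fun p hp => ?_, fun r hr => hblock' t' ht' hk r hr⟩⟩
    obtain ⟨v, hv, hpv⟩ := Pass.mem_W_certain.1 hp
    obtain ⟨θ, -, h₂, rfl, -⟩ := hblock' t ht (KeyEq.refl t) r₀ hr₀
    obtain ⟨θ', -, h₂', rfl, -⟩ := hblock' t' ht' hk r₀ hr₀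
    simp [Atom.fact, hpv, Term.eval, h₂ v hv, h₂' v hv]
  nonempty := db.exists_isRepair

end Pass

/-! ### Loop-free programs and the rule for counting loops -/

section Programs

variable {S : Schema} {D : Type*}

/-- A program without loops. -/
def Program.LoopFree : Program S D → Prop
  | .instr _ => True
  | .seq P Q => P.LoopFree ∧ Q.LoopFree
  | .ite _ _ P Q => P.LoopFree ∧ Q.LoopFree
  | .loop _ _ _ => False

open Classical in
/-- The final state of a loop-free program. -/
noncomputable def Program.run (inp : Input S D) : Program S D → State D → State D
  | .instr i, s => i.step inp s
  | .seq P Q, s => Q.run inp (P.run inp s)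
  | .ite r r' P Q, s => if s.reg r = s.reg r' then P.run inp s else Q.run inp s
  | .loop _ _ _, s => s

/-- A bound on the number of steps of a loop-free program. -/
def Program.cost : Program S D → ℕ
  | .instr _ => 1
  | .seq P Q => P.cost + Q.cost
  | .ite _ _ P Q => max P.cost Q.cost + 1
  | .loop _ _ _ => 0

theorem Program.LoopFree.exec {inp : Input S D} {P : Program S D} (h : P.LoopFree) (s : State D) :
    ∃ t ≤ P.cost, Exec inp P s (P.run inp s) t := by
  induction P generalizing s with
  | instr i => exact ⟨1, le_rfl, .instr i s⟩
  | seq P Q ihP ihQ =>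
    obtain ⟨t₁, h₁, e₁⟩ := ihP h.1 s
    obtain ⟨t₂, h₂, e₂⟩ := ihQ h.2 (P.run inp s)
    exact ⟨t₁ + t₂, Nat.add_le_add h₁ h₂, .seq e₁ e₂⟩
  | ite r r' P Q ihP ihQ =>
    by_cases hr : s.reg r = s.reg r'
    · obtain ⟨t, ht, e⟩ := ihP h.1 s
      refine ⟨t + 1, ?_, ?_⟩
      · simp only [Program.cost]
        omega
      · rw [Program.run, if_pos hr]
        exact .ite_eq hr e
    · obtain ⟨t, ht, e⟩ := ihQ h.2 s
      refine ⟨t + 1, ?_, ?_⟩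
      · simp only [Program.cost]
        omega
      · rw [Program.run, if_neg hr]
        exact .ite_ne hr e
  | loop => exact h.elim

/-- A program that does nothing. -/
def Program.skip : Program S D := .instr (.copy 0 0)

@[simp] theorem Program.run_skip (inp : Input S D) (s : State D) :
    (Program.skip : Program S D).run inp s = s := by
  simp [Program.skip, Program.run, Instr.step, State.set]

@[simp] theorem Program.loopFree_skip : (Program.skip : Program S D).LoopFree := trivial

/-- The sequential composition of a list of programs. -/
def Program.block : List (Program S D) → Program S D
  | [] => .skip
  | P :: l => .seq P (block l)

@[simp] theorem Program.run_block_nil (inp : Input S D) (s : State D) :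
    (Program.block [] : Program S D).run inp s = s := Program.run_skip inp s

@[simp] theorem Program.run_block_cons (inp : Input S D) (P : Program S D)
    (l : List (Program S D)) (s : State D) :
    (Program.block (P :: l)).run inp s = (Program.block l).run inp (P.run inp s) := rfl

@[simp] theorem Program.loopFree_block {l : List (Program S D)} :
    (Program.block l).LoopFree ↔ ∀ P ∈ l, P.LoopFree := by
  induction l with
  | nil => simp [Program.block]
  | cons P l ih => simp [Program.block, Program.LoopFree, ih]

@[simp] theorem Program.loopFree_instr (i : Instr S D) : (Program.instr i).LoopFree := trivial

@[simp] theorem Program.loopFree_seq {P Q : Program S D} :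
    (Program.seq P Q).LoopFree ↔ P.LoopFree ∧ Q.LoopFree := Iff.rfl

@[simp] theorem Program.loopFree_ite {r r' : ℕ} {P Q : Program S D} :
    (Program.ite r r' P Q).LoopFree ↔ P.LoopFree ∧ Q.LoopFree := Iff.rfl

@[simp] theorem Program.run_seq (inp : Input S D) (P Q : Program S D) (s : State D) :
    (Program.seq P Q).run inp s = Q.run inp (P.run inp s) := rfl

open Classical in
theorem Program.run_ite (inp : Input S D) (r r' : ℕ) (P Q : Program S D) (s : State D) :
    (Program.ite r r' P Q).run inp s =
      if s.reg r = s.reg r' then P.run inp s else Q.run inp s := rfl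

theorem Program.run_ite_of_eq (inp : Input S D) {r r' : ℕ} (P Q : Program S D) {s : State D}
    (h : s.reg r = s.reg r') : (Program.ite r r' P Q).run inp s = P.run inp s := by
  rw [Program.run_ite, if_pos h]

theorem Program.run_ite_of_ne (inp : Input S D) {r r' : ℕ} (P Q : Program S D) {s : State D}
    (h : s.reg r ≠ s.reg r') : (Program.ite r r' P Q).run inp s = Q.run inp s := by
  rw [Program.run_ite, if_neg h]

@[simp] theorem Program.run_instr (inp : Input S D) (i : Instr S D) (s : State D) :
    (Program.instr i).run inp s = i.step inp s := rfl

/-- Run `P` for all tuple positions of `R` in the register `i`; `l` holds the number of tuples. -/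
def Program.forEach (i l : ℕ) (R : S.Rel) (P : Program S D) : Program S D :=
  .seq (.instr (.lit i (.inr 0))) (.seq (.instr (.size l R))
    (.loop i l (.seq P (.instr (.succ i)))))

/-- The loop rule. The invariant `I` may speak about the time that the loop body has used. -/
theorem exec_forEach {inp : Input S D} {i l : ℕ} {R : S.Rel} {P : Program S D} (hil : l ≠ i)
    (I : ℕ → ℕ → State D → Prop) {s : State D}
    (h0 : I 0 0 ((s.set i (.inr 0)).set l (.inr (inp R).length)))
    (hstep : ∀ m < (inp R).length, ∀ n s, I m n s → s.reg i = .inr m →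
      s.reg l = .inr (inp R).length → ∃ s' t, Exec inp P s s' t ∧ s'.reg i = .inr m ∧
        s'.reg l = .inr (inp R).length ∧ I (m + 1) (n + t) (s'.set i (.inr (m + 1)))) :
    ∃ s' t n, Exec inp (Program.forEach i l R P) s s' t ∧ t ≤ n + 2 * (inp R).length + 3 ∧
      I (inp R).length n s' := by
  -- Induction on the number `d` of remaining rounds. Besides its body, a round costs one test and
  -- one increment; the final test adds one step.
  have loop : ∀ d m, m + d = (inp R).length → ∀ n s, I m n s → s.reg i = .inr m →
      s.reg l = .inr (inp R).length → ∃ s' t n', Exec inp (.loop i l (.seq P (.instr (.succ i))))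
        s s' t ∧ t + n ≤ n' + 2 * d + 1 ∧ I (inp R).length n' s' := by
    intro d
    induction d with
    | zero =>
      intro m hm n s hI hi hl
      refine ⟨s, 1, n, .loop_eq (by rw [hi, hl, ← hm]; rfl), by omega, ?_⟩
      rwa [← hm]
    | succ d ih =>
      intro m hm n s hI hi hl
      obtain ⟨s₁, t₁, e₁, hi₁, hl₁, hI₁⟩ := hstep m (by omega) n s hI hi hl
      have hsucc : (Instr.succ i : Instr S D).step inp s₁ = s₁.set i (.inr (m + 1)) := by
        simp [Instr.step, hi₁, Word.mapNat]
      have e₂ := Exec.instr (inp := inp) (Instr.succ i) s₁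
      rw [hsucc] at e₂
      obtain ⟨s', t, n', e, ht, hI'⟩ := ih (m + 1) (by omega) (n + t₁) _ hI₁
        (by simp [State.set]) (by simp [State.set, hil, hl₁])
      refine ⟨s', t₁ + 1 + t + 1, n', .loop_ne ?_ (.seq e₁ e₂) e, by omega, hI'⟩
      rw [hi, hl]
      intro h
      have := Sum.inr.inj h
      omega
  obtain ⟨s', t, n, e, ht, hI⟩ := loop _ 0 (Nat.zero_add _) 0 _ h0 (by simp [State.set, hil.symm])
    (by simp [State.set])
  refine ⟨s', 1 + (1 + t), n, .seq (.instr _ _) (.seq (.instr _ _) ?_), by omega, hI⟩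
  simpa [Instr.step] using e

theorem exec_forEach_loopFree {inp : Input S D} {i l : ℕ} {R : S.Rel} {P : Program S D}
    (hil : l ≠ i) (hP : P.LoopFree) (I : ℕ → State D → Prop) {s : State D}
    (h0 : I 0 ((s.set i (.inr 0)).set l (.inr (inp R).length)))
    (hstep : ∀ m < (inp R).length, ∀ s, I m s → s.reg i = .inr m →
      s.reg l = .inr (inp R).length → (P.run inp s).reg i = .inr m ∧
        (P.run inp s).reg l = .inr (inp R).length ∧
        I (m + 1) ((P.run inp s).set i (.inr (m + 1)))) :
    ∃ s', (∃ t ≤ (P.cost + 3) * ((inp R).length + 1),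
      Exec inp (Program.forEach i l R P) s s' t) ∧ I (inp R).length s' := by
  obtain ⟨s', t, n, e, ht, hn, hI⟩ := exec_forEach (inp := inp) (P := P) hil
    (fun m n s => n ≤ m * P.cost ∧ I m s) (s := s) ⟨by simp, h0⟩ (by
      rintro m hm n s ⟨hn, hI⟩ hi hl
      obtain ⟨h₁, h₂, h₃⟩ := hstep m hm s hI hi hl
      obtain ⟨t, ht, e⟩ := hP.exec (inp := inp) s
      refine ⟨_, t, e, h₁, h₂, ?_, h₃⟩
      rw [Nat.add_mul]
      omega)
  refine ⟨s', ⟨t, ?_, e⟩, hI⟩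
  nlinarith

end Programs

/-! ### Register layout and memory addresses -/

section Registers

/-- Register numbers: a kind and two indices. -/
def rg (a i j : ℕ) : ℕ := Nat.pair a (Nat.pair i j)

@[simp] theorem rg_inj {a i j a' i' j' : ℕ} :
    rg a i j = rg a' i' j' ↔ a = a' ∧ i = i' ∧ j = j' := by
  simp [rg, Nat.pair_eq_pair]

/-- The kind of a register. -/
def rkind (r : ℕ) : ℕ := (Nat.unpair r).1

@[simp] theorem rkind_rg (a i j : ℕ) : rkind (rg a i j) = a := by simp [rkind, rg]

/-- The register for the first component of an address. -/
def rTag : ℕ := rg 0 0 0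
/-- A scratch register. -/
def rX : ℕ := rg 1 0 0
/-- A scratch register. -/
def rY : ℕ := rg 2 0 0
/-- The register for the result of a test. -/
def rFlag : ℕ := rg 3 0 0
/-- The register for the position in a pass over a table. -/
def rIdx : ℕ := rg 4 0 0
/-- The register for the number of tuples in a pass over a table. -/
def rLim : ℕ := rg 5 0 0
/-- The register for the number of the current pass. -/
def rStamp : ℕ := rg 6 0 0
/-- The register that holds the number 0. -/
def rZero : ℕ := rg 7 0 0
/-- The register that holds the number 1. -/
def rOne : ℕ := rg 8 0 0
/-- The register for attribute `p` of the current tuple of atom `i`. -/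
def rTup (i p : ℕ) : ℕ := rg 9 i p
/-- The register for the value of the free variable `j`. -/
def rVal (j : ℕ) : ℕ := rg 10 j 0
/-- The register for the position in the loop over values of the free variable `j`. -/
def rPos (j : ℕ) : ℕ := rg 11 j 0
/-- The register for the bound in the loop over values of the free variable `j`. -/
def rEnd (j : ℕ) : ℕ := rg 12 j 0
/-- The register for the number of the pass for the free variable `j`. -/
def rPass (j : ℕ) : ℕ := rg 13 j 0
/-- The register for the linked list of atom `i`. -/
def rPtr (i : ℕ) : ℕ := rg 14 i 0

variable {D : Type*}

/-- The address of a memory cell: a kind of table, an atom, the number of a pass, and a key. -/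
def cell (a i σ : ℕ) (ws : List (Word D)) : List (Word D) :=
  .inr (Nat.pair a i) :: .inr σ :: ws

@[simp] theorem cell_inj {a i σ a' i' σ' : ℕ} {ws ws' : List (Word D)} :
    cell a i σ ws = cell a' i' σ' ws' ↔ a = a' ∧ i = i' ∧ σ = σ' ∧ ws = ws' := by
  simp [cell, Nat.pair_eq_pair, and_assoc]

theorem State.set_reg (s : State D) (r : ℕ) (w : Word D) (x : ℕ) :
    (s.set r w).reg x = if x = r then w else s.reg x := by
  simp [State.set, Function.update_apply]

@[simp] theorem State.set_mem (s : State D) (r : ℕ) (w : Word D) : (s.set r w).mem = s.mem := rfl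

@[simp] theorem State.set_out (s : State D) (r : ℕ) (w : Word D) : (s.set r w).out = s.out := rfl

@[simp] theorem State.set_reg_self (s : State D) (r : ℕ) (w : Word D) :
    (s.set r w).reg r = w := by simp [State.set]

theorem State.set_reg_of_ne (s : State D) {r x : ℕ} (w : Word D) (h : x ≠ r) :
    (s.set r w).reg x = s.reg x := by simp [State.set, h]

/-- The states agree except for the registers of the kinds in `B`. -/
structure State.SameExcept (B : Set ℕ) (s s' : State D) : Prop where
  mem : s.mem = s'.mem
  out : s.out = s'.out
  reg : ∀ r, rkind r ∉ B → s.reg r = s'.reg r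

theorem State.SameExcept.refl (B : Set ℕ) (s : State D) : State.SameExcept B s s :=
  ⟨rfl, rfl, fun _ _ => rfl⟩

theorem State.SameExcept.trans {B : Set ℕ} {s s' s'' : State D} (h : State.SameExcept B s s')
    (h' : State.SameExcept B s' s'') : State.SameExcept B s s'' :=
  ⟨h.mem.trans h'.mem, h.out.trans h'.out, fun r hr => (h.reg r hr).trans (h'.reg r hr)⟩

theorem State.SameExcept.set {B : Set ℕ} {s s' : State D} (h : State.SameExcept B s s') {r : ℕ}
    (hr : rkind r ∈ B) (w : Word D) : State.SameExcept B (s.set r w) s' :=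
  ⟨h.mem, h.out, fun x hx => by
    rw [State.set_reg_of_ne _ _ (by rintro rfl; exact hx hr), h.reg x hx]⟩

end Registers

/-! ### Tests that accumulate in a flag -/

section Tests

variable {S : Schema} {D : Type*}

/-- The kinds of the scratch registers. -/
def scratch : Set ℕ := {a | a < 4}

open Classical in
/-- Started in a state that agrees with `s₀` except for scratch registers, the program clears the
flag unless `p` holds. -/
structure IsTest (inp : Input S D) (P : Program S D) (s₀ : State D) (p : Prop) : Prop where
  loopFree : P.LoopFree
  run : ∀ s, State.SameExcept scratch s s₀ → State.SameExcept scratch (P.run inp s) s₀ ∧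
    (P.run inp s).reg rFlag = if p then s.reg rFlag else .inr 0

/-- A test can only clear the flag, never set it, so running tests in sequence computes their
conjunction. -/
theorem IsTest.block {inp : Input S D} {s₀ : State D} {α : Type*} (l : List α)
    {P : α → Program S D} {p : α → Prop} (h : ∀ x ∈ l, IsTest inp (P x) s₀ (p x)) :
    IsTest inp (Program.block (l.map P)) s₀ (∀ x ∈ l, p x) := by
  classical
  induction l with
  | nil => exact ⟨by simp, fun s hs => by simpa using hs⟩
  | cons x l ih =>
    have hx := h x (by simp)
    have hl := ih fun y hy => h y (by simp [hy])
    refine ⟨by simpa using ⟨hx.loopFree, by simpa using hl.loopFree⟩, fun s hs => ?_⟩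
    obtain ⟨h₁, h₂⟩ := hx.run s hs
    obtain ⟨h₃, h₄⟩ := hl.run _ h₁
    refine ⟨h₃, ?_⟩
    rw [List.map_cons, Program.run_block_cons, h₄, h₂]
    by_cases hpx : p x <;> by_cases hpl : ∀ y ∈ l, p y <;> simp [hpx, hpl]

theorem IsTest.seq {inp : Input S D} {s₀ : State D} {P Q : Program S D} {p q : Prop}
    (hP : IsTest inp P s₀ p) (hQ : IsTest inp Q s₀ q) : IsTest inp (.seq P Q) s₀ (p ∧ q) := by
  classical
  refine ⟨⟨hP.loopFree, hQ.loopFree⟩, fun s hs => ?_⟩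
  obtain ⟨h₁, h₂⟩ := hP.run s hs
  obtain ⟨h₃, h₄⟩ := hQ.run _ h₁
  refine ⟨h₃, ?_⟩
  rw [Program.run_seq, h₄, h₂]
  by_cases hp : p <;> by_cases hq : q <;> simp [hp, hq]

/-- Clear the flag unless the registers are equal. -/
def testEq (r r' : ℕ) : Program S D := .ite r r' .skip (.instr (.lit rFlag (.inr 0)))

theorem isTest_testEq {inp : Input S D} {s₀ : State D} {r r' : ℕ} (hr : rkind r ∉ scratch)
    (hr' : rkind r' ∉ scratch) : IsTest inp (testEq r r') s₀ (s₀.reg r = s₀.reg r') := by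
  classical
  refine ⟨by simp [testEq], fun s hs => ?_⟩
  rw [testEq, Program.run_ite, hs.reg r hr, hs.reg r' hr']
  split_ifs with h
  · simpa using hs
  · simpa [Instr.step] using hs.set (by simp [rFlag, scratch]) _

/-- Clear the flag unless the register holds the constant. -/
def testConst (r : ℕ) (d : D) : Program S D :=
  .seq (.instr (.lit rX (.inl d))) (.ite r rX .skip (.instr (.lit rFlag (.inr 0))))

theorem isTest_testConst {inp : Input S D} {s₀ : State D} {r : ℕ} (d : D)
    (hr : rkind r ∉ scratch) : IsTest inp (testConst r d) s₀ (s₀.reg r = .inl d) := by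
  classical
  refine ⟨by simp [testConst], fun s hs => ?_⟩
  have hrX : r ≠ rX := by
    rintro rfl
    exact hr (by simp [rX, scratch])
  have hs' : State.SameExcept scratch (s.set rX (.inl d)) s₀ :=
    hs.set (by simp [rX, scratch]) _
  have hF : rFlag ≠ rX := by simp [rFlag, rX]
  rw [testConst, Program.run_seq, Program.run_ite]
  simp only [Program.run_instr, Instr.step, State.set_reg_self, State.set_reg_of_ne _ _ hrX,
    hs.reg r hr, Program.run_skip]
  split_ifs with h
  · exact ⟨hs', State.set_reg_of_ne _ _ hF⟩
  · exact ⟨hs'.set (by simp [rFlag, scratch]) _, State.set_reg_self _ _ _⟩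

/-- Load into `r` the memory cell of the given table at the key in the registers `a`. -/
def loadCell (r k i st : ℕ) (a : List ℕ) : Program S D :=
  .seq (.instr (.lit rTag (.inr (Nat.pair k i)))) (.instr (.load r (rTag :: st :: a)))

/-- Store `r` into the memory cell of the given table at the key in the registers `a`. -/
def storeCell (k i st : ℕ) (a : List ℕ) (r : ℕ) : Program S D :=
  .seq (.instr (.lit rTag (.inr (Nat.pair k i)))) (.instr (.store (rTag :: st :: a) r))

theorem map_set_reg (s : State D) (r : ℕ) (w : Word D) {a : List ℕ} (ha : r ∉ a) :
    a.map (s.set r w).reg = a.map s.reg := by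
  refine List.map_congr_left fun x hx => State.set_reg_of_ne _ _ ?_
  rintro rfl
  exact ha hx

theorem run_loadCell {inp : Input S D} {s : State D} {r k i st σ : ℕ} {a : List ℕ}
    (hst : s.reg st = .inr σ) (hst' : st ≠ rTag) (ha : rTag ∉ a) :
    (loadCell r k i st a : Program S D).run inp s =
      (s.set rTag (.inr (Nat.pair k i))).set r (s.mem (cell k i σ (a.map s.reg))) := by
  simp [loadCell, Instr.step, map_set_reg _ _ _ ha, State.set_reg_of_ne _ _ hst', hst, cell]

open Classical in
theorem run_storeCell {inp : Input S D} {s : State D} {r k i st σ : ℕ} {a : List ℕ}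
    (hst : s.reg st = .inr σ) (hst' : st ≠ rTag) (ha : rTag ∉ a) (hr : r ≠ rTag) :
    (storeCell k i st a r : Program S D).run inp s =
      { s.set rTag (.inr (Nat.pair k i)) with
        mem := Function.update s.mem (cell k i σ (a.map s.reg)) (s.reg r) } := by
  simp [storeCell, Instr.step, map_set_reg _ _ _ ha, State.set_reg_of_ne _ _ hst',
    State.set_reg_of_ne _ _ hr, hst, cell]

@[simp] theorem loopFree_loadCell {r k i st : ℕ} {a : List ℕ} :
    (loadCell r k i st a : Program S D).LoopFree := ⟨trivial, trivial⟩

@[simp] theorem loopFree_storeCell {r k i st : ℕ} {a : List ℕ} :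
    (storeCell k i st a r : Program S D).LoopFree := ⟨trivial, trivial⟩

theorem notMem_of_rkind {r : ℕ} {a : List ℕ} (h : ∀ x ∈ a, rkind x ∉ scratch)
    (hr : rkind r ∈ scratch) : r ∉ a := fun hx => h r hx hr

theorem State.SameExcept.map_reg {B : Set ℕ} {s s' : State D} (h : State.SameExcept B s s')
    {a : List ℕ} (ha : ∀ x ∈ a, rkind x ∉ B) : a.map s.reg = a.map s'.reg :=
  List.map_congr_left fun x hx => h.reg x (ha x hx)

/-- Clear the flag if the memory cell holds 0. -/
def testCell (k i : ℕ) (a : List ℕ) : Program S D :=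
  .seq (loadCell rX k i rStamp a) (.ite rX rZero (.instr (.lit rFlag (.inr 0))) .skip)

theorem isTest_testCell {inp : Input S D} {s₀ : State D} {k i σ : ℕ} {a : List ℕ}
    (hst : s₀.reg rStamp = .inr σ) (hz : s₀.reg rZero = .inr 0)
    (ha : ∀ x ∈ a, rkind x ∉ scratch) :
    IsTest inp (testCell k i a) s₀ (s₀.mem (cell k i σ (a.map s₀.reg)) ≠ .inr 0) := by
  classical
  refine ⟨by simp [testCell], fun s hs => ?_⟩
  rw [testCell, Program.run_seq, run_loadCell (σ := σ)
    (by rw [hs.reg _ (by simp [rStamp, scratch]), hst]) (by simp [rStamp, rTag])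
    (notMem_of_rkind ha (by simp [rTag, scratch])), Program.run_ite, hs.mem, hs.map_reg ha]
  have hs' := ((hs.set (r := rTag) (by simp [rTag, scratch])
    (.inr (Nat.pair k i))).set (r := rX) (by simp [rX, scratch])
    (s₀.mem (cell k i σ (a.map s₀.reg))))
  rw [State.set_reg_self, hs'.reg rZero (by simp [rZero, scratch]), hz]
  by_cases h : s₀.mem (cell k i σ (a.map s₀.reg)) = .inr 0
  · rw [if_pos h, if_neg (not_not.2 h)]
    exact ⟨hs'.set (by simp [rFlag, scratch]) _, State.set_reg_self _ _ _⟩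
  · rw [if_neg h, if_pos h]
    refine ⟨by simpa using hs', ?_⟩
    simp [State.set_reg, rFlag, rX, rTag]

/-- Clear the flag unless attribute `p` of the tuple of `R` at the position stored in the memory
cell equals register `r`. -/
def testAttr (k i : ℕ) (a : List ℕ) (R : S.Rel) (p : Fin (S.arity R)) (r : ℕ) : Program S D :=
  .seq (loadCell rX k i rStamp a) (.seq (.instr (.read rY R rX p))
    (.ite rY r .skip (.instr (.lit rFlag (.inr 0)))))

theorem isTest_testAttr {inp : Input S D} {s₀ : State D} {k i σ : ℕ} {a : List ℕ} {R : S.Rel}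
    {p : Fin (S.arity R)} {r : ℕ} (hst : s₀.reg rStamp = .inr σ)
    (ha : ∀ x ∈ a, rkind x ∉ scratch) (hr : rkind r ∉ scratch) :
    IsTest inp (testAttr k i a R p r) s₀
      (inp.get R (s₀.mem (cell k i σ (a.map s₀.reg))) p = s₀.reg r) := by
  classical
  refine ⟨by simp [testAttr], fun s hs => ?_⟩
  rw [testAttr, Program.run_seq, run_loadCell (σ := σ)
    (by rw [hs.reg _ (by simp [rStamp, scratch]), hst]) (by simp [rStamp, rTag])
    (notMem_of_rkind ha (by simp [rTag, scratch])), hs.mem, hs.map_reg ha, Program.run_seq,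
    Program.run_ite]
  have hs' := ((hs.set (r := rTag) (by simp [rTag, scratch])
    (.inr (Nat.pair k i))).set (r := rX) (by simp [rX, scratch])
    (s₀.mem (cell k i σ (a.map s₀.reg))))
  simp only [Program.run_instr, Instr.step, State.set_reg_self]
  have hs'' := hs'.set (r := rY) (by simp [rY, scratch])
    (inp.get R (s₀.mem (cell k i σ (a.map s₀.reg))) p)
  rw [hs''.reg r hr]
  split_ifs with h
  · refine ⟨by simpa using hs'', ?_⟩
    simp [State.set_reg, rFlag, rX, rTag, rY]
  · exact ⟨hs''.set (by simp [rFlag, scratch]) _, State.set_reg_self _ _ _⟩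

end Tests

/-! ### The loop bodies that process one atom -/

section NodePass

/-- The states have the same output and agree on the registers outside the kinds in `B`. -/
structure State.Frame {D : Type*} (B : Set ℕ) (s s' : State D) : Prop where
  out : s.out = s'.out
  reg : ∀ r, rkind r ∉ B → s.reg r = s'.reg r

theorem State.Frame.refl {D : Type*} (B : Set ℕ) (s : State D) : State.Frame B s s :=
  ⟨rfl, fun _ _ => rfl⟩

theorem State.Frame.trans {D : Type*} {B : Set ℕ} {s s' s'' : State D} (h : State.Frame B s s')
    (h' : State.Frame B s' s'') : State.Frame B s s'' :=
  ⟨h.out.trans h'.out, fun r hr => (h.reg r hr).trans (h'.reg r hr)⟩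

theorem State.Frame.mono {D : Type*} {B B' : Set ℕ} {s s' : State D} (h : State.Frame B s s')
    (hB : B ⊆ B') : State.Frame B' s s' :=
  ⟨h.out, fun r hr => h.reg r fun h => hr (hB h)⟩

theorem State.SameExcept.frame {D : Type*} {B : Set ℕ} {s s' : State D}
    (h : State.SameExcept B s s') : State.Frame B s s' :=
  ⟨h.out, h.reg⟩

theorem State.Frame.set {D : Type*} {B : Set ℕ} {s s' : State D} (h : State.Frame B s s')
    {r : ℕ} (hr : rkind r ∈ B) (w : Word D) : State.Frame B (s.set r w) s' :=
  ⟨h.out, fun x hx => by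
    rw [State.set_reg_of_ne _ _ (by rintro rfl; exact hx hr), h.reg x hx]⟩

theorem State.Frame.set_mem {D : Type*} {B : Set ℕ} {s s' : State D} (h : State.Frame B s s')
    (f : List (Word D) → Word D) : State.Frame B { s with mem := f } s' :=
  ⟨h.out, h.reg⟩

theorem State.Frame.map_reg {D : Type*} {B : Set ℕ} {s s' : State D} (h : State.Frame B s s')
    {a : List ℕ} (ha : ∀ x ∈ a, rkind x ∉ B) : a.map s.reg = a.map s'.reg :=
  List.map_congr_left fun x hx => h.reg x (ha x hx)

/-- The kinds of the registers used by the loop body of a pass over a table. -/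
def bodyKinds : Set ℕ := {a | a < 4 ∨ a = 9}

/-- The kinds of the registers used by a pass over a table. -/
def passKinds : Set ℕ := {a | a < 6 ∨ a = 9}

theorem scratch_subset_bodyKinds : scratch ⊆ bodyKinds := fun _ h => .inl h

theorem bodyKinds_subset_passKinds : bodyKinds ⊆ passKinds := by
  rintro a (h | h)
  exacts [.inl (Nat.lt_of_lt_of_le h (by norm_num)), .inr h]

variable {S : Schema} {V D : Type*} {n : ℕ} {b : Body S V D (Fin n)}

/-- Registers are dealt with by the frame conditions, so the invariant `J` of a table scan speaks
about memory only. The kinds a body may change exclude the position and the limit of the scan. -/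
theorem exec_tableLoop {inp : Input S D} {R : S.Rel} {P : Program S D} (hP : P.LoopFree)
    {s₀ : State D} (J : ℕ → (List (Word D) → Word D) → Prop) (h0 : J 0 s₀.mem)
    (hstep : ∀ m t, (inp R)[m]? = some t → ∀ s, State.Frame passKinds s s₀ →
      s.reg rIdx = .inr m → J m s.mem →
      State.Frame bodyKinds (P.run inp s) s ∧ J (m + 1) (P.run inp s).mem) :
    ∃ s', (∃ t ≤ (P.cost + 3) * ((inp R).length + 1),
      Exec inp (Program.forEach rIdx rLim R P) s₀ s' t) ∧
      State.Frame passKinds s' s₀ ∧ J (inp R).length s'.mem := by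
  refine exec_forEach_loopFree (by simp [rLim, rIdx]) hP
    (fun m s => State.Frame passKinds s s₀ ∧ J m s.mem) ⟨?_, h0⟩ ?_
  · exact ((State.Frame.refl _ _).set (by simp [rIdx, passKinds]) _).set
      (by simp [rLim, passKinds]) _
  · rintro m hm s ⟨hF, hJ⟩ hi hl
    obtain ⟨h₁, h₂⟩ := hstep m _ (List.getElem?_eq_getElem hm) s hF hi hJ
    refine ⟨?_, ?_, ?_, h₂⟩
    · rw [h₁.reg _ (by simp [rIdx, bodyKinds]), hi]
    · rw [h₁.reg _ (by simp [rLim, bodyKinds]), hl]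
    · exact ((h₁.mono bodyKinds_subset_passKinds).trans hF).set (by simp [rIdx, passKinds]) _

/-- Read the tuple of atom `i` at the position in `rIdx`. -/
def readTuple (b : Body S V D (Fin n)) (i : Fin n) : Program S D :=
  Program.block ((List.finRange (S.arity (b i).rel)).map fun p : Fin (S.arity (b i).rel) =>
    .instr (.read (rTup i p) (b i).rel rIdx p))

theorem loopFree_readTuple (i : Fin n) : (readTuple b i).LoopFree := by
  simp [readTuple]

theorem run_readTuple {inp : Input S D} {i : Fin n} {s : State D} {m : ℕ}
    {t : Tuple S D (b i).rel} (hm : s.reg rIdx = .inr m) (ht : (inp (b i).rel)[m]? = some t) :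
    State.SameExcept {9} ((readTuple b i).run inp s) s ∧
      (∀ r, (∀ p, r ≠ rTup i p) → ((readTuple b i).run inp s).reg r = s.reg r) ∧
      ∀ p : Fin (S.arity (b i).rel), ((readTuple b i).run inp s).reg (rTup i p) = .inl (t p) := by
  -- Generalised over the positions still to be read: an attribute ends up correct if it is yet to
  -- be read or is correct already.
  have : ∀ (l : List (Fin (S.arity (b i).rel))) (s : State D), s.reg rIdx = .inr m →
      State.SameExcept {9} ((Program.block (l.map fun p : Fin (S.arity (b i).rel) =>
        .instr (.read (rTup i p) (b i).rel rIdx p))).run inp s) s ∧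
      (∀ r, (∀ p, r ≠ rTup i p) → ((Program.block (l.map fun p : Fin (S.arity (b i).rel) =>
        .instr (.read (rTup i p) (b i).rel rIdx p))).run inp s).reg r = s.reg r) ∧
      ∀ p : Fin (S.arity (b i).rel), p ∈ l ∨ s.reg (rTup i p) = .inl (t p) →
        ((Program.block (l.map fun p : Fin (S.arity (b i).rel) =>
        .instr (.read (rTup i p) (b i).rel rIdx p))).run inp s).reg (rTup i p) = .inl (t p) := by
    intro l
    induction l with
    | nil =>
      intro s _
      simpa using State.SameExcept.refl _ _
    | cons p l ih =>
      intro s hs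
      have hrun : (Program.instr (.read (rTup i p) (b i).rel rIdx p)).run inp s =
          s.set (rTup i p) (.inl (t p)) := by
        simp [Instr.step, Input.get, hs, ht]
      rw [List.map_cons, Program.run_block_cons, hrun]
      obtain ⟨h₁, h₂, h₃⟩ := ih (s.set (rTup i p) (.inl (t p)))
        (by rw [State.set_reg_of_ne _ _ (by simp [rIdx, rTup]), hs])
      refine ⟨h₁.trans ((State.SameExcept.refl _ _).set (by simp [rTup]) _), fun r hr => ?_,
        fun q hq => h₃ q ?_⟩
      · rw [h₂ r hr, State.set_reg_of_ne _ _ (hr _)]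
      · by_cases hqp : q = p
        · subst hqp
          exact .inr (State.set_reg_self _ _ _)
        · rcases hq with hq | hq
          · exact .inl ((List.mem_cons.1 hq).resolve_left hqp)
          · right
            rw [State.set_reg_of_ne _ _ (by simp [rTup, Fin.val_inj, hqp]), hq]
  obtain ⟨h₁, h₂, h₃⟩ := this (List.finRange _) s hm
  exact ⟨h₁, h₂, fun p => h₃ p (.inl (List.mem_finRange p))⟩

open Classical in
/-- The register that holds the value of the variable `v` in the current tuple of atom `i`. -/
noncomputable def vreg (b : Body S V D (Fin n)) (i : Fin n) (v : V) : ℕ :=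
  if h : ∃ p, (b i).args p = .var v then rTup i h.choose else rZero

theorem reg_vreg {s : State D} {i : Fin n} {t : Tuple S D (b i).rel} (hz : s.reg rZero = .inr 0)
    (ht : ∀ p : Fin (S.arity (b i).rel), s.reg (rTup i p) = .inl (t p)) (v : V) :
    s.reg (vreg b i v) = (b i).look t v := by
  rw [vreg, Atom.look]
  split_ifs with h
  exacts [ht _, hz]

theorem rkind_vreg (i : Fin n) (v : V) : rkind (vreg b i v) = 7 ∨ rkind (vreg b i v) = 9 := by
  rw [vreg]
  split_ifs <;> simp [rTup, rZero]

theorem rkind_vreg_notMem_scratch (i : Fin n) (v : V) : rkind (vreg b i v) ∉ scratch := by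
  rcases rkind_vreg (b := b) i v with h | h <;> simp [h, scratch]

theorem IsTest.congr {inp : Input S D} {s₀ : State D} {P : Program S D} {p q : Prop}
    (h : IsTest inp P s₀ p) (hpq : p ↔ q) : IsTest inp P s₀ q := by
  rwa [propext hpq] at h

theorem isTest_skip {inp : Input S D} {s₀ : State D} :
    IsTest inp (.skip : Program S D) s₀ True :=
  ⟨trivial, fun s hs => by simpa using hs⟩

namespace Pass

variable (C : Pass b) (ρ : V → ℕ)

/-- The registers that hold the key of the current tuple. -/
noncomputable def keyRegs (i : Fin n) : List ℕ :=
  (C.K i).toList.map fun p : Fin (S.arity (b i).rel) => rTup i p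

/-- The key of a tuple. -/
noncomputable def keyOf (i : Fin n) (t : Tuple S D (b i).rel) : List (Word D) :=
  (C.K i).toList.map fun p => .inl (t p)

variable {C} in
theorem keyOf_eq_iff {i : Fin n} {t t' : Tuple S D (b i).rel} :
    C.keyOf i t' = C.keyOf i t ↔ C.SameKey i t' t := by
  simp [keyOf, SameKey]

open Classical in
/-- Test that a position of the current tuple matches the atom. -/
noncomputable def testPos (i : Fin n) (p : Fin (S.arity (b i).rel)) : Program S D :=
  match (b i).args p with
  | .const d => testConst (rTup i p) d
  | .var v => .seq (testEq (vreg b i v) (rTup i p))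
    (if v ∈ C.U then testEq (ρ v) (rTup i p) else .skip)

/-- Test that the current tuple matches the atom, agrees on `W` with the representative of its
block, and joins with the children. -/
noncomputable def testTuple (i : Fin n) : Program S D :=
  .seq (Program.block ((List.finRange (S.arity (b i).rel)).map (C.testPos ρ i)))
    (.seq (Program.block ((C.W i).toList.map fun p : Fin (S.arity (b i).rel) =>
        testAttr 0 i (C.keyRegs i) (b i).rel p (rTup i p)))
      (Program.block ((C.children i).map fun j : Fin n => testCell 2 j ((C.sh j).map (vreg b i)))))

/-- The state is ready for a pass with number `σ`. -/
structure Ready (γ : V → D) (σ : ℕ) (s : State D) : Prop where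
  stamp : s.reg rStamp = .inr σ
  zero : s.reg rZero = .inr 0
  one : s.reg rOne = .inr 1
  val : ∀ v ∈ C.U, s.reg (ρ v) = .inl (γ v)

variable {C ρ} {γ : V → D} {σ : ℕ} {inp : Input S D}

theorem Ready.of_frame {s s' : State D} (h : C.Ready ρ γ σ s) (hρ : ∀ v, rkind (ρ v) = 10)
    {B : Set ℕ} (hB : B ⊆ passKinds) (hF : State.Frame B s' s) : C.Ready ρ γ σ s' := by
  have hF := hF.mono hB
  refine ⟨?_, ?_, ?_, fun v hv => ?_⟩
  · rw [hF.reg _ (by simp [rStamp, passKinds]), h.stamp]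
  · rw [hF.reg _ (by simp [rZero, passKinds]), h.zero]
  · rw [hF.reg _ (by simp [rOne, passKinds]), h.one]
  · rw [hF.reg _ (by simp [hρ, passKinds]), h.val v hv]

theorem isTest_testPos {s : State D} (hs : C.Ready ρ γ σ s) (hρ : ∀ v, rkind (ρ v) = 10)
    {i : Fin n} {t : Tuple S D (b i).rel}
    (ht : ∀ p : Fin (S.arity (b i).rel), s.reg (rTup i p) = .inl (t p))
    (p : Fin (S.arity (b i).rel)) :
    IsTest inp (C.testPos ρ i p) s ((∀ d, (b i).args p = .const d → t p = d) ∧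
      ∀ v, (b i).args p = .var v → (b i).look t v = .inl (t p) ∧ (v ∈ C.U → γ v = t p)) := by
  have hk : rkind (rTup i p) ∉ scratch := by simp [rTup, scratch]
  rcases hp : (b i).args p with v | d
  · simp only [testPos, hp]
    have h₁ : IsTest inp (testEq (vreg b i v) (rTup i p)) s ((b i).look t v = .inl (t p)) := by
      refine (isTest_testEq (rkind_vreg_notMem_scratch i v) hk).congr ?_
      rw [reg_vreg hs.zero ht, ht]
    split_ifs with hU
    · refine (h₁.seq (isTest_testEq (r := ρ v) (r' := rTup i p) ?_ hk)).congr ?_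
      · simp [hρ, scratch]
      · rw [hs.val v hU, ht]
        simp [hU]
    · refine (h₁.seq isTest_skip).congr ?_
      simp [hU]
  · simp only [testPos, hp]
    refine (isTest_testConst d hk).congr ?_
    rw [ht]
    simp

theorem map_keyRegs {s : State D} {i : Fin n} {t : Tuple S D (b i).rel}
    (ht : ∀ p : Fin (S.arity (b i).rel), s.reg (rTup i p) = .inl (t p)) :
    (C.keyRegs i).map s.reg = C.keyOf i t := by
  simp [keyRegs, keyOf, ht]

theorem rkind_of_mem_keyRegs {i : Fin n} {r : ℕ} (hr : r ∈ C.keyRegs i) : rkind r = 9 := by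
  simp only [keyRegs, List.mem_map] at hr
  obtain ⟨p, -, rfl⟩ := hr
  simp [rTup]

theorem notMem_keyRegs {i : Fin n} {r : ℕ} (hr : rkind r ≠ 9) : r ∉ C.keyRegs i :=
  fun h => hr (rkind_of_mem_keyRegs h)

theorem map_vreg {s : State D} {i : Fin n} {t : Tuple S D (b i).rel} (hz : s.reg rZero = .inr 0)
    (ht : ∀ p : Fin (S.arity (b i).rel), s.reg (rTup i p) = .inl (t p)) (l : List V) :
    (l.map (vreg b i)).map s.reg = l.map ((b i).look t) := by
  simp [reg_vreg hz ht]

theorem notMem_map_vreg {i : Fin n} {l : List V} {r : ℕ} (hr : rkind r < 7) :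
    r ∉ l.map (vreg b i) := by
  intro h
  obtain ⟨v, -, rfl⟩ := List.mem_map.1 h
  rcases rkind_vreg (b := b) i v with h | h <;> omega

theorem isTest_testTuple {s : State D} (hs : C.Ready ρ γ σ s) (hρ : ∀ v, rkind (ρ v) = 10)
    {i : Fin n} {t : Tuple S D (b i).rel}
    (ht : ∀ p : Fin (S.arity (b i).rel), s.reg (rTup i p) = .inl (t p)) :
    IsTest inp (C.testTuple ρ i) s ((b i).Matches C.U γ t ∧
      (∀ p ∈ C.W i, inp.get (b i).rel (s.mem (cell 0 i σ (C.keyOf i t))) p = .inl (t p)) ∧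
      ∀ j ∈ C.children i, s.mem (cell 2 j σ ((C.sh j).map ((b i).look t))) ≠ .inr 0) := by
  refine ((IsTest.block _ fun p _ => isTest_testPos hs hρ ht p).seq
    ((IsTest.block _ fun p _ => isTest_testAttr hs.stamp
      (fun x hx => by simp [rkind_of_mem_keyRegs hx, scratch])
      (by simp [rTup, scratch])).seq
      (IsTest.block _ fun j _ => isTest_testCell hs.stamp hs.zero fun x hx => ?_))).congr ?_
  · obtain ⟨v, -, rfl⟩ := List.mem_map.1 hx
    exact rkind_vreg_notMem_scratch i v
  · simp [Atom.Matches, map_keyRegs ht, ht, map_vreg hs.zero ht]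

variable (C ρ)

/-- Record a representative of the block of the current tuple. -/
noncomputable def bodyRep (i : Fin n) : Program S D :=
  .seq (readTuple b i) (storeCell 0 i rStamp (C.keyRegs i) rIdx)

/-- Mark the block of the current tuple as bad if the tuple fails the test. -/
noncomputable def bodyBad (i : Fin n) : Program S D :=
  .seq (readTuple b i) (.seq (.instr (.lit rFlag (.inr 1))) (.seq (C.testTuple ρ i)
    (.ite rFlag rOne .skip (storeCell 1 i rStamp (C.keyRegs i) rOne))))

/-- Put the current tuple into the linked list of its projection if its block is not bad. -/
noncomputable def bodyLink (i : Fin n) : Program S D :=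
  .seq (readTuple b i) (.seq (loadCell rX 1 i rStamp (C.keyRegs i))
    (.ite rX rOne .skip (.seq (loadCell rX 2 i rStamp ((C.sh i).map (vreg b i)))
      (.seq (storeCell 3 i rStamp [rIdx] rX) (.seq (.instr (.copy rX rIdx))
        (.seq (.instr (.succ rX)) (storeCell 2 i rStamp ((C.sh i).map (vreg b i)) rX)))))))

variable {C ρ}

theorem loopFree_bodyRep (i : Fin n) : (C.bodyRep i).LoopFree :=
  ⟨loopFree_readTuple i, loopFree_storeCell⟩

theorem loopFree_bodyLink (i : Fin n) : (C.bodyLink i).LoopFree := by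
  simp [bodyLink, loopFree_readTuple]

theorem loopFree_testTuple (i : Fin n) : (C.testTuple ρ i).LoopFree := by
  simp only [testTuple, Program.loopFree_seq, Program.loopFree_block, List.mem_map]
  refine ⟨?_, ?_, ?_⟩
  · rintro P ⟨p, -, rfl⟩
    rw [testPos]
    split
    · simp [testConst]
    · split_ifs <;> simp [testEq]
  · rintro P ⟨p, -, rfl⟩
    simp [testAttr]
  · rintro P ⟨p, -, rfl⟩
    simp [testCell]

theorem loopFree_bodyBad (i : Fin n) : (C.bodyBad ρ i).LoopFree := by
  simp [bodyBad, loopFree_readTuple, loopFree_testTuple]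

theorem _root_.CQA.State.SameExcept.nine_frame {s s' : State D} (h : State.SameExcept {9} s s') :
    State.Frame bodyKinds s s' :=
  h.frame.mono (by rintro a rfl; simp [bodyKinds])

open Classical in
theorem run_bodyRep {s : State D} (hs : C.Ready ρ γ σ s) (hρ : ∀ v, rkind (ρ v) = 10) {m : ℕ}
    {i : Fin n} {t : Tuple S D (b i).rel} (hm : s.reg rIdx = .inr m)
    (ht : (inp (b i).rel)[m]? = some t) :
    State.Frame bodyKinds ((C.bodyRep i).run inp s) s ∧ ((C.bodyRep i).run inp s).mem =
      Function.update s.mem (cell 0 i σ (C.keyOf i t)) (.inr m) := by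
  obtain ⟨h₁, -, h₃⟩ := run_readTuple hm ht
  have hs₁ := hs.of_frame hρ bodyKinds_subset_passKinds h₁.nine_frame
  rw [bodyRep, Program.run_seq, run_storeCell hs₁.stamp (by simp [rStamp, rTag])
    (notMem_keyRegs (by simp [rTag])) (by simp [rIdx, rTag])]
  refine ⟨(h₁.nine_frame.set (by simp [rTag, bodyKinds]) _).set_mem _, ?_⟩
  simp [map_keyRegs h₃, h₁.mem, h₁.reg rIdx (by simp [rIdx]), hm]

open Classical in
theorem run_bodyBad {s : State D} (hs : C.Ready ρ γ σ s) (hρ : ∀ v, rkind (ρ v) = 10) {m : ℕ}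
    {i : Fin n} {t : Tuple S D (b i).rel} (hm : s.reg rIdx = .inr m)
    (ht : (inp (b i).rel)[m]? = some t) :
    State.Frame bodyKinds ((C.bodyBad ρ i).run inp s) s ∧ ((C.bodyBad ρ i).run inp s).mem =
      if (b i).Matches C.U γ t ∧
        (∀ p ∈ C.W i, inp.get (b i).rel (s.mem (cell 0 i σ (C.keyOf i t))) p = .inl (t p)) ∧
        ∀ j ∈ C.children i, s.mem (cell 2 j σ ((C.sh j).map ((b i).look t))) ≠ .inr 0
      then s.mem else Function.update s.mem (cell 1 i σ (C.keyOf i t)) (.inr 1) := by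
  obtain ⟨h₁, -, h₃⟩ := run_readTuple hm ht
  set s₁ := (readTuple b i).run inp s
  have hs₁ := hs.of_frame hρ bodyKinds_subset_passKinds h₁.nine_frame
  have htest := isTest_testTuple (inp := inp) hs₁ hρ h₃
  obtain ⟨h₄, h₅⟩ := htest.run (s₁.set rFlag (.inr 1))
    ((State.SameExcept.refl _ _).set (by simp [rFlag, scratch]) _)
  set s₂ := (C.testTuple ρ i).run inp (s₁.set rFlag (.inr 1))
  have hrun : (C.bodyBad ρ i).run inp s =
    (Program.ite rFlag rOne .skip (storeCell 1 i rStamp (C.keyRegs i) rOne)).run inp s₂ := rfl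
  have hF₂ : State.Frame bodyKinds s₂ s :=
    (h₄.frame.mono scratch_subset_bodyKinds).trans h₁.nine_frame
  have hs₂ := hs.of_frame hρ bodyKinds_subset_passKinds hF₂
  rw [h₁.mem, State.set_reg_self] at h₅
  rw [hrun]
  by_cases hp : (b i).Matches C.U γ t ∧
        (∀ p ∈ C.W i, inp.get (b i).rel (s.mem (cell 0 i σ (C.keyOf i t))) p = .inl (t p)) ∧
        ∀ j ∈ C.children i, s.mem (cell 2 j σ ((C.sh j).map ((b i).look t))) ≠ .inr 0
  · rw [if_pos hp] at h₅ ⊢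
    rw [Program.run_ite_of_eq _ _ _ (h₅.trans hs₂.one.symm), Program.run_skip]
    exact ⟨hF₂, h₄.mem.trans h₁.mem⟩
  · rw [if_neg hp] at h₅ ⊢
    rw [Program.run_ite_of_ne _ _ _ (by rw [h₅, hs₂.one]; simp),
      run_storeCell hs₂.stamp (by simp [rStamp, rTag])
      (notMem_keyRegs (by simp [rTag])) (by simp [rOne, rTag])]
    refine ⟨(hF₂.set (by simp [rTag, bodyKinds]) _).set_mem _, ?_⟩
    rw [h₄.map_reg (fun x hx => by simp [rkind_of_mem_keyRegs hx, scratch]), map_keyRegs h₃]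
    simp only
    rw [h₄.mem, h₁.mem, hs₂.one]

open Classical in
-- A cell of kind 2 holds the head of a list and a cell of kind 3 the successor of a position. Both
-- store a position plus one, so the initial content 0 is the empty list. The current tuple gets the
-- old head as successor and becomes the new head.
theorem run_bodyLink {s : State D} (hs : C.Ready ρ γ σ s) (hρ : ∀ v, rkind (ρ v) = 10) {m : ℕ}
    {i : Fin n} {t : Tuple S D (b i).rel} (hm : s.reg rIdx = .inr m)
    (ht : (inp (b i).rel)[m]? = some t) :
    State.Frame bodyKinds ((C.bodyLink i).run inp s) s ∧ ((C.bodyLink i).run inp s).mem =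
      if s.mem (cell 1 i σ (C.keyOf i t)) = .inr 1 then s.mem else
        Function.update (Function.update s.mem (cell 3 i σ [.inr m])
          (s.mem (cell 2 i σ (C.proj i t)))) (cell 2 i σ (C.proj i t)) (.inr (m + 1)) := by
  obtain ⟨h₁, -, h₃⟩ := run_readTuple hm ht
  set s₁ := (readTuple b i).run inp s
  have hs₁ := hs.of_frame hρ bodyKinds_subset_passKinds h₁.nine_frame
  have hX : rkind rX ∈ scratch := by simp [rX, scratch]
  have hT : rkind rTag ∈ scratch := by simp [rTag, scratch]
  have hS : rStamp ≠ rTag := by simp [rStamp, rTag]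
  have hXT : rX ≠ rTag := by simp [rX, rTag]
  have hkT : rTag ∉ C.keyRegs i := notMem_keyRegs (by simp [rTag])
  have hvT : rTag ∉ (C.sh i).map (vreg b i) := notMem_map_vreg (by simp [rTag])
  have hIs : rkind rIdx ∉ scratch := by simp [rIdx, scratch]
  rw [bodyLink, Program.run_seq, Program.run_seq, run_loadCell hs₁.stamp hS hkT, map_keyRegs h₃,
    h₁.mem, Program.run_ite]
  set s₂ := (s₁.set rTag (.inr (Nat.pair 1 i))).set rX (s.mem (cell 1 i σ (C.keyOf i t)))
  have h₂ : State.SameExcept scratch s₂ s₁ := ((State.SameExcept.refl _ _).set hT _).set hX _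
  have hF₂ : State.Frame bodyKinds s₂ s :=
    (h₂.frame.mono scratch_subset_bodyKinds).trans h₁.nine_frame
  have hs₂ := hs.of_frame hρ bodyKinds_subset_passKinds hF₂
  have hX₂ : s₂.reg rX = s.mem (cell 1 i σ (C.keyOf i t)) := State.set_reg_self _ _ _
  rw [hX₂, hs₂.one]
  split_ifs with hbad
  · rw [Program.run_skip]
    exact ⟨hF₂, h₂.mem.trans h₁.mem⟩
  have hv : ∀ s', State.Frame scratch s' s₁ →
      ((C.sh i).map (vreg b i)).map s'.reg = C.proj i t := by
    intro s' h
    rw [h.map_reg, map_vreg hs₁.zero h₃]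
    · rfl
    · intro x hx
      obtain ⟨v, -, rfl⟩ := List.mem_map.1 hx
      exact rkind_vreg_notMem_scratch i v
  rw [Program.run_seq, run_loadCell hs₂.stamp hS hvT, hv s₂ h₂.frame, h₂.mem, h₁.mem]
  set s₃ := (s₂.set rTag (.inr (Nat.pair 2 i))).set rX (s.mem (cell 2 i σ (C.proj i t)))
  have h₃' : State.SameExcept scratch s₃ s₁ := (h₂.set hT _).set hX _
  have hst₃ : s₃.reg rStamp = .inr σ := by
    rw [h₃'.reg _ (by simp [rStamp, scratch]), hs₁.stamp]
  have hi₃ : s₃.reg rIdx = .inr m := by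
    rw [h₃'.reg _ hIs, h₁.reg _ (by simp [rIdx]), hm]
  rw [Program.run_seq, run_storeCell hst₃ hS (by simp [rIdx, rTag]) hXT, List.map_singleton, hi₃,
    h₃'.mem, h₁.mem, show s₃.reg rX = _ from State.set_reg_self _ _ _]
  set s₄ : State D := { s₃.set rTag (.inr (Nat.pair 3 i)) with
    mem := Function.update s.mem (cell 3 i σ [.inr m]) (s.mem (cell 2 i σ (C.proj i t))) }
  have h₄ : State.Frame scratch s₄ s₁ := (h₃'.frame.set hT _).set_mem _
  have hi₄ : s₄.reg rIdx = .inr m := by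
    rw [h₄.reg _ hIs, h₁.reg _ (by simp [rIdx]), hm]
  rw [Program.run_seq, Program.run_seq]
  simp only [Program.run_instr, Instr.step, State.set_reg_self, hi₄, Word.mapNat]
  have h₅ : State.Frame scratch ((s₄.set rX (.inr m)).set rX (.inr m.succ)) s₁ :=
    (h₄.set hX _).set hX _
  rw [run_storeCell (σ := σ) (by rw [h₅.reg _ (by simp [rStamp, scratch]), hs₁.stamp]) hS hvT hXT,
    hv _ h₅]
  refine ⟨(((h₅.set hT _).mono scratch_subset_bodyKinds).trans h₁.nine_frame).set_mem _, ?_⟩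
  simp [s₄]

end Pass

end NodePass

/-! ### Linked lists in memory -/

section Lists

variable {D : Type*}

/-- The word `p` points to a linked list of atom `i` with the given elements. -/
inductive Chain (mem : List (Word D) → Word D) (i σ : ℕ) : Word D → List ℕ → Prop
  | nil : Chain mem i σ (.inr 0) []
  | cons {a : ℕ} {l : List ℕ} : Chain mem i σ (mem (cell 3 i σ [.inr a])) l →
      Chain mem i σ (.inr (a + 1)) (a :: l)

theorem Chain.congr {mem mem' : List (Word D) → Word D} {i σ : ℕ} {p : Word D} {l : List ℕ}
    (h : Chain mem i σ p l)
    (hm : ∀ a ∈ l, mem' (cell 3 i σ [.inr a]) = mem (cell 3 i σ [.inr a])) :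
    Chain mem' i σ p l := by
  induction h with
  | nil => exact .nil
  | @cons a l _ ih =>
    refine .cons ?_
    rw [hm a (by simp)]
    exact ih fun x hx => hm x (by simp [hx])

theorem Chain.eq_zero_iff {mem : List (Word D) → Word D} {i σ : ℕ} {p : Word D} {l : List ℕ}
    (h : Chain mem i σ p l) : p = .inr 0 ↔ l = [] := by
  cases h <;> simp

end Lists

/-! ### Processing one atom, then the whole tree -/

section NodePass

variable {S : Schema} {V D : Type*} {n : ℕ} {b : Body S V D (Fin n)}

namespace Pass

variable (C : Pass b) (ρ : V → ℕ)

open Classical in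
/-- The positions below `m` of the tuples in good blocks that have the projection `ws`, in
descending order. -/
noncomputable def bucket (γ : V → D) (g : Fin n → List (Word D) → Prop) (db : Instance S D)
    (inp : Input S D) (i : Fin n) (ws : List (Word D)) (m : ℕ) : List ℕ :=
  ((List.range m).filter fun a => ∃ t, (inp (b i).rel)[a]? = some t ∧ C.Good γ g db i t ∧
    C.proj i t = ws).reverse

/-- The family of projections with nonempty linked lists. -/
def heads (mem : List (Word D) → Word D) (σ : ℕ) (j : Fin n) (ws : List (Word D)) : Prop :=
  mem (cell 2 j σ ws) ≠ .inr 0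

/-- Process atom `i`. -/
noncomputable def nodePass (i : Fin n) : Program S D :=
  .seq (.forEach rIdx rLim (b i).rel (C.bodyRep i))
    (.seq (.forEach rIdx rLim (b i).rel (C.bodyBad ρ i))
      (.forEach rIdx rLim (b i).rel (C.bodyLink i)))

/-- A bound for the time of `nodePass` per tuple. -/
noncomputable def nodeCost (i : Fin n) : ℕ :=
  ((C.bodyRep i).cost + 3) + ((C.bodyBad ρ i).cost + 3) + ((C.bodyLink i).cost + 3)

variable {C ρ} {γ : V → D} {σ : ℕ} {inp : Input S D} {db : Instance S D}
  {g g' : Fin n → List (Word D) → Prop}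

theorem mem_bucket {i : Fin n} {ws : List (Word D)} {m a : ℕ} :
    a ∈ C.bucket γ g db inp i ws m ↔ a < m ∧ ∃ t, (inp (b i).rel)[a]? = some t ∧
      C.Good γ g db i t ∧ C.proj i t = ws := by
  simp [bucket]

theorem nodup_bucket {i : Fin n} {ws : List (Word D)} {m : ℕ} :
    (C.bucket γ g db inp i ws m).Nodup := by
  rw [bucket, List.nodup_reverse]
  exact List.nodup_range.filter _

theorem bucket_succ_of {i : Fin n} {ws : List (Word D)} {m : ℕ}
    (h : ∃ t, (inp (b i).rel)[m]? = some t ∧ C.Good γ g db i t ∧ C.proj i t = ws) :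
    C.bucket γ g db inp i ws (m + 1) = m :: C.bucket γ g db inp i ws m := by
  rw [bucket, List.range_succ, List.filter_append]
  simp [bucket, h]

theorem bucket_succ_of_not {i : Fin n} {ws : List (Word D)} {m : ℕ}
    (h : ¬ ∃ t, (inp (b i).rel)[m]? = some t ∧ C.Good γ g db i t ∧ C.proj i t = ws) :
    C.bucket γ g db inp i ws (m + 1) = C.bucket γ g db inp i ws m := by
  rw [bucket, List.range_succ, List.filter_append]
  simp only [List.filter_cons, decide_eq_true_eq, h, List.filter_nil]
  simp [bucket]

theorem good_congr {i : Fin n} (h : ∀ j ∈ C.children i, ∀ ws, g j ws ↔ g' j ws)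
    (t : Tuple S D (b i).rel) : C.Good γ g db i t ↔ C.Good γ g' db i t := by
  simp only [Good]
  refine forall₃_congr fun t' _ _ => and_congr_right fun _ => and_congr_right fun _ => ?_
  exact forall₂_congr fun j hj => h j hj _

theorem bucket_congr {i : Fin n} (h : ∀ j ∈ C.children i, ∀ ws, g j ws ↔ g' j ws)
    (ws : List (Word D)) (m : ℕ) :
    C.bucket γ g db inp i ws m = C.bucket γ g' db inp i ws m := by
  refine congrArg _ (List.filter_congr fun a _ => ?_)
  rw [decide_eq_decide]
  simp only [good_congr h]

/-- Each tuple overwrites the cell of its block, so the last one stays as representative; which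
tuple that is does not matter. -/
theorem exec_repLoop {s : State D} (hs : C.Ready ρ γ σ s) (hρ : ∀ v, rkind (ρ v) = 10)
    (i : Fin n) :
    ∃ s', (∃ t ≤ ((C.bodyRep i).cost + 3) * ((inp (b i).rel).length + 1),
      Exec inp (.forEach rIdx rLim (b i).rel (C.bodyRep i)) s s' t) ∧
      State.Frame passKinds s' s ∧
      (∀ a, (∀ ws, a ≠ cell 0 i σ ws) → s'.mem a = s.mem a) ∧
      ∀ t ∈ inp (b i).rel, ∃ m'', ∃ t'', (inp (b i).rel)[m'']? = some t'' ∧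
        s'.mem (cell 0 i σ (C.keyOf i t)) = .inr m'' ∧ C.SameKey i t'' t := by
  classical
  obtain ⟨s', he, hF, h₁, h₂⟩ := exec_tableLoop (inp := inp) (loopFree_bodyRep (C := C) i)
    (s₀ := s) (fun m mem => (∀ a, (∀ ws, a ≠ cell 0 i σ ws) → mem a = s.mem a) ∧
      ∀ m' < m, ∀ t, (inp (b i).rel)[m']? = some t → ∃ m'', ∃ t'',
        (inp (b i).rel)[m'']? = some t'' ∧ mem (cell 0 i σ (C.keyOf i t)) = .inr m'' ∧
        C.SameKey i t'' t) ⟨fun _ _ => rfl, fun m' h => absurd h (Nat.not_lt_zero _)⟩ (by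
    rintro m t ht s₁ hF₁ hm ⟨h₁, h₂⟩
    obtain ⟨hF, hmem⟩ := run_bodyRep (hs.of_frame hρ subset_rfl hF₁) hρ hm ht
    refine ⟨hF, fun a ha => ?_, fun m' hm' t' ht' => ?_⟩
    · rw [hmem, Function.update_of_ne (ha _), h₁ a ha]
    · rw [hmem]
      by_cases hk : C.keyOf i t' = C.keyOf i t
      · refine ⟨m, t, ht, ?_, keyOf_eq_iff.1 hk.symm⟩
        rw [hk, Function.update_self]
      · have hne : m' ≠ m := by
          rintro rfl
          rw [ht] at ht'
          cases ht'
          exact hk rfl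
        obtain ⟨m'', t'', h₃, h₄, h₅⟩ := h₂ m' (by omega) t' ht'
        refine ⟨m'', t'', h₃, ?_, h₅⟩
        rw [Function.update_of_ne (by simpa using hk), h₄])
  refine ⟨s', he, hF, h₁, fun t ht => ?_⟩
  obtain ⟨m, hm, rfl⟩ := List.getElem_of_mem ht
  exact h₂ m hm _ (List.getElem?_eq_getElem hm)

/-- The condition on a single tuple that is tested by `bodyBad`. -/
def Passes (C : Pass b) (γ : V → D) (σ : ℕ) (inp : Input S D) (mem : List (Word D) → Word D)
    (i : Fin n) (t : Tuple S D (b i).rel) : Prop :=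
  (b i).Matches C.U γ t ∧
    (∀ p ∈ C.W i, inp.get (b i).rel (mem (cell 0 i σ (C.keyOf i t))) p = .inl (t p)) ∧
    ∀ j ∈ C.children i, mem (cell 2 j σ ((C.sh j).map ((b i).look t))) ≠ .inr 0

/-- The loop writes only marks, and the tested condition reads representatives and heads, so it may
be evaluated in the memory before the loop. A mark is never removed: one failing tuple spoils its
block for good. -/
theorem exec_badLoop {s : State D} (hs : C.Ready ρ γ σ s) (hρ : ∀ v, rkind (ρ v) = 10)
    (i : Fin n) (hfresh : ∀ ws, s.mem (cell 1 i σ ws) = .inr 0) :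
    ∃ s', (∃ t ≤ ((C.bodyBad ρ i).cost + 3) * ((inp (b i).rel).length + 1),
      Exec inp (.forEach rIdx rLim (b i).rel (C.bodyBad ρ i)) s s' t) ∧
      State.Frame passKinds s' s ∧
      (∀ a, (∀ ws, a ≠ cell 1 i σ ws) → s'.mem a = s.mem a) ∧
      ∀ t, s'.mem (cell 1 i σ (C.keyOf i t)) = .inr 1 ↔
        ∃ t' ∈ inp (b i).rel, C.SameKey i t' t ∧ ¬ C.Passes γ σ inp s.mem i t' := by
  classical
  obtain ⟨s', he, hF, h₁, h₂⟩ := exec_tableLoop (inp := inp) (loopFree_bodyBad (C := C) (ρ := ρ) i)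
    (s₀ := s) (fun m mem => (∀ a, (∀ ws, a ≠ cell 1 i σ ws) → mem a = s.mem a) ∧
      ∀ t, mem (cell 1 i σ (C.keyOf i t)) = .inr 1 ↔ ∃ m' < m, ∃ t',
        (inp (b i).rel)[m']? = some t' ∧ C.SameKey i t' t ∧ ¬ C.Passes γ σ inp s.mem i t')
      ⟨fun _ _ => rfl, fun t => by simp [hfresh]⟩ (by
    rintro m t ht s₁ hF₁ hm ⟨h₁, h₂⟩
    obtain ⟨hF, hmem⟩ := run_bodyBad (hs.of_frame hρ subset_rfl hF₁) hρ hm ht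
    have hpass : ((b i).Matches C.U γ t ∧
        (∀ p ∈ C.W i, inp.get (b i).rel (s₁.mem (cell 0 i σ (C.keyOf i t))) p = .inl (t p)) ∧
        ∀ j ∈ C.children i, s₁.mem (cell 2 j σ ((C.sh j).map ((b i).look t))) ≠ .inr 0) ↔
        C.Passes γ σ inp s.mem i t := by
      rw [Passes, h₁ _ (by simp)]
      refine and_congr_right fun _ => and_congr_right fun _ => forall₂_congr fun j _ => ?_
      rw [h₁ _ (by simp)]
    by_cases hp : C.Passes γ σ inp s.mem i t
    · rw [if_pos (hpass.2 hp)] at hmem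
      refine ⟨hF, fun a ha => by rw [hmem, h₁ a ha], fun t' => ?_⟩
      rw [hmem, h₂]
      constructor
      · rintro ⟨m', hm', h⟩
        exact ⟨m', by omega, h⟩
      · rintro ⟨m', hm', u, hu, hk, hn⟩
        have hne : m' ≠ m := by
          rintro rfl
          rw [ht] at hu
          cases hu
          exact hn hp
        exact ⟨m', by omega, u, hu, hk, hn⟩
    · rw [if_neg (fun h => hp (hpass.1 h))] at hmem
      refine ⟨hF, fun a ha => by rw [hmem, Function.update_of_ne (ha _), h₁ a ha], fun t' => ?_⟩
      rw [hmem]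
      by_cases hk : C.keyOf i t' = C.keyOf i t
      · rw [hk, Function.update_self]
        simp only [true_iff]
        exact ⟨m, by omega, t, ht, keyOf_eq_iff.1 hk.symm, hp⟩
      · rw [Function.update_of_ne (by simpa using hk), h₂]
        constructor
        · rintro ⟨m', hm', h⟩
          exact ⟨m', by omega, h⟩
        · rintro ⟨m', hm', u, hu, hk', hn⟩
          have hne : m' ≠ m := by
            rintro rfl
            rw [ht] at hu
            cases hu
            exact hk (keyOf_eq_iff.2 hk').symm
          exact ⟨m', by omega, u, hu, hk', hn⟩)
  refine ⟨s', he, hF, h₁, fun t => (h₂ t).trans ⟨?_, ?_⟩⟩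
  · rintro ⟨m, -, t', ht', h⟩
    exact ⟨t', List.mem_of_getElem? ht', h⟩
  · rintro ⟨t', ht', h⟩
    obtain ⟨m, hm, rfl⟩ := List.getElem_of_mem ht'
    exact ⟨m, hm, _, List.getElem?_eq_getElem hm, h⟩

/-- Tuples are prepended in the order of their positions, hence the descending order in `bucket`.
The lists built so far contain only positions below `m`, so writing the successor of `m` leaves them
intact. -/
theorem exec_linkLoop {s : State D} (hs : C.Ready ρ γ σ s) (hρ : ∀ v, rkind (ρ v) = 10)
    (i : Fin n) (hfresh : ∀ ws, s.mem (cell 2 i σ ws) = .inr 0)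
    (hgood : ∀ t ∈ inp (b i).rel,
      s.mem (cell 1 i σ (C.keyOf i t)) ≠ .inr 1 ↔ C.Good γ g db i t) :
    ∃ s', (∃ t ≤ ((C.bodyLink i).cost + 3) * ((inp (b i).rel).length + 1),
      Exec inp (.forEach rIdx rLim (b i).rel (C.bodyLink i)) s s' t) ∧
      State.Frame passKinds s' s ∧
      (∀ a, (∀ k ws, a ≠ cell k i σ ws) → s'.mem a = s.mem a) ∧
      ∀ ws, Chain s'.mem i σ (s'.mem (cell 2 i σ ws))
        (C.bucket γ g db inp i ws (inp (b i).rel).length) := by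
  classical
  obtain ⟨s', he, hF, h₁, h₂⟩ := exec_tableLoop (inp := inp) (loopFree_bodyLink (C := C) i)
    (s₀ := s) (fun m mem => (∀ a, (∀ ws, a ≠ cell 2 i σ ws ∧ a ≠ cell 3 i σ ws) →
        mem a = s.mem a) ∧
      ∀ ws, Chain mem i σ (mem (cell 2 i σ ws)) (C.bucket γ g db inp i ws m))
      ⟨fun _ _ => rfl, fun ws => by rw [hfresh]; exact .nil⟩ (by
    rintro m t ht s₁ hF₁ hm ⟨h₁, h₂⟩
    obtain ⟨hF, hmem⟩ := run_bodyLink (hs.of_frame hρ subset_rfl hF₁) hρ hm ht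
    rw [h₁ _ (by simp)] at hmem
    have hgt := hgood t (List.mem_of_getElem? ht)
    by_cases hbad : s.mem (cell 1 i σ (C.keyOf i t)) = .inr 1
    · rw [if_pos hbad] at hmem
      refine ⟨hF, by rwa [hmem], fun ws => ?_⟩
      rw [hmem, bucket_succ_of_not]
      · exact h₂ ws
      · rintro ⟨t', ht', hg, -⟩
        rw [ht] at ht'
        cases ht'
        exact hgt.2 hg hbad
    · rw [if_neg hbad] at hmem
      refine ⟨hF, fun a ha => ?_, fun ws => ?_⟩
      · rw [hmem, Function.update_of_ne (ha _).1, Function.update_of_ne (ha _).2, h₁ a ha]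
      · rw [hmem]
        by_cases hws : ws = C.proj i t
        · subst hws
          rw [Function.update_self, bucket_succ_of ⟨t, ht, hgt.1 hbad, rfl⟩]
          refine .cons ?_
          rw [Function.update_of_ne (by simp), Function.update_self]
          refine (h₂ _).congr fun a ha => ?_
          have := (mem_bucket.1 ha).1
          rw [Function.update_of_ne (by simp), Function.update_of_ne]
          simp
          omega
        · rw [Function.update_of_ne (by simpa using hws), Function.update_of_ne (by simp),
            bucket_succ_of_not]
          · refine (h₂ _).congr fun a ha => ?_
            have := (mem_bucket.1 ha).1
            rw [Function.update_of_ne (by simp), Function.update_of_ne]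
            simp
            omega
          · rintro ⟨t', ht', -, hp⟩
            rw [ht] at ht'
            cases ht'
            exact hws hp.symm)
  exact ⟨s', he, hF, fun a ha => h₁ a fun ws => ⟨ha 2 ws, ha 3 ws⟩, h₂⟩

theorem exec_nodePass (hinp : inp.Lists db) {s : State D} (hs : C.Ready ρ γ σ s)
    (hρ : ∀ v, rkind (ρ v) = 10) (i : Fin n)
    (hfresh : ∀ k ws, s.mem (cell k i σ ws) = .inr 0) :
    ∃ s', (∃ t ≤ C.nodeCost ρ i * ((inp (b i).rel).length + 1),
      Exec inp (C.nodePass ρ i) s s' t) ∧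
      State.Frame passKinds s' s ∧
      (∀ a, (∀ k ws, a ≠ cell k i σ ws) → s'.mem a = s.mem a) ∧
      ∀ ws, Chain s'.mem i σ (s'.mem (cell 2 i σ ws))
        (C.bucket γ (heads s.mem σ) db inp i ws (inp (b i).rel).length) := by
  obtain ⟨s₁, ⟨t₁, ht₁, e₁⟩, hF₁, hm₁, hrep⟩ := exec_repLoop (inp := inp) hs hρ i
  have hs₁ := hs.of_frame hρ subset_rfl hF₁
  obtain ⟨s₂, ⟨t₂, ht₂, e₂⟩, hF₂, hm₂, hbad⟩ := exec_badLoop (inp := inp) hs₁ hρ i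
    (fun ws => by rw [hm₁ _ (by simp), hfresh])
  have hs₂ := hs₁.of_frame hρ subset_rfl hF₂
  have hchild : ∀ j ∈ C.children i, ∀ ws, s₁.mem (cell 2 j σ ws) = s.mem (cell 2 j σ ws) :=
    fun j _ ws => hm₁ _ (by simp)
  have hgood : ∀ t ∈ inp (b i).rel,
      s₂.mem (cell 1 i σ (C.keyOf i t)) ≠ .inr 1 ↔ C.Good γ (heads s.mem σ) db i t := by
    intro t ht
    rw [ne_eq, hbad t]
    push Not
    -- The program compares tuples with the representative `u` of the block, whereas goodness
    -- compares them with `t`. As `u` and `t` lie in the same block, agreement of the whole block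
    -- with one is agreement with the other.
    obtain ⟨m, u, hu, hmu, hk⟩ := hrep t ht
    have hget : ∀ t', C.SameKey i t' t → ∀ p,
        inp.get (b i).rel (s₁.mem (cell 0 i σ (C.keyOf i t'))) p = .inl (u p) := by
      intro t' hk' p
      rw [keyOf_eq_iff.2 hk', hmu]
      simp [Input.get, hu]
    constructor
    · intro h t' ht' hk'
      obtain ⟨h₁, h₂, h₃⟩ := h t' (((hinp _).2 t').2 ht') hk'
      obtain ⟨-, h₂', -⟩ := h t ht (fun _ _ => rfl)
      refine ⟨h₁, fun p hp => ?_, fun j hj => ?_⟩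
      · have e := h₂ p hp
        have e' := h₂' p hp
        rw [hget t' hk'] at e
        rw [hget t fun _ _ => rfl] at e'
        rw [← Sum.inl.inj e, ← Sum.inl.inj e']
      · have := h₃ j hj
        rwa [hchild j hj] at this
    · intro h t' ht' hk'
      obtain ⟨h₁, h₂, h₃⟩ := h t' (((hinp _).2 t').1 ht') hk'
      refine ⟨h₁, fun p hp => ?_, fun j hj => ?_⟩
      · rw [hget t' hk', (h u (((hinp _).2 u).1 (List.mem_of_getElem? hu)) hk).2.1 p hp, h₂ p hp]
      · rw [hchild j hj]
        exact h₃ j hj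
  obtain ⟨s₃, ⟨t₃, ht₃, e₃⟩, hF₃, hm₃, hlink⟩ := exec_linkLoop (inp := inp) (db := db) hs₂ hρ i
    (fun ws => by rw [hm₂ _ (by simp), hm₁ _ (by simp), hfresh]) hgood
  refine ⟨s₃, ⟨t₁ + (t₂ + t₃), ?_, .seq e₁ (.seq e₂ e₃)⟩, (hF₃.trans hF₂).trans hF₁,
    fun a ha => ?_, hlink⟩
  · rw [nodeCost, Nat.add_mul, Nat.add_mul]
    omega
  · rw [hm₃ a ha, hm₂ a fun ws => ha 1 ws, hm₁ a fun ws => ha 0 ws]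

variable (C ρ)

/-- Process the atoms in the list, from the last to the first. -/
noncomputable def passList : List (Fin n) → Program S D
  | [] => .skip
  | i :: l => .seq (passList l) (C.nodePass ρ i)

/-- A bound for the time of `passList`, per tuple of the database. -/
noncomputable def passCost : List (Fin n) → ℕ
  | [] => 1
  | i :: l => passCost l + C.nodeCost ρ i

/-- Every atom is listed before its children. -/
def BottomUp : List (Fin n) → Prop
  | [] => True
  | i :: l => i ∉ l ∧ (∀ j ∈ C.children i, j ∈ l) ∧ BottomUp l

variable {C ρ}

/-- The tail of the list, which contains all children of its first atom, is processed first. An atom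
writes only to its own cells, so the heads of its children are already final when it is processed,
and the conclusion can be stated for the final memory. -/
theorem exec_passList (hinp : inp.Lists db) (hρ : ∀ v, rkind (ρ v) = 10) {N : ℕ}
    (hN : ∀ R, (inp R).length ≤ N) (l : List (Fin n)) (hl : C.BottomUp l) {s : State D}
    (hs : C.Ready ρ γ σ s) (hfresh : ∀ k, ∀ i : Fin n, ∀ ws, s.mem (cell k i σ ws) = .inr 0) :
    ∃ s', (∃ t ≤ C.passCost ρ l * (N + 1), Exec inp (C.passList ρ l) s s' t) ∧
      State.Frame passKinds s' s ∧
      (∀ a, (∀ i ∈ l, ∀ k ws, a ≠ cell k i σ ws) → s'.mem a = s.mem a) ∧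
      ∀ i ∈ l, ∀ ws, Chain s'.mem i σ (s'.mem (cell 2 i σ ws))
        (C.bucket γ (heads s'.mem σ) db inp i ws (inp (b i).rel).length) := by
  induction l with
  | nil =>
    obtain ⟨t, ht, e⟩ := Program.loopFree_skip.exec (inp := inp) s
    refine ⟨s, ⟨t, ?_, ?_⟩, State.Frame.refl _ _, fun _ _ => rfl, by simp⟩
    · simp only [Program.skip, Program.cost] at ht
      simp only [passCost]
      omega
    · rwa [Program.run_skip] at e
  | cons i l ih =>
    obtain ⟨hil, hch, hl⟩ := hl
    obtain ⟨s₁, ⟨t₁, ht₁, e₁⟩, hF₁, hm₁, hc₁⟩ := ih hl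
    have hs₁ := hs.of_frame hρ subset_rfl hF₁
    obtain ⟨s₂, ⟨t₂, ht₂, e₂⟩, hF₂, hm₂, hc₂⟩ := exec_nodePass hinp hs₁ hρ i
      (fun k ws => by
        rw [hm₁ _ (fun j hj k' ws' h => ?_), hfresh]
        rw [cell_inj] at h
        exact hil (Fin.ext h.2.1 ▸ hj))
    have hne : ∀ j ∈ l, (j : ℕ) ≠ i := fun j hj h => hil (Fin.ext h ▸ hj)
    have hkeep : ∀ j ∈ l, ∀ k ws, s₂.mem (cell k j σ ws) = s₁.mem (cell k j σ ws) :=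
      fun j hj k ws => hm₂ _ (by simp [hne j hj])
    have hheads : ∀ j ∈ l, ∀ ws, heads s₁.mem σ j ws ↔ heads s₂.mem σ j ws := by
      intro j hj ws
      rw [heads, heads, hkeep j hj]
    have hchl : ∀ l : List (Fin n), C.BottomUp l → ∀ i ∈ l, ∀ j ∈ C.children i, j ∈ l := by
      intro l
      induction l with
      | nil => simp
      | cons x l ih =>
        rintro ⟨-, h₁, h₂⟩ i hi j hj
        rcases List.mem_cons.1 hi with rfl | hi
        · exact List.mem_cons_of_mem _ (h₁ j hj)
        · exact List.mem_cons_of_mem _ (ih h₂ i hi j hj)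
    refine ⟨s₂, ⟨t₁ + t₂, ?_, .seq e₁ e₂⟩, hF₂.trans hF₁, fun a ha => ?_, fun j hj ws => ?_⟩
    · have := hN (b i).rel
      have : C.nodeCost ρ i * ((inp (b i).rel).length + 1) ≤ C.nodeCost ρ i * (N + 1) :=
        Nat.mul_le_mul_left _ (by omega)
      rw [passCost, Nat.add_mul]
      omega
    · rw [hm₂ a (ha i (by simp)), hm₁ a fun j hj => ha j (by simp [hj])]
    · rcases List.mem_cons.1 hj with rfl | hj
      · rw [← bucket_congr fun x hx => hheads x (hch x hx)]
        exact hc₂ ws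
      · rw [← bucket_congr fun x hx => hheads x (hchl l hl j hj x hx), hkeep j hj]
        exact (hc₁ j hj ws).congr fun a _ => hkeep j hj _ _

/-- A child is neither its parent nor listed earlier, since in a top-down list the parent of an
element does not occur from that element on. The prefix `l'` in the induction remembers this for the
elements already passed. -/
theorem Fits.bottomUp {J : RootedJoinTree fun i => (b i).vars \ C.U} {Rs : Set (Instance S D)}
    (h : C.Fits J γ db Rs) : C.BottomUp J.order := by
  have : ∀ l l' : List (Fin n), l' ++ l = J.order → TopDown J.root J.par l →
      (∀ x ∈ l', x ≠ J.root → J.par x ∉ l) → C.BottomUp l := by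
    intro l
    induction l with
    | nil => exact fun _ _ _ _ => trivial
    | cons i l ih =>
      rintro l' hl' ⟨h₁, h₂, h₃⟩ hpar
      refine ⟨h₁, fun j hj => ?_, ih (l' ++ [i]) (by simpa using hl') h₃ ?_⟩
      · obtain ⟨hjr, hji⟩ := (h.mem_children i j).1 hj
        have hmem := J.mem_order j
        rw [← hl', List.mem_append, List.mem_cons] at hmem
        rcases hmem with hmem | rfl | hmem
        · exact absurd (by simp [hji]) (hpar j hmem hjr)
        · exact absurd (by simp [hji]) (h₂ hjr)
        · exact hmem
      · intro x hx hxr hmem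
        rcases List.mem_append.1 hx with hx | hx
        · exact hpar x hx hxr (List.mem_cons_of_mem _ hmem)
        · rw [List.mem_singleton] at hx
          subst hx
          exact h₂ hxr (List.mem_cons_of_mem _ hmem)
  exact this J.order [] rfl J.topDown (by simp)

/-- The bottom-up pass computes linked lists of the good tuples, and its heads solve the equations
of the pass. -/
theorem Fits.exec_pass {J : RootedJoinTree fun i => (b i).vars \ C.U} {Rs : Set (Instance S D)}
    (h : C.Fits J γ db Rs) (hinp : inp.Lists db) (hρ : ∀ v, rkind (ρ v) = 10) {N : ℕ}
    (hN : ∀ R, (inp R).length ≤ N) {s : State D}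
    (hs : C.Ready ρ γ σ s) (hfresh : ∀ k, ∀ i : Fin n, ∀ ws, s.mem (cell k i σ ws) = .inr 0) :
    ∃ s', (∃ t ≤ C.passCost ρ J.order * (N + 1), Exec inp (C.passList ρ J.order) s s' t) ∧
      State.Frame passKinds s' s ∧
      (∀ a, (∀ k i ws, a ≠ cell k i σ ws) → s'.mem a = s.mem a) ∧
      (∀ (i : Fin n) ws, Chain s'.mem i σ (s'.mem (cell 2 i σ ws))
        (C.bucket γ (heads s'.mem σ) db inp i ws (inp (b i).rel).length)) ∧
      C.Solves γ (heads s'.mem σ) db := by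
  obtain ⟨s', he, hF, hm, hc⟩ := exec_passList hinp hρ hN J.order h.bottomUp hs hfresh
  refine ⟨s', he, hF, fun a ha => hm a fun i _ k ws => ha k i ws,
    fun i ws => hc i (J.mem_order i) ws, fun i ws => ?_⟩
  rw [heads, ne_eq, (hc i (J.mem_order i) ws).eq_zero_iff, List.eq_nil_iff_forall_not_mem,
    not_forall_not]
  simp only [mem_bucket]
  constructor
  · rintro ⟨a, -, t, ht, hg, hp⟩
    exact ⟨t, ((hinp _).2 t).1 (List.mem_of_getElem? ht), hp, hg⟩
  · rintro ⟨t, ht, hp, hg⟩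
    obtain ⟨m, hm, rfl⟩ := List.getElem_of_mem (((hinp _).2 t).2 ht)
    exact ⟨m, hm, _, List.getElem?_eq_getElem hm, hg, hp⟩

end Pass

end NodePass

/-! ### Enumeration by fixing free variables: specification and base case -/

section Levels

variable {S : Schema} {V D : Type*} {k : ℕ}

/-- The free variables whose index is not in `js`. -/
def Query.fixedVars (q : Query S V D k) (js : List (Fin k)) : Set V :=
  {v | ∃ l, l ∉ js ∧ q.head l = v}

open Classical in
/-- A valuation that sends the free variables to `c`. -/
noncomputable def Query.val [Nonempty D] (q : Query S V D k) (c : Fin k → D) (v : V) : D :=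
  if h : ∃ j, q.head j = v then c h.choose else Classical.arbitrary D

theorem Query.val_head [Nonempty D] (q : Query S V D k) (c : Fin k → D) (j : Fin k) :
    q.val c (q.head j) = c j := by
  have h : ∃ j', q.head j' = q.head j := ⟨j, rfl⟩
  rw [Query.val, dif_pos h, q.head_injective h.choose_spec]

open Classical in
/-- The register for the value of a free variable. -/
noncomputable def Query.valReg (q : Query S V D k) (v : V) : ℕ :=
  if h : ∃ j, q.head j = v then rVal h.choose else rVal 0

theorem Query.valReg_head (q : Query S V D k) (j : Fin k) : q.valReg (q.head j) = rVal j := by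
  have h : ∃ j', q.head j' = q.head j := ⟨j, rfl⟩
  rw [Query.valReg, dif_pos h, q.head_injective h.choose_spec]

theorem Query.rkind_valReg (q : Query S V D k) (v : V) : rkind (q.valReg v) = 10 := by
  rw [Query.valReg]
  split_ifs <;> simp [rVal]

/-- All memory cells of passes with a number above `σ` are unused. -/
def State.Fresh (σ : ℕ) (s : State D) : Prop :=
  ∀ σ', σ < σ' → ∀ a i ws, s.mem (cell a i σ' ws) = .inr 0

/-- The state holds the values `c` of the free variables with index outside `js`, and the last
pass had the number `σ`. -/
structure LevelReady (js : List (Fin k)) (c : Fin k → D) (σ : ℕ) (s : State D) : Prop where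
  stamp : s.reg rStamp = .inr σ
  zero : s.reg rZero = .inr 0
  one : s.reg rOne = .inr 1
  val : ∀ l, l ∉ js → s.reg (rVal l) = .inl (c l)
  fresh : s.Fresh σ

/-- Registers that are not changed by the loops over values of the free variables in `js`. -/
def KeptReg (js : List (Fin k)) (r : ℕ) : Prop :=
  r = rZero ∨ r = rOne ∨ ∃ l, l ∉ js ∧ (r = rVal l ∨ r = rPos l ∨ r = rEnd l ∨ r = rPass l)

/-- The state `s'` is ready for further passes, and preserves what the loops outside `js` use. -/
structure LevelKeeps (js : List (Fin k)) (σ : ℕ) (s' s : State D) : Prop where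
  stamp : ∃ σ', σ ≤ σ' ∧ s'.reg rStamp = .inr σ' ∧ s'.Fresh σ'
  mem : ∀ a i σ' ws, σ' ≤ σ → s'.mem (cell a i σ' ws) = s.mem (cell a i σ' ws)
  reg : ∀ r, KeptReg js r → s'.reg r = s.reg r

/-- The output for a list of answers. -/
def encode (L : List (Fin k → D)) : List (List (Word D)) :=
  L.map fun c => List.ofFn fun j => Sum.inl (c j)

open Classical in
/-- The program enumerates the consistent answers that extend given values of the free variables
outside `js`, in time proportional to the number of such possible answers. -/
def EnumeratesFrom (q : Query S V D k) (js : List (Fin k)) (P : Program S D) (C : ℕ) : Prop :=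
  ∀ (db : Instance S D) (inp : Input S D), inp.Lists db → ∀ N, (∀ R, (inp R).length ≤ N) →
    ∀ c σ s, LevelReady js c σ s → ∃ s' t, ∃ L : List (Fin k → D), Exec inp P s s' t ∧
      t ≤ C * (N + 1) * max 1 L.length ∧ L.Nodup ∧
      (∀ c', c' ∈ L ↔ c' ∈ q.possibleAnswers db ∧ ∀ l, l ∉ js → c' l = c l) ∧
      s'.out = s.out ++ encode (L.filter fun c' => c' ∈ q.consistentAnswers db) ∧
      LevelKeeps js σ s' s

theorem Query.consistentAnswers_subset (q : Query S V D k) (db : Instance S D) :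
    q.consistentAnswers db ⊆ q.possibleAnswers db := by
  intro c hc
  obtain ⟨r, hr⟩ := db.exists_isRepair
  obtain ⟨θ, hθ, h⟩ := hc r hr
  exact ⟨θ, fun i => hr.1 _ (hθ i), h⟩

variable {n : ℕ} {b : Body S V D (Fin n)}

theorem KeptReg.rkind_notMem {js : List (Fin k)} {r : ℕ} (h : KeptReg js r) :
    rkind r ∉ passKinds ∧ rkind r ≠ 6 := by
  rcases h with rfl | rfl | ⟨l, -, rfl | rfl | rfl | rfl⟩ <;>
    simp [rZero, rOne, rVal, rPos, rEnd, rPass, passKinds]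

/-- A pass with a new number. -/
noncomputable def newPass (C : Pass b) (ρ : V → ℕ) (l : List (Fin n)) : Program S D :=
  .seq (.instr (.succ rStamp)) (C.passList ρ l)

/-- Incrementing the stamp gives the pass cells that have never been written, so no time goes into
clearing memory and the tables of outer passes stay readable. -/
theorem Pass.Fits.exec_newPass {C : Pass b} {ρ : V → ℕ} {γ : V → D} {db : Instance S D}
    {J : RootedJoinTree fun i => (b i).vars \ C.U} {Rs : Set (Instance S D)}
    (h : C.Fits J γ db Rs) {inp : Input S D} (hinp : inp.Lists db) (hρ : ∀ v, rkind (ρ v) = 10)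
    {N : ℕ} (hN : ∀ R, (inp R).length ≤ N) {σ : ℕ} {s : State D}
    (hst : s.reg rStamp = .inr σ) (hz : s.reg rZero = .inr 0) (ho : s.reg rOne = .inr 1)
    (hv : ∀ v ∈ C.U, s.reg (ρ v) = .inl (γ v)) (hfresh : s.Fresh σ) :
    ∃ s', (∃ t ≤ (C.passCost ρ J.order + 1) * (N + 1),
        Exec inp (newPass C ρ J.order) s s' t) ∧
      s'.out = s.out ∧ s'.reg rStamp = .inr (σ + 1) ∧ s'.Fresh (σ + 1) ∧
      (∀ r, rkind r ∉ passKinds → rkind r ≠ 6 → s'.reg r = s.reg r) ∧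
      (∀ a i σ' ws, σ' ≤ σ → s'.mem (cell a i σ' ws) = s.mem (cell a i σ' ws)) ∧
      (∀ (i : Fin n) ws, Chain s'.mem i (σ + 1) (s'.mem (cell 2 i (σ + 1) ws))
        (C.bucket γ (Pass.heads s'.mem (σ + 1)) db inp i ws (inp (b i).rel).length)) ∧
      C.Solves γ (Pass.heads s'.mem (σ + 1)) db := by
  have hrun : (Instr.succ rStamp : Instr S D).step inp s = s.set rStamp (.inr (σ + 1)) := by
    simp [Instr.step, hst, Word.mapNat]
  have e₁ := Exec.instr (inp := inp) (Instr.succ rStamp) s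
  rw [hrun] at e₁
  have hne : ∀ r, rkind r ≠ 6 → (s.set rStamp (.inr (σ + 1))).reg r = s.reg r := by
    intro r hr
    refine State.set_reg_of_ne _ _ ?_
    rintro rfl
    simp [rStamp] at hr
  have hs : C.Ready ρ γ (σ + 1) (s.set rStamp (.inr (σ + 1))) := by
    refine ⟨State.set_reg_self _ _ _, ?_, ?_, fun v hv' => ?_⟩
    · rw [hne _ (by simp [rZero]), hz]
    · rw [hne _ (by simp [rOne]), ho]
    · rw [hne _ (by simp [hρ]), hv v hv']
  obtain ⟨s', ⟨t, ht, e⟩, hF, hm, hc, hsol⟩ := h.exec_pass hinp hρ hN hs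
    (fun a i ws => hfresh (σ + 1) (by omega) a i ws)
  refine ⟨s', ⟨1 + t, ?_, .seq e₁ e⟩, hF.out, ?_, fun σ' hσ' a i ws => ?_, fun r hr hr' => ?_,
    fun a i σ' ws hσ' => ?_, hc, hsol⟩
  · rw [Nat.add_mul]
    omega
  · rw [hF.reg _ (by simp [rStamp, passKinds]), State.set_reg_self]
  · rw [hm _ (by simp; omega)]
    exact hfresh σ' (by omega) a i ws
  · rw [hF.reg r hr, hne r hr']
  · rw [hm _ (by simp; omega)]
    rfl

/-- All free variables are fixed, so one certainty pass decides the candidate. The root passes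
nothing on; its only relevant list is the one at the empty key, which is nonempty exactly if the
candidate is a consistent answer. -/
theorem exists_enumeratesFrom_nil [Nonempty D] [Fintype S.Rel] (q : Query S V D k)
    (hsjf : q.SelfJoinFree) (hppjt : q.AdmitsPPJT) : ∃ P C, EnumeratesFrom q [] P C := by
  classical
  obtain ⟨J, hJ⟩ := hppjt.exists_rootedJoinTree
  let C := Pass.certain (b := q.body) (Set.range q.head) J
  have hU : C.U = Set.range q.head := rfl
  have hsh : C.sh J.root = [] := Pass.ofTree_sh_root
  refine ⟨.seq (newPass C q.valReg J.order) (.seq (loadCell rX 2 J.root rStamp [])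
    (.ite rX rZero .skip (.instr (.emit ((List.finRange k).map fun j : Fin k => rVal j))))),
    C.passCost q.valReg J.order + 1 + 4, fun db inp hinp N hN c σ s hs => ?_⟩
  have hfits := Pass.fits_certain hsjf (Set.range q.head) J hJ (q.val c) db
  obtain ⟨s₁, ⟨t₁, ht₁, e₁⟩, hout, hst, hfresh, hreg, hmem, -, hsol⟩ :=
    hfits.exec_newPass hinp q.rkind_valReg hN hs.stamp hs.zero hs.one
      (by
        rintro v ⟨j, rfl⟩
        rw [q.valReg_head, q.val_head, hs.val j (by simp)]) hs.fresh
  have hcert : Pass.heads s₁.mem (σ + 1) J.root [] ↔ c ∈ q.consistentAnswers db := by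
    have := hfits.solves_iff hsol J.root (q.val c)
    rw [show (Pass.certain (Set.range q.head) J).sh J.root = [] from hsh, List.map_nil] at this
    rw [this]
    refine forall₂_congr fun r _ => exists_congr fun θ => ?_
    constructor
    · rintro ⟨h₁, -, h₂⟩
      refine ⟨fun i => h₂ i (J.mem_sub_root i), fun j => ?_⟩
      rw [h₁ _ ⟨j, rfl⟩, q.val_head]
    · rintro ⟨h₁, h₂⟩
      refine ⟨?_, fun v hv => ?_, fun i _ => h₁ i⟩
      · rintro v ⟨j, rfl⟩
        rw [h₂, q.val_head]
      · rw [show (Pass.certain (Set.range q.head) J).sh J.root = [] from hsh] at hv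
        simp at hv
  set Q : Program S D := .seq (loadCell rX 2 J.root rStamp [])
    (.ite rX rZero .skip (.instr (.emit ((List.finRange k).map fun j : Fin k => rVal j))))
  have hQ : Q.LoopFree := by simp [Q]
  have hcost : Q.cost = 4 := by simp [Q, Program.cost, loadCell, Program.skip]
  obtain ⟨t₂, ht₂, e₂⟩ := hQ.exec (inp := inp) s₁
  set s₂ := (s₁.set rTag (.inr (Nat.pair 2 J.root))).set rX
    (s₁.mem (cell 2 J.root (σ + 1) [])) with hs₂
  have hrunQ : Q.run inp s₁ = (Program.ite rX rZero .skip
      (.instr (.emit ((List.finRange k).map fun j : Fin k => rVal j)))).run inp s₂ := by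
    rw [hs₂]
    simp only [Q]
    rw [Program.run_seq, run_loadCell hst (by simp [rStamp, rTag]) (by simp)]
    rfl
  have hsame : State.SameExcept scratch s₂ s₁ :=
    ((State.SameExcept.refl _ _).set (by simp [rTag, scratch]) _).set (by simp [rX, scratch]) _
  have hz₂ : s₂.reg rZero = .inr 0 := by
    rw [hsame.reg _ (by simp [rZero, scratch]),
      hreg _ (by simp [rZero, passKinds]) (by simp [rZero]), hs.zero]
  have hX₂ : s₂.reg rX = s₁.mem (cell 2 J.root (σ + 1) []) := State.set_reg_self _ _ _
  have hkeep : ∀ s' : State D, s'.mem = s₂.mem → s'.reg = s₂.reg →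
      LevelKeeps (k := k) [] σ s' s := by
    intro s' hm hr
    refine ⟨⟨σ + 1, by omega, ?_, ?_⟩, fun a i σ' ws hσ' => ?_, fun r hr' => ?_⟩
    · rw [hr, hsame.reg _ (by simp [rStamp, scratch]), hst]
    · intro σ' hσ' a i ws
      rw [hm, hsame.mem]
      exact hfresh σ' hσ' a i ws
    · rw [hm, hsame.mem, hmem a i σ' ws hσ']
    · have := hr'.rkind_notMem
      rw [hr, hsame.reg r (fun h => this.1 (bodyKinds_subset_passKinds
        (scratch_subset_bodyKinds h))), hreg r this.1 this.2]
  refine ⟨_, t₁ + t₂, if c ∈ q.possibleAnswers db then [c] else [], .seq e₁ e₂, ?_, ?_, ?_, ?_, ?_⟩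
  · change t₁ ≤ (C.passCost q.valReg J.order + 1) * (N + 1) at ht₁
    rw [hcost] at ht₂
    calc t₁ + t₂ ≤ (C.passCost q.valReg J.order + 1) * (N + 1) + 4 * (N + 1) := by omega
      _ = (C.passCost q.valReg J.order + 1 + 4) * (N + 1) := by ring
      _ ≤ _ := Nat.le_mul_of_pos_right _ (by omega)
  · split_ifs <;> simp
  · intro c'
    split_ifs with hc
    · simp only [List.mem_singleton, List.not_mem_nil, not_false_eq_true, forall_const]
      constructor
      · rintro rfl
        exact ⟨hc, fun _ => rfl⟩
      · exact fun h => funext h.2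
    · simp only [List.not_mem_nil, not_false_eq_true, forall_const, false_iff, not_and]
      intro h h'
      exact hc (funext h' ▸ h)
  · rw [hrunQ]
    by_cases hc : c ∈ q.consistentAnswers db
    · rw [Program.run_ite_of_ne _ _ _ (by rw [hX₂, hz₂]; exact hcert.2 hc),
        if_pos (q.consistentAnswers_subset db hc)]
      simp only [Program.run_instr, Instr.step, hsame.out, hout, encode, hc, decide_true,
        List.filter_cons_of_pos, List.filter_nil, List.map_cons, List.map_nil, List.map_map]
      congr 2
      rw [List.ofFn_eq_map]
      refine List.map_congr_left fun j _ => ?_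
      rw [Function.comp, hsame.reg _ (by simp [rVal, scratch]),
        hreg _ (by simp [rVal, passKinds]) (by simp [rVal]), hs.val j (by simp)]
    · rw [Program.run_ite_of_eq _ _ _ (by rw [hX₂, hz₂]; exact not_not.1 fun h => hc (hcert.1 h)),
        Program.run_skip, hsame.out, hout]
      split_ifs <;> simp [encode, hc]
  · rw [hrunQ]
    by_cases hc : s₂.reg rX = s₂.reg rZero
    · rw [Program.run_ite_of_eq _ _ _ hc, Program.run_skip]
      exact hkeep _ rfl rfl
    · rw [Program.run_ite_of_ne _ _ _ hc]
      exact hkeep _ rfl rfl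

end Levels

/-! ### Enumeration by fixing free variables: the recursion -/

section Levels

variable {S : Schema} {V D : Type*} {k n : ℕ} {b : Body S V D (Fin n)}

/-- Read the value of `v` in the tuple of atom `i` at position `rPos j`, and compare that position
with the head of the linked list for this value. -/
noncomputable def readValue (b : Body S V D (Fin n)) (i : Fin n) (v : V) (j : Fin k) :
    Program S D :=
  .seq (.instr (.copy rIdx (rPos j))) (.seq (readTuple b i)
    (.seq (.instr (.copy (rVal j) (vreg b i v))) (.seq (loadCell rX 2 i (rPass j) [rVal j])
      (.seq (.instr (.copy rY rIdx)) (.instr (.succ rY))))))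

theorem loopFree_readValue (i : Fin n) (v : V) (j : Fin k) : (readValue b i v j).LoopFree := by
  simp [readValue, loopFree_readTuple]

theorem run_readValue {inp : Input S D} {s : State D} {i : Fin n} {v : V} {j : Fin k} {m σ : ℕ}
    {t : Tuple S D (b i).rel} {d : D} (hm : s.reg (rPos j) = .inr m)
    (ht : (inp (b i).rel)[m]? = some t) (hz : s.reg rZero = .inr 0)
    (hσ : s.reg (rPass j) = .inr σ) (hd : (b i).look t v = .inl d) :
    ((readValue b i v j).run inp s).mem = s.mem ∧ ((readValue b i v j).run inp s).out = s.out ∧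
      ((readValue b i v j).run inp s).reg (rVal j) = .inl d ∧
      ((readValue b i v j).run inp s).reg rX = s.mem (cell 2 i σ [.inl d]) ∧
      ((readValue b i v j).run inp s).reg rY = .inr (m + 1) ∧
      ∀ r, rkind r ∉ passKinds → r ≠ rVal j → ((readValue b i v j).run inp s).reg r = s.reg r := by
  set s₁ := s.set rIdx (.inr m) with hs₁
  have hrun₁ : (Program.instr (.copy rIdx (rPos j)) : Program S D).run inp s = s₁ := by
    simp [Instr.step, hm, hs₁]
  obtain ⟨h₁, -, h₃⟩ := run_readTuple (inp := inp) (s := s₁) (State.set_reg_self _ _ _) ht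
  set s₂ := (readTuple b i).run inp s₁
  have h₂ : ∀ r, rkind r ≠ 9 → r ≠ rIdx → s₂.reg r = s.reg r := fun r hr hr' => by
    rw [h₁.reg r (by simpa using hr), State.set_reg_of_ne _ _ hr']
  have hz₂ : s₂.reg rZero = .inr 0 := by
    rw [h₂ _ (by simp [rZero]) (by simp [rZero, rIdx]), hz]
  have hrun₃ : (Program.instr (.copy (rVal j) (vreg b i v)) : Program S D).run inp s₂ =
      s₂.set (rVal j) (.inl d) := by
    simp [Instr.step, reg_vreg hz₂ h₃, hd]
  have hrun₄ : (loadCell rX 2 i (rPass j) [rVal j] : Program S D).run inp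
      (s₂.set (rVal j) (.inl d)) = ((s₂.set (rVal j) (.inl d)).set rTag
        (.inr (Nat.pair 2 i))).set rX (s.mem (cell 2 i σ [.inl d])) := by
    rw [run_loadCell (σ := σ) _ (by simp [rPass, rTag]) (by simp [rVal, rTag])]
    · simp [h₁.mem, hs₁]
    · rw [State.set_reg_of_ne _ _ (by simp [rPass, rVal]), h₂ _ (by simp [rPass])
        (by simp [rPass, rIdx]), hσ]
  have hidx : (((s₂.set (rVal j) (.inl d)).set rTag (.inr (Nat.pair 2 i))).set rX
      (s.mem (cell 2 i σ [.inl d]))).reg rIdx = .inr m := by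
    rw [State.set_reg_of_ne _ _ (by simp [rIdx, rX]),
      State.set_reg_of_ne _ _ (by simp [rIdx, rTag]),
      State.set_reg_of_ne _ _ (by simp [rIdx, rVal]), h₁.reg _ (by simp [rIdx]),
      State.set_reg_self]
  have hrun : (readValue b i v j).run inp s = ((((s₂.set (rVal j) (.inl d)).set rTag
      (.inr (Nat.pair 2 i))).set rX (s.mem (cell 2 i σ [.inl d]))).set rY (.inr m)).set rY
      (.inr (m + 1)) := by
    rw [readValue, Program.run_seq, hrun₁, Program.run_seq, Program.run_seq, hrun₃,
      Program.run_seq, hrun₄, Program.run_seq]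
    simp only [Program.run_instr, Instr.step, State.set_reg_self, hidx, Word.mapNat]
  rw [hrun]
  refine ⟨?_, ?_, ?_, ?_, State.set_reg_self _ _ _, fun r hr hrv => ?_⟩
  · simp [h₁.mem, hs₁]
  · simp [h₁.out, hs₁]
  · simp [State.set_reg, rVal, rX, rY, rTag]
  · simp [State.set_reg, rX, rY]
  · have hne : ∀ r', rkind r' ∈ passKinds → r ≠ r' := by
      rintro r' h rfl
      exact hr h
    rw [State.set_reg_of_ne _ _ (hne _ (by simp [rY, passKinds])),
      State.set_reg_of_ne _ _ (hne _ (by simp [rY, passKinds])),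
      State.set_reg_of_ne _ _ (hne _ (by simp [rX, passKinds])),
      State.set_reg_of_ne _ _ (hne _ (by simp [rTag, passKinds])),
      State.set_reg_of_ne _ _ hrv]
    exact h₂ r (fun h => hr (.inr h)) (hne _ (by simp [rIdx, passKinds]))

theorem Query.mem_possible_iff [Nonempty D] (q : Query S V D k) {js : List (Fin k)} {j : Fin k}
    {db : Instance S D} {c : Fin k → D} {d : D} :
    (∃ θ : V → D, (∀ v ∈ q.fixedVars (j :: js), θ v = q.val c v) ∧ θ (q.head j) = d ∧
      ∀ i, (q.body i).Holds θ db) ↔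
    ∃ c' ∈ q.possibleAnswers db, (∀ l, l ∉ j :: js → c' l = c l) ∧ c' j = d := by
  constructor
  · rintro ⟨θ, h₁, h₂, h₃⟩
    refine ⟨fun l => θ (q.head l), ⟨θ, h₃, fun _ => rfl⟩, fun l hl => ?_, h₂⟩
    change θ (q.head l) = c l
    rw [h₁ _ ⟨l, hl, rfl⟩, q.val_head]
  · rintro ⟨c', ⟨θ, h₁, h₂⟩, h₃, h₄⟩
    refine ⟨θ, ?_, by rw [h₂, h₄], h₁⟩
    rintro v ⟨l, hl, rfl⟩
    rw [h₂, q.val_head, h₃ l hl]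

/-- Root a join tree at an atom that contains the variable `q.head j` and run the possible-answer
pass, letting the root pass on just this variable. The nonempty lists at the root then belong to
exactly the values that extend to a possible answer. Scan the table of the root and call `P` once
per such value. The pass and the scan are linear; the calls cost a linear amount per possible
answer, because none of them is made in vain. -/
theorem exists_enumeratesFrom_cons [Nonempty D] (q : Query S V D k) (hac : q.IsAcyclic)
    {j : Fin k} {js : List (Fin k)} (hj : j ∉ js) {P : Program S D} {C' : ℕ}
    (hP : EnumeratesFrom q js P C') : ∃ P C, EnumeratesFrom q (j :: js) P C := by
  classical
  obtain ⟨i₀, hi₀⟩ := q.head_safe j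
  obtain ⟨J, rfl⟩ := hac.exists_rootedJoinTree (q.fixedVars (j :: js)) i₀
  let C := Pass.possible (b := q.body) (q.fixedVars (j :: js)) J [q.head j]
  have hsh : C.sh J.root = [q.head j] := Pass.ofTree_sh_root
  let B : Program S D := .seq (readValue q.body J.root (q.head j) j) (.ite rX rY P .skip)
  set A := (readValue q.body J.root (q.head j) j : Program S D).cost with hA
  refine ⟨.seq (newPass C q.valReg J.order) (.seq (.instr (.copy (rPass j) rStamp))
    (.forEach (rPos j) (rEnd j) (q.body J.root).rel B)),
    (C.passCost q.valReg J.order + 1) + (A + 2) + C' + 6, fun db inp hinp N hN c σ s hs => ?_⟩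
  have hfits := Pass.fits_possible (q.fixedVars (j :: js)) J [q.head j] (by simpa using hi₀)
    (q.val c) db
  obtain ⟨s₁, ⟨t₁, ht₁, e₁⟩, hout, hst, hfresh, hreg, hmem, hchain, hsol⟩ :=
    hfits.exec_newPass hinp q.rkind_valReg hN hs.stamp hs.zero hs.one
      (by
        rintro v ⟨l, hl, rfl⟩
        rw [q.valReg_head, q.val_head, hs.val l hl]) hs.fresh
  change ∀ (i : Fin q.n) ws, Chain s₁.mem i (σ + 1) (s₁.mem (cell 2 i (σ + 1) ws))
        (C.bucket (q.val c) (Pass.heads s₁.mem (σ + 1)) db inp i ws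
          (inp (q.body i).rel).length) at hchain
  have hheads : ∀ d, s₁.mem (cell 2 J.root (σ + 1) [.inl d]) ≠ .inr 0 ↔
      ∃ c' ∈ q.possibleAnswers db, (∀ l, l ∉ j :: js → c' l = c l) ∧ c' j = d := by
    intro d
    have := hfits.solves_iff hsol J.root fun _ => d
    rw [show (Pass.possible (q.fixedVars (j :: js)) J [q.head j]).sh J.root = _ from hsh,
      List.map_singleton] at this
    rw [← q.mem_possible_iff]
    refine Iff.trans this ?_
    simp only [Set.mem_singleton_iff, forall_eq]
    refine exists_congr fun θ => and_congr_right fun _ => and_congr ?_ ?_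
    · rw [show (Pass.possible (q.fixedVars (j :: js)) J [q.head j]).sh J.root = _ from hsh]
      simp
    · exact ⟨fun h i => h i (J.mem_sub_root i), fun h i _ => h i⟩
  set len := (inp (q.body J.root).rel).length with hlen
  set H : D → Word D := fun d => s₁.mem (cell 2 J.root (σ + 1) [.inl d]) with hH
  -- the head of a list is the position of a tuple with the given value
  have hpos : ∀ d a, H d = .inr (a + 1) → a < len ∧ ∃ t,
      (inp (q.body J.root).rel)[a]? = some t ∧
        (q.body J.root).look t (q.head j) = .inl d := by
    intro d a h
    have hc := hchain J.root [.inl d]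
    rw [show s₁.mem (cell 2 J.root (σ + 1) [.inl d]) = .inr (a + 1) from h] at hc
    have hmem : a ∈ C.bucket (q.val c) (Pass.heads s₁.mem (σ + 1)) db inp J.root [.inl d] len := by
      generalize C.bucket (q.val c) (Pass.heads s₁.mem (σ + 1)) db inp J.root [.inl d] len = l
        at hc
      cases hc
      simp
    obtain ⟨ha, t, ht, -, hp⟩ := Pass.mem_bucket.1 hmem
    refine ⟨ha, t, ht, ?_⟩
    simpa [Pass.proj, hsh] using hp
  have hpos' : ∀ d, H d ≠ .inr 0 → ∃ a, H d = .inr (a + 1) := by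
    intro d h
    have hc := hchain J.root [.inl d]
    change Chain _ _ _ (H d) _ at hc
    generalize C.bucket (q.val c) (Pass.heads s₁.mem (σ + 1)) db inp J.root [.inl d] len = l
      at hc
    generalize H d = w at h hc
    cases hc with
    | nil => exact absurd rfl h
    | @cons a _ _ => exact ⟨a, rfl⟩
  set s₂ := s₁.set (rPass j) (.inr (σ + 1)) with hs₂
  have e₂ : Exec inp (.instr (.copy (rPass j) rStamp)) s₁ s₂ 1 := by
    have := Exec.instr (inp := inp) (Instr.copy (rPass j) rStamp) s₁
    simpa [Instr.step, hst, ← hs₂] using this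
  -- After `m` tuples, `L` contains the possible answers whose value of the variable heads its list
  -- at a position below `m`. The time is a constant for each tuple plus the recursive bound for
  -- each answer found.
  let Inv : ℕ → ℕ → State D → Prop := fun m τ s' => ∃ L : List (Fin k → D), L.Nodup ∧
    (∀ c', c' ∈ L ↔ c' ∈ q.possibleAnswers db ∧ (∀ l, l ∉ j :: js → c' l = c l) ∧
      ∃ m' < m, H (c' j) = .inr (m' + 1)) ∧
    s'.out = s.out ++ encode (L.filter fun c' => c' ∈ q.consistentAnswers db) ∧
    τ ≤ (A + 2) * m + C' * (N + 1) * L.length ∧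
    s'.reg (rPass j) = .inr (σ + 1) ∧ LevelKeeps (j :: js) (σ + 1) s' s₁
  have hkr : ∀ {r}, KeptReg (j :: js) r → KeptReg js r := by
    rintro r (h | h | ⟨l, hl, h⟩)
    · exact .inl h
    · exact .inr (.inl h)
    · exact .inr (.inr ⟨l, fun h => hl (List.mem_cons_of_mem _ h), h⟩)
  have hkset : ∀ (s' : State D) (r : ℕ) w, LevelKeeps (j :: js) (σ + 1) s' s₁ →
      (r = rPos j ∨ r = rEnd j ∨ r = rPass j ∨ r = rVal j) →
      LevelKeeps (j :: js) (σ + 1) (s'.set r w) s₁ := by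
    rintro s' r w ⟨⟨σ', h₁, h₂, h₃⟩, h₄, h₅⟩ hr
    refine ⟨⟨σ', h₁, ?_, h₃⟩, h₄, fun x hx => ?_⟩
    · rw [State.set_reg_of_ne, h₂]
      rintro h
      rw [← h] at hr
      simp [rStamp, rPos, rEnd, rPass, rVal] at hr
    · rw [State.set_reg_of_ne, h₅ x hx]
      rintro rfl
      rcases hx with rfl | rfl | ⟨l, hl, hx⟩
      · simp [rZero, rPos, rEnd, rPass, rVal] at hr
      · simp [rOne, rPos, rEnd, rPass, rVal] at hr
      · have hlj : (l : ℕ) ≠ j := fun h => hl (by simp [Fin.ext h])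
        rcases hr with rfl | rfl | rfl | rfl <;>
          simp [rPos, rEnd, rPass, rVal] at hx <;> exact hlj hx.symm
  have hk₁ : LevelKeeps (j :: js) (σ + 1) s₁ s₁ :=
    ⟨⟨σ + 1, le_rfl, hst, hfresh⟩, fun _ _ _ _ _ => rfl, fun _ _ => rfl⟩
  obtain ⟨s₃, t₃, τ, e₃, ht₃, L, hnd, hL, hout₃, hτ, hpass, hkeep⟩ :=
    exec_forEach (inp := inp) (i := rPos j) (l := rEnd j) (R := (q.body J.root).rel) (P := B)
      (by simp [rEnd, rPos]) Inv (s := s₂)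
    (by
      refine ⟨[], by simp, by simp, by simpa [encode, hs₂] using hout, by simp, ?_, ?_⟩
      · simp [State.set_reg, rEnd, rPass, rPos, hs₂]
      · refine hkset _ _ _ (hkset _ _ _ (hkset _ _ _ hk₁ ?_) ?_) ?_ <;> simp)
    (by
      rintro m hm τ s' ⟨L, hnd, hL, hout', hτ, hpass, hkeep⟩ hpm hem
      obtain ⟨t, ht⟩ : ∃ t, (inp (q.body J.root).rel)[m]? = some t :=
        ⟨_, List.getElem?_eq_getElem hm⟩
      obtain ⟨d, hd⟩ : ∃ d, (q.body J.root).look t (q.head j) = .inl d := by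
        obtain ⟨p, hp⟩ := hi₀
        have h : ∃ p, (q.body J.root).args p = .var (q.head j) := ⟨p, hp⟩
        exact ⟨_, by rw [Atom.look, dif_pos h]⟩
      have hz : s'.reg rZero = .inr 0 := by
        rw [hkeep.reg _ (.inl rfl), hreg _ (by simp [rZero, passKinds]) (by simp [rZero]), hs.zero]
      have ho : s'.reg rOne = .inr 1 := by
        rw [hkeep.reg _ (.inr (.inl rfl)), hreg _ (by simp [rOne, passKinds]) (by simp [rOne]),
          hs.one]
      obtain ⟨h₁, h₂, h₃, h₄, h₅, h₆⟩ := run_readValue (inp := inp) hpm ht hz hpass hd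
      obtain ⟨t₄, ht₄, e₄⟩ := (loopFree_readValue (b := q.body) J.root (q.head j) j).exec
        (inp := inp) s'
      set s₄ := (readValue q.body J.root (q.head j) j).run inp s'
      rw [hkeep.mem _ _ _ _ le_rfl] at h₄
      change s₄.reg rX = H d at h₄
      obtain ⟨σ', hσ', hst', hfresh'⟩ := hkeep.stamp
      have hk₄ : LevelKeeps (j :: js) (σ + 1) s₄ s₁ := by
        refine ⟨⟨σ', hσ', ?_, ?_⟩, fun a i σ' ws h => ?_, fun r hr => ?_⟩
        · rw [h₆ _ (by simp [rStamp, passKinds]) (by simp [rStamp, rVal]), hst']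
        · intro σ'' h a i ws
          rw [h₁]
          exact hfresh' σ'' h a i ws
        · rw [h₁, hkeep.mem a i σ' ws h]
        · rw [h₆ _ hr.rkind_notMem.1, hkeep.reg r hr]
          rintro rfl
          rcases hr with h | h | ⟨l, hl, h⟩
          · simp [rVal, rZero] at h
          · simp [rVal, rOne] at h
          · simp [rVal, rPos, rEnd, rPass] at h
            exact hl (by simp [Fin.ext h])
      have hp₄ : s₄.reg (rPass j) = .inr (σ + 1) := by
        rw [h₆ _ (by simp [rPass, passKinds]) (by simp [rPass, rVal]), hpass]
      have hi₄ : s₄.reg (rPos j) = .inr m := by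
        rw [h₆ _ (by simp [rPos, passKinds]) (by simp [rPos, rVal]), hpm]
      have hl₄ : s₄.reg (rEnd j) = .inr len := by
        rw [h₆ _ (by simp [rEnd, passKinds]) (by simp [rEnd, rVal]), hem]
      -- A value may occur in many tuples but is processed only at the tuple that heads its list, so
      -- it is processed exactly once, without keeping a separate list of values.
      by_cases hHd : H d = .inr (m + 1)
      · have hready : LevelReady js (Function.update c j d) σ' s₄ := by
          refine ⟨?_, ?_, ?_, fun l hl => ?_, ?_⟩
          · rw [h₆ _ (by simp [rStamp, passKinds]) (by simp [rStamp, rVal]), hst']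
          · rw [h₆ _ (by simp [rZero, passKinds]) (by simp [rZero, rVal]), hz]
          · rw [h₆ _ (by simp [rOne, passKinds]) (by simp [rOne, rVal]), ho]
          · by_cases hlj : l = j
            · subst hlj
              rw [h₃, Function.update_self]
            · have hl' : l ∉ j :: js := by simp [hlj, hl]
              rw [Function.update_of_ne hlj, hk₄.reg _ (.inr (.inr ⟨l, hl', .inl rfl⟩)),
                hreg _ (by simp [rVal, passKinds]) (by simp [rVal]), hs.val l hl']
          · intro σ'' h a i ws
            rw [h₁]
            exact hfresh' σ'' h a i ws
        obtain ⟨s₅, t₅, L', e₅, ht₅, hnd', hL', hout₅, hk₅⟩ := hP db inp hinp N hN _ _ _ hready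
        have hL'' : ∀ c', c' ∈ L' ↔ c' ∈ q.possibleAnswers db ∧
            (∀ l, l ∉ j :: js → c' l = c l) ∧ c' j = d := by
          intro c'
          rw [hL']
          refine and_congr_right fun _ => ⟨fun h => ⟨fun l hl => ?_, ?_⟩, fun h l hl => ?_⟩
          · rw [h l (fun h => hl (List.mem_cons_of_mem _ h)), Function.update_of_ne]
            rintro rfl
            simp at hl
          · rw [h j hj, Function.update_self]
          · by_cases hlj : l = j
            · subst hlj
              rw [h.2, Function.update_self]
            · rw [Function.update_of_ne hlj, h.1 l (by simp [hlj, hl])]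
        -- The value has a nonempty list, so it extends to a possible answer. This removes the `max
        -- 1` from the recursive bound and lets the bounds for different values add up.
        have hne : 1 ≤ L'.length := by
          obtain ⟨c', hc', h⟩ := (hheads d).1 (by rw [show s₁.mem _ = _ from hHd]; simp)
          exact List.length_pos_of_mem ((hL'' c').2 ⟨hc', h⟩)
        rw [max_eq_right hne] at ht₅
        obtain ⟨σ₅, hσ₅, hst₅, hfresh₅⟩ := hk₅.stamp
        refine ⟨s₅, t₄ + (t₅ + 1), .seq e₄ (.ite_eq (by rw [h₄, h₅, hHd]) e₅), ?_, ?_, L ++ L',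
          ?_, fun c' => ?_, ?_, ?_, ?_, ?_⟩
        · rw [hk₅.reg _ (.inr (.inr ⟨j, hj, by simp⟩)), hi₄]
        · rw [hk₅.reg _ (.inr (.inr ⟨j, hj, by simp⟩)), hl₄]
        · rw [List.nodup_append]
          refine ⟨hnd, hnd', ?_⟩
          rintro x hx y hy rfl
          obtain ⟨-, -, m', hm', hxm⟩ := (hL x).1 hx
          rw [((hL'' x).1 hy).2.2, hHd] at hxm
          have := Sum.inr.inj hxm
          omega
        · rw [List.mem_append, hL, hL'', ← and_or_left, ← and_or_left]
          refine and_congr_right fun _ => and_congr_right fun _ => ⟨?_, ?_⟩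
          · rintro (⟨m', hm', h⟩ | h)
            · exact ⟨m', by omega, h⟩
            · exact ⟨m, by omega, by rw [h, hHd]⟩
          · rintro ⟨m', hm', h⟩
            -- A list headed by position `m` belongs to the value in the tuple there, so the only
            -- value newly covered is `d`.
            by_cases hmm : m' = m
            · subst hmm
              obtain ⟨-, t', ht', hd'⟩ := hpos _ _ h
              rw [ht] at ht'
              cases ht'
              rw [hd] at hd'
              exact .inr (Sum.inl.inj hd').symm
            · exact .inl ⟨m', by omega, h⟩
        · rw [State.set_out, hout₅, h₂, hout', List.filter_append, encode, encode, encode,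
            List.map_append, List.append_assoc]
        · rw [List.length_append, Nat.mul_add, Nat.mul_add]
          omega
        · rw [State.set_reg_of_ne _ _ (by simp [rPass, rPos]),
            hk₅.reg _ (.inr (.inr ⟨j, hj, by simp⟩)), hp₄]
        · refine hkset _ _ _ ⟨⟨σ₅, by omega, hst₅, hfresh₅⟩, fun a i σ'' ws h => ?_,
            fun r hr => ?_⟩ (by simp)
          · rw [hk₅.mem _ _ _ _ (by omega), hk₄.mem _ _ _ _ h]
          · rw [hk₅.reg r (hkr hr), hk₄.reg r hr]
      · refine ⟨s₄, t₄ + (1 + 1), .seq e₄ (.ite_ne (by rwa [h₄, h₅]) ?_), hi₄, hl₄, L, hnd,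
          fun c' => ?_, ?_, ?_, ?_, hkset _ _ _ hk₄ (by simp)⟩
        · have := Exec.instr (inp := inp) (Instr.copy 0 0) s₄
          rwa [show (Instr.copy 0 0).step inp s₄ = s₄ from Program.run_skip inp s₄] at this
        · rw [hL]
          refine and_congr_right fun _ => and_congr_right fun _ => ⟨?_, ?_⟩
          · rintro ⟨m', hm', h⟩
            exact ⟨m', by omega, h⟩
          · rintro ⟨m', hm', h⟩
            by_cases hmm : m' = m
            · subst hmm
              obtain ⟨-, t', ht', hd'⟩ := hpos _ _ h
              rw [ht] at ht'
              cases ht'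
              rw [hd] at hd'
              rw [← Sum.inl.inj hd'] at h
              exact absurd h hHd
            · exact ⟨m', by omega, h⟩
        · rw [State.set_out, h₂, hout']
        · rw [Nat.mul_add]
          omega
        · rw [State.set_reg_of_ne _ _ (by simp [rPass, rPos]), hp₄])
  have hlenN : len ≤ N := hN _
  refine ⟨s₃, t₁ + (1 + t₃), L, .seq e₁ (.seq e₂ e₃), ?_, hnd, fun c' => ?_, hout₃, ?_⟩
  · have hM : 1 ≤ max 1 L.length := le_max_left _ _
    have hML : L.length ≤ max 1 L.length := le_max_right _ _
    have h₁ : C' * (N + 1) * L.length ≤ C' * (N + 1) * max 1 L.length :=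
      Nat.mul_le_mul_left _ hML
    have h₂ : (A + 2) * len ≤ (A + 2) * (N + 1) := Nat.mul_le_mul_left _ (by omega)
    change t₁ ≤ (C.passCost q.valReg J.order + 1) * (N + 1) at ht₁
    have h₃ : t₁ + (1 + t₃) ≤ ((C.passCost q.valReg J.order + 1) + (A + 2) + 6) * (N + 1) +
        C' * (N + 1) * max 1 L.length := by
      rw [← hlen] at hτ ht₃
      rw [Nat.add_mul, Nat.add_mul]
      omega
    refine h₃.trans ?_
    have h₄ : ((C.passCost q.valReg J.order + 1) + (A + 2) + 6) * (N + 1) ≤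
        ((C.passCost q.valReg J.order + 1) + (A + 2) + 6) * (N + 1) * max 1 L.length :=
      Nat.le_mul_of_pos_right _ hM
    refine (Nat.add_le_add_right h₄ _).trans (le_of_eq ?_)
    ring
  · rw [hL]
    refine and_congr_right fun hc' => ⟨fun h => h.1, fun h => ⟨h, ?_⟩⟩
    obtain ⟨a, ha⟩ := hpos' (c' j) ((hheads (c' j)).2 ⟨c', hc', h, rfl⟩)
    exact ⟨a, (hpos _ _ ha).1, ha⟩
  · obtain ⟨σ', h₁, h₂, h₃⟩ := hkeep.stamp
    refine ⟨⟨σ', by omega, h₂, h₃⟩, fun a i σ' ws h => ?_, fun r hr => ?_⟩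
    · rw [hkeep.mem _ _ _ _ (by omega), hmem _ _ _ _ h]
    · rw [hkeep.reg r hr, hreg r hr.rkind_notMem.1 hr.rkind_notMem.2]

theorem exists_enumeratesFrom [Nonempty D] [Fintype S.Rel] (q : Query S V D k)
    (hac : q.IsAcyclic) (hsjf : q.SelfJoinFree) (hppjt : q.AdmitsPPJT) (js : List (Fin k))
    (hjs : js.Nodup) : ∃ P C, EnumeratesFrom q js P C := by
  induction js with
  | nil => exact exists_enumeratesFrom_nil q hsjf hppjt
  | cons j js ih =>
    rw [List.nodup_cons] at hjs
    obtain ⟨P, C, h⟩ := ih hjs.2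
    exact exists_enumeratesFrom_cons q hac hjs.1 h

theorem Input.Lists.length_le_size {S : Schema} {D : Type*} [Fintype S.Rel] {db : Instance S D}
    {inp : Input S D} (h : inp.Lists db) (R : S.Rel) : (inp R).length ≤ db.size := by
  classical
  have : (inp R).toFinset = db R := by
    ext t
    rw [List.mem_toFinset, (h R).2]
  rw [← List.toFinset_card_of_nodup (h R).1, this]
  exact Finset.single_le_sum (f := fun R => (db R).card) (fun _ _ => Nat.zero_le _)
    (Finset.mem_univ R)

theorem exists_computes_consistentAnswers [Nonempty D] [Fintype S.Rel] (q : Query S V D k)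
    (hac : q.IsAcyclic) (hsjf : q.SelfJoinFree) (hppjt : q.AdmitsPPJT) :
    ∃ (P : Program S D) (C : ℕ), P.Computes q.consistentAnswers
      (fun db => C * (max 1 db.size * max 1 (q.possibleAnswers db).ncard)) := by
  classical
  obtain ⟨P, C, h⟩ := exists_enumeratesFrom q hac hsjf hppjt (List.finRange k)
    (List.nodup_finRange k)
  -- Registers and memory start at 0, which provides the stamp, the zero register and the unused
  -- cells; only the register for 1 has to be set, at the cost of one step. The factor 2 comes from
  -- replacing `db.size + 1` by `max 1 db.size`.
  refine ⟨.seq (.instr (.lit rOne (.inr 1))) P, 2 * C + 1, fun db inp hinp => ?_⟩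
  obtain ⟨s', t, L, e, ht, hnd, hL, hout, -⟩ := h db inp hinp db.size hinp.length_le_size
    (fun _ => Classical.arbitrary D) 0 ((State.init D).set rOne (.inr 1))
    ⟨by simp [State.set_reg, rStamp, rOne, State.init],
      by simp [State.set_reg, rZero, rOne, State.init],
      State.set_reg_self _ _ _, fun l hl => absurd (List.mem_finRange l) hl,
      fun _ _ _ _ _ => rfl⟩
  refine ⟨s', 1 + t, L.filter fun c => c ∈ q.consistentAnswers db, .seq (.instr _ _) e, ?_, ?_,
    hnd.filter _, fun c => ?_⟩
  · have hcard : (q.possibleAnswers db).ncard = L.length := by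
      rw [← List.toFinset_card_of_nodup hnd, ← Set.ncard_coe_finset]
      congr 1
      ext c
      simp [hL]
    change 1 + t ≤ (2 * C + 1) * (max 1 db.size * max 1 (q.possibleAnswers db).ncard)
    rw [hcard]
    have h₁ : 1 ≤ max 1 db.size * max 1 L.length :=
      Nat.mul_le_mul (le_max_left 1 db.size) (le_max_left 1 L.length)
    have h₂ : db.size + 1 ≤ 2 * max 1 db.size := by omega
    calc 1 + t ≤ 1 + C * (db.size + 1) * max 1 L.length := by omega
      _ ≤ 1 + C * (2 * max 1 db.size) * max 1 L.length := by gcongr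
      _ = 1 + 2 * C * (max 1 db.size * max 1 L.length) := by ring
      _ ≤ (2 * C + 1) * (max 1 db.size * max 1 L.length) := by
        rw [Nat.add_mul]
        omega
  · rw [hout]
    simp [encode, State.init]
  · simp only [List.mem_filter, hL, decide_eq_true_eq]
    constructor
    · exact fun h => h.2
    · exact fun h => ⟨⟨q.consistentAnswers_subset db h,
        fun l hl => absurd (List.mem_finRange l) hl⟩, h⟩

end Levels

/-! ### Top-down enumeration through the linked lists -/

section Enumeration

variable {S : Schema} {V D : Type*} {n : ℕ} {b : Body S V D (Fin n)}

/-- Registers that are changed by the loops over the tuples of the atoms in `l`. -/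
def ChangedReg (l : List (Fin n)) (r : ℕ) : Prop :=
  rkind r < 6 ∨ ∃ i ∈ l, r = rPtr i ∨ ∃ p, r = rTup i p

theorem ChangedReg.cons {i : Fin n} {l : List (Fin n)} {r : ℕ} (h : ChangedReg l r) :
    ChangedReg (i :: l) r :=
  h.imp id fun ⟨j, hj, h⟩ => ⟨j, List.mem_cons_of_mem _ hj, h⟩

/-- Run `P` for the tuple of atom `i` at the current position of a linked list, and move to the
next position. -/
noncomputable def listBody (b : Body S V D (Fin n)) (i : Fin n) (P : Program S D) : Program S D :=
  .seq (.seq (.instr (.copy rIdx (rPtr i))) (.seq (.instr (.pred rIdx)) (readTuple b i)))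
    (.seq P (.seq (.instr (.copy rIdx (rPtr i))) (.seq (.instr (.pred rIdx))
      (loadCell (rPtr i) 3 i rStamp [rIdx]))))

/-- Enumerate the joining tuples of the atoms in the list, and emit the registers `regs` for each
choice. -/
noncomputable def enumerate (b : Body S V D (Fin n)) (par : Fin n → Fin n) (sh : Fin n → List V)
    (regs : List ℕ) : List (Fin n) → Program S D
  | [] => .instr (.emit regs)
  | i :: l => .seq (loadCell (rPtr i) 2 i rStamp ((sh i).map (vreg b (par i))))
    (.loop (rPtr i) rZero (listBody b i (enumerate b par sh regs l)))

/-- A bound for the time of `enumerate` per emitted tuple. -/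
noncomputable def enumerateCost (b : Body S V D (Fin n)) : List (Fin n) → ℕ
  | [] => 1
  | i :: l => (readTuple b i).cost + enumerateCost b l + 10

/-- A choice of a tuple for every atom. -/
abbrev Choice (b : Body S V D (Fin n)) : Type _ := (i : Fin n) → Tuple S D (b i).rel

/-- The key at which the tuples of atom `i` that join with the tuple of its parent are stored. -/
noncomputable def Choice.key (T : Choice b) (par : Fin n → Fin n) (sh : Fin n → List V)
    (i : Fin n) : List (Word D) :=
  (sh i).map ((b (par i)).look (T (par i)))

/-- The state of the enumeration when tuples have been chosen for the atoms outside `l`. -/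
structure Choice.Held (T : Choice b) (l : List (Fin n)) (σ : ℕ)
    (mem : List (Word D) → Word D) (s : State D) : Prop where
  mem_eq : s.mem = mem
  stamp : s.reg rStamp = .inr σ
  zero : s.reg rZero = .inr 0
  tup : ∀ i, i ∉ l → ∀ p : Fin (S.arity (b i).rel), s.reg (rTup i p) = .inl (T i p)

theorem notChangedReg_of_rkind {l : List (Fin n)} {r : ℕ} (h : rkind r = 6 ∨ rkind r = 7) :
    ¬ ChangedReg l r := by
  rintro (h' | ⟨i, -, rfl | ⟨p, rfl⟩⟩)
  · omega
  · simp [rPtr] at h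
  · simp [rTup] at h

theorem notChangedReg_rTup {l : List (Fin n)} {i : Fin n} (hi : i ∉ l) (p : ℕ) :
    ¬ ChangedReg l (rTup i p) := by
  rintro (h | ⟨j, hj, h | ⟨p', h⟩⟩)
  · simp [rTup] at h
  · simp [rTup, rPtr] at h
  · simp only [rTup, rg_inj] at h
    exact hi (Fin.ext h.2.1 ▸ hj)

theorem notChangedReg_rPtr {l : List (Fin n)} {i : Fin n} (hi : i ∉ l) :
    ¬ ChangedReg l (rPtr i) := by
  rintro (h | ⟨j, hj, h | ⟨p', h⟩⟩)
  · simp [rPtr] at h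
  · simp only [rPtr, rg_inj] at h
    exact hi (Fin.ext h.2.1 ▸ hj)
  · simp [rTup, rPtr] at h

theorem Choice.Held.congr {T : Choice b} {l : List (Fin n)} {σ : ℕ}
    {mem : List (Word D) → Word D} {s s' : State D} (h : T.Held l σ mem s)
    (hm : s'.mem = s.mem) (hr : ∀ r, ¬ ChangedReg l r → s'.reg r = s.reg r) :
    T.Held l σ mem s' where
  mem_eq := hm.trans h.mem_eq
  stamp := (hr _ (notChangedReg_of_rkind (.inl (by simp [rStamp])))).trans h.stamp
  zero := (hr _ (notChangedReg_of_rkind (.inr (by simp [rZero])))).trans h.zero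
  tup i hi p := (hr _ (notChangedReg_rTup hi p)).trans (h.tup i hi p)

variable {inp : Input S D}

/-- The specification of a program that enumerates the choices of tuples for the atoms in `l`. -/
def Enumerates (inp : Input S D) (l : List (Fin n)) (σ : ℕ) (mem : List (Word D) → Word D)
    (word : Choice b → List (Word D)) (P : Program S D) (c : ℕ) (T : Choice b)
    (L : List (Choice b)) : Prop :=
  ∀ s, T.Held l σ mem s → ∃ s' t, Exec inp P s s' t ∧ t ≤ c * L.length ∧ s'.mem = s.mem ∧
    (∀ r, ¬ ChangedReg l r → s'.reg r = s.reg r) ∧ s'.out = s.out ++ L.map word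

/-- The inner program may overwrite `rIdx` but keeps `rPtr i`, because `i ∉ l`. The position is
therefore recomputed from the pointer, which is the position plus one, before the link is followed.
-/
theorem exec_listBody {i : Fin n} {l : List (Fin n)} (hi : i ∉ l) {σ : ℕ}
    {mem : List (Word D) → Word D} {word : Choice b → List (Word D)} {P : Program S D} {c : ℕ}
    {T : Choice b} {L : List (Choice b)} {a : ℕ} {t : Tuple S D (b i).rel}
    (ht : (inp (b i).rel)[a]? = some t)
    (hP : Enumerates inp l σ mem word P c (Function.update T i t) L) {s : State D}
    (hs : T.Held (i :: l) σ mem s) (ha : s.reg (rPtr i) = .inr (a + 1)) :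
    ∃ s' τ, Exec inp (listBody b i P) s s' τ ∧ τ ≤ (readTuple b i).cost + 6 + c * L.length ∧
      s'.mem = s.mem ∧ (∀ r, ¬ ChangedReg (i :: l) r → s'.reg r = s.reg r) ∧
      s'.out = s.out ++ L.map word ∧ s'.reg (rPtr i) = mem (cell 3 i σ [.inr a]) := by
  have hidx : ∀ s : State D, s.reg (rPtr i) = .inr (a + 1) →
      (Program.seq (.instr (.copy rIdx (rPtr i))) (.instr (.pred rIdx)) : Program S D).run inp s =
        (s.set rIdx (.inr (a + 1))).set rIdx (.inr a) := by
    intro s h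
    simp [Instr.step, h, Word.mapNat]
  set Q₁ : Program S D := .seq (.instr (.copy rIdx (rPtr i)))
    (.seq (.instr (.pred rIdx)) (readTuple b i)) with hQ₁
  set Q₂ : Program S D := .seq (.instr (.copy rIdx (rPtr i))) (.seq (.instr (.pred rIdx))
      (loadCell (rPtr i) 3 i rStamp [rIdx])) with hQ₂
  have hl₁ : Q₁.LoopFree := ⟨trivial, trivial, loopFree_readTuple i⟩
  have hl₂ : Q₂.LoopFree := ⟨trivial, trivial, loopFree_loadCell⟩
  set s₀ := (s.set rIdx (.inr (a + 1))).set rIdx (.inr a) with hs₀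
  have hrun₁ : Q₁.run inp s = (readTuple b i).run inp s₀ := by
    rw [hs₀, ← hidx s ha]
    rfl
  obtain ⟨h₁, h₂, h₃⟩ := run_readTuple (inp := inp) (s := s₀) (State.set_reg_self _ _ _) ht
  obtain ⟨t₁, ht₁, e₁⟩ := hl₁.exec (inp := inp) s
  rw [hrun₁] at e₁
  set s₁ := (readTuple b i).run inp s₀ with hs₁
  have hreg₁ : ∀ r, rkind r ≠ 4 → (∀ p, r ≠ rTup i p) → s₁.reg r = s.reg r := by
    intro r hr hr'
    have : r ≠ rIdx := by
      rintro rfl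
      simp [rIdx] at hr
    rw [h₂ r hr', hs₀, State.set_reg_of_ne _ _ this, State.set_reg_of_ne _ _ this]
  have hc₁ : ∀ r, ¬ ChangedReg (i :: l) r → s₁.reg r = s.reg r := by
    intro r hr
    refine hreg₁ r (fun h => hr (.inl (by omega))) ?_
    rintro p rfl
    exact hr (.inr ⟨i, by simp, .inr ⟨p, rfl⟩⟩)
  have hheld : Choice.Held (Function.update T i t) l σ mem s₁ := by
    have := hs.congr h₁.mem hc₁
    refine ⟨this.mem_eq, this.stamp, this.zero, fun x hx p => ?_⟩
    by_cases hxi : x = i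
    · subst hxi
      rw [Function.update_self]
      exact h₃ p
    · rw [Function.update_of_ne hxi]
      exact this.tup x (by simp [hxi, hx]) p
  obtain ⟨s₂, t₂, e₂, ht₂, hm₂, hc₂, ho₂⟩ := hP s₁ hheld
  have hptr₂ : s₂.reg (rPtr i) = .inr (a + 1) := by
    rw [hc₂ _ (notChangedReg_rPtr hi), hreg₁ _ (by simp [rPtr]) (by simp [rPtr, rTup]), ha]
  have hst₂ : s₂.reg rStamp = .inr σ := (hheld.congr hm₂ hc₂).stamp
  obtain ⟨t₃, ht₃, e₃⟩ := hl₂.exec (inp := inp) s₂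
  set s₃ := (s₂.set rIdx (.inr (a + 1))).set rIdx (.inr a) with hs₃
  have hne : ∀ r, rkind r ≠ 4 → s₃.reg r = s₂.reg r := by
    intro r hr
    have : r ≠ rIdx := by
      rintro rfl
      simp [rIdx] at hr
    rw [hs₃, State.set_reg_of_ne _ _ this, State.set_reg_of_ne _ _ this]
  have hrun₂ : Q₂.run inp s₂ =
      (s₃.set rTag (.inr (Nat.pair 3 i))).set (rPtr i) (mem (cell 3 i σ [.inr a])) := by
    have : Q₂.run inp s₂ = (loadCell (rPtr i) 3 i rStamp [rIdx]).run inp s₃ := by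
      rw [hs₃, ← hidx s₂ hptr₂]
      rfl
    rw [this, run_loadCell (σ := σ) (by rw [hne _ (by simp [rStamp]), hst₂])
      (by simp [rStamp, rTag]) (by simp [rTag, rIdx])]
    congr 2
    rw [List.map_singleton, hs₃, State.set_reg_self]
    exact congrFun (hm₂.trans hheld.mem_eq) _
  rw [hrun₂] at e₃
  refine ⟨_, t₁ + (t₂ + t₃), .seq e₁ (.seq e₂ e₃), ?_, ?_, fun r hr => ?_, ?_,
    State.set_reg_self _ _ _⟩
  · simp only [hQ₁, Program.cost] at ht₁
    simp only [hQ₂, Program.cost, loadCell] at ht₃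
    omega
  · exact hm₂.trans h₁.mem
  · have h₆ : ¬ rkind r < 6 := fun h => hr (.inl h)
    rw [State.set_reg_of_ne, State.set_reg_of_ne, hne r (by omega),
      hc₂ r fun h => hr h.cons, hc₁ r hr]
    · rintro rfl
      simp [rTag] at h₆
    · rintro rfl
      exact hr (.inr ⟨i, by simp, .inl rfl⟩)
  · rw [State.set_out, State.set_out, hs₃, State.set_out, State.set_out, ho₂, h₁.out]
    rfl

/-- The tuple at a position of the input. -/
noncomputable def tupleAt [Nonempty D] (b : Body S V D (Fin n)) (inp : Input S D) (i : Fin n)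
    (a : ℕ) : Tuple S D (b i).rel :=
  ((inp (b i).rel)[a]?).getD fun _ => Classical.arbitrary D

variable [Nonempty D]

/-- The choices that extend `T` by joining tuples for the atoms in the list; the positions of the
tuples of atom `i` with the key `ws` are `bk i ws`. -/
noncomputable def choices (inp : Input S D) (par : Fin n → Fin n) (sh : Fin n → List V)
    (bk : Fin n → List (Word D) → List ℕ) : List (Fin n) → Choice b → List (Choice b)
  | [], T => [T]
  | i :: l, T => (bk i (T.key par sh i)).flatMap fun a =>
    choices inp par sh bk l (Function.update T i (tupleAt b inp i a))

/-- The enumeration has no dead ends. -/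
def NoDeadEnd (inp : Input S D) (par : Fin n → Fin n) (sh : Fin n → List V)
    (bk : Fin n → List (Word D) → List ℕ) : List (Fin n) → Choice b → Prop
  | [], _ => True
  | i :: l, T => bk i (T.key par sh i) ≠ [] ∧ ∀ a ∈ bk i (T.key par sh i),
    NoDeadEnd inp par sh bk l (Function.update T i (tupleAt b inp i a))

variable {par : Fin n → Fin n} {sh : Fin n → List V}
  {bk : Fin n → List (Word D) → List ℕ}

/-- Every partial choice leads to at least one complete one, to which the bookkeeping at each level
can be charged. -/
theorem length_choices_pos {l : List (Fin n)} {T : Choice b}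
    (h : NoDeadEnd inp par sh bk l T) : 1 ≤ (choices inp par sh bk l T).length := by
  induction l generalizing T with
  | nil => simp [choices]
  | cons i l ih =>
    obtain ⟨a, ha⟩ := List.exists_mem_of_ne_nil _ h.1
    obtain ⟨T', hT'⟩ := List.exists_mem_of_length_pos (ih (h.2 a ha))
    exact List.length_pos_of_mem (List.mem_flatMap.2 ⟨a, ha, hT'⟩)

theorem exec_listLoop {i : Fin n} {l : List (Fin n)} (hi : i ∉ l) {σ : ℕ}
    {mem : List (Word D) → Word D} {word : Choice b → List (Word D)} {P : Program S D} {c : ℕ}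
    {T : Choice b} {L : ℕ → List (Choice b)} {p : Word D} {as : List ℕ}
    (hp : Chain mem i σ p as)
    (hP : ∀ a ∈ as, a < (inp (b i).rel).length ∧ 1 ≤ (L a).length ∧
      Enumerates inp l σ mem word P c (Function.update T i (tupleAt b inp i a)) (L a))
    {s : State D} (hs : T.Held (i :: l) σ mem s) (hptr : s.reg (rPtr i) = p) :
    ∃ s' τ, Exec inp (.loop (rPtr i) rZero (listBody b i P)) s s' τ ∧
      τ ≤ ((readTuple b i).cost + 7 + c) * (as.flatMap L).length + 1 ∧
      s'.mem = s.mem ∧ (∀ r, ¬ ChangedReg (i :: l) r → s'.reg r = s.reg r) ∧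
      s'.out = s.out ++ (as.flatMap L).map word := by
  induction hp generalizing s with
  | nil =>
    exact ⟨s, 1, .loop_eq (by rw [hptr, hs.zero]), by simp, rfl, fun _ _ => rfl, by simp⟩
  | @cons a as _ ih =>
    obtain ⟨ha, hpos, hPa⟩ := hP a (by simp)
    have hget : (inp (b i).rel)[a]? = some (tupleAt b inp i a) := by
      simp [tupleAt, List.getElem?_eq_getElem ha]
    obtain ⟨s₁, t₁, e₁, ht₁, hm₁, hc₁, ho₁, hptr₁⟩ := exec_listBody hi hget hPa hs hptr
    obtain ⟨s₂, t₂, e₂, ht₂, hm₂, hc₂, ho₂⟩ := ih (fun x hx => hP x (by simp [hx]))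
      (hs.congr hm₁ hc₁) hptr₁
    refine ⟨s₂, t₁ + t₂ + 1, .loop_ne (by rw [hptr, hs.zero]; simp) e₁ e₂, ?_,
      hm₂.trans hm₁, fun r hr => (hc₂ r hr).trans (hc₁ r hr), ?_⟩
    · rw [List.flatMap_cons, List.length_append, Nat.mul_add]
      -- The overhead of a round, 6 steps besides reading the tuple and one for the test, is charged
      -- to the choices found in this round, of which there is at least one.
      have : ((readTuple b i).cost + 7) * 1 ≤ ((readTuple b i).cost + 7) * (L a).length :=
        Nat.mul_le_mul_left _ hpos
      rw [Nat.add_mul _ c (L a).length]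
      omega
    · rw [ho₂, ho₁, List.flatMap_cons, List.map_append, List.append_assoc]

theorem enumerates_choices {σ : ℕ} {mem : List (Word D) → Word D} {regs : List ℕ}
    {word : Choice b → List (Word D)}
    (hword : ∀ T s, T.Held [] σ mem s → regs.map s.reg = word T)
    (hchain : ∀ (i : Fin n) ws, Chain mem i σ (mem (cell 2 i σ ws)) (bk i ws))
    (hbk : ∀ i ws, ∀ a ∈ bk i ws, a < (inp (b i).rel).length) {root : Fin n}
    (hroot : sh root = []) (l : List (Fin n)) (hl : TopDown root par l) (T : Choice b)
    (hT : NoDeadEnd inp par sh bk l T) :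
    Enumerates inp l σ mem word (enumerate b par sh regs l) (enumerateCost b l) T
      (choices inp par sh bk l T) := by
  induction l generalizing T with
  | nil =>
    intro s hs
    refine ⟨_, 1, .instr _ s, by simp [enumerateCost, choices], rfl, fun _ _ => rfl, ?_⟩
    simp [Instr.step, choices, hword T s hs]
  | cons i l ih =>
    obtain ⟨hil, hpar, hl⟩ := hl
    intro s hs
    have hkey : ((sh i).map (vreg b (par i))).map s.reg = T.key par sh i := by
      by_cases hi : i = root
      · subst hi
        simp [Choice.key, hroot]
      · exact Pass.map_vreg hs.zero (hs.tup _ (hpar hi)) _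
    have hload : (loadCell (rPtr i) 2 i rStamp ((sh i).map (vreg b (par i)))).run inp s =
        (s.set rTag (.inr (Nat.pair 2 i))).set (rPtr i) (mem (cell 2 i σ (T.key par sh i))) := by
      rw [run_loadCell hs.stamp (by simp [rStamp, rTag]) (Pass.notMem_map_vreg (by simp [rTag])),
        hkey, hs.mem_eq]
    obtain ⟨t₁, ht₁, e₁⟩ := (loopFree_loadCell (S := S) (r := rPtr i) (k := 2) (i := i)
      (st := rStamp) (a := (sh i).map (vreg b (par i)))).exec (inp := inp) s
    rw [hload] at e₁
    set s₁ := (s.set rTag (.inr (Nat.pair 2 i))).set (rPtr i)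
      (mem (cell 2 i σ (T.key par sh i))) with hs₁
    have hc₁ : ∀ r, ¬ ChangedReg (i :: l) r → s₁.reg r = s.reg r := by
      intro r hr
      rw [hs₁, State.set_reg_of_ne, State.set_reg_of_ne]
      · rintro rfl
        exact hr (.inl (by simp [rTag]))
      · rintro rfl
        exact hr (.inr ⟨i, by simp, .inl rfl⟩)
    obtain ⟨s₂, t₂, e₂, ht₂, hm₂, hc₂, ho₂⟩ := exec_listLoop hil
      (L := fun a => choices inp par sh bk l (Function.update T i (tupleAt b inp i a)))
      (hchain i (T.key par sh i))
      (fun a ha => ⟨hbk i _ a ha, length_choices_pos (hT.2 a ha), ih hl _ (hT.2 a ha)⟩)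
      (hs.congr (s' := s₁) rfl hc₁) (State.set_reg_self _ _ _)
    refine ⟨s₂, t₁ + t₂, .seq e₁ e₂, ?_, hm₂, fun r hr => (hc₂ r hr).trans (hc₁ r hr), ho₂⟩
    have hpos : 1 ≤ (choices inp par sh bk (i :: l) T).length := length_choices_pos hT
    rw [← choices] at ht₂
    generalize (choices inp par sh bk (i :: l) T).length = m at hpos ht₂ ⊢
    simp only [Program.cost, loadCell] at ht₁
    -- The 10 in `enumerateCost` is 7 for each round of the loop plus 3 for loading the head of the
    -- list (two steps) and the final test.
    have : enumerateCost b (i :: l) * m = ((readTuple b i).cost + 7 + enumerateCost b l) * m +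
        3 * m := by
      rw [enumerateCost]
      ring
    omega

end Enumeration

/-! ### Which choices are enumerated, and that none is repeated -/

section Choices

variable {S : Schema} {V D : Type*} {n : ℕ} {b : Body S V D (Fin n)}

/-- The tuples for the atoms outside `l` are good and join along the tree. -/
structure Choice.Joins (T : Choice b) (C : Pass b) (γ : V → D)
    (g : Fin n → List (Word D) → Prop) (db : Instance S D) (root : Fin n) (par : Fin n → Fin n)
    (l : List (Fin n)) : Prop where
  mem : ∀ i, i ∉ l → T i ∈ db (b i).rel
  good : ∀ i, i ∉ l → C.Good γ g db i (T i)
  par_notMem : ∀ i, i ∉ l → i ≠ root → par i ∉ l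
  proj : ∀ i, i ∉ l → i ≠ root → C.proj i (T i) = T.key par C.sh i

variable {C : Pass b} {γ : V → D} {db : Instance S D} {inp : Input S D}

/-- The parent of an atom that already has its tuple also has one, so it is not `i`, and the new
tuple does not disturb the joins made before. -/
theorem Choice.Joins.update {T : Choice b} {g : Fin n → List (Word D) → Prop} {root : Fin n}
    {par : Fin n → Fin n} {i : Fin n} {l : List (Fin n)}
    (hT : T.Joins C γ g db root par (i :: l)) (hroot : C.sh root = [])
    (hpar : i ≠ root → par i ∉ i :: l) {t : Tuple S D (b i).rel} (ht : t ∈ db (b i).rel)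
    (hg : C.Good γ g db i t) (hp : C.proj i t = T.key par C.sh i) :
    Choice.Joins (Function.update T i t) C γ g db root par l := by
  have hkey : ∀ x, (x ≠ root → par x ≠ i) →
      Choice.key (Function.update T i t) par C.sh x = T.key par C.sh x := by
    intro x hx
    by_cases hr : x = root
    · subst hr
      simp [Choice.key, hroot]
    · rw [Choice.key, Choice.key, Function.update_of_ne (hx hr)]
  have hmem : ∀ x, x ∉ l → x = i ∨ x ∉ i :: l := fun x hx => by
    by_cases h : x = i <;> simp [h, hx]
  refine ⟨fun x hx => ?_, fun x hx => ?_, fun x hx hr => ?_, fun x hx hr => ?_⟩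
  all_goals rcases hmem x hx with rfl | hx'
  · rwa [Function.update_self]
  · rw [Function.update_of_ne fun h => hx' (by simp [h])]
    exact hT.mem x hx'
  · rwa [Function.update_self]
  · rw [Function.update_of_ne fun h => hx' (by simp [h])]
    exact hT.good x hx'
  · exact fun h => hpar hr (List.mem_cons_of_mem _ h)
  · exact fun h => hT.par_notMem x hx' hr (List.mem_cons_of_mem _ h)
  · rw [Function.update_self, hkey _ fun h h' => hpar h (by simp [h']), hp]
  · rw [Function.update_of_ne fun h => hx' (by simp [h]),
      hkey _ fun h h' => hT.par_notMem x hx' h (by simp [h']), hT.proj x hx' hr]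

variable [Nonempty D]

theorem Pass.tupleAt_of_mem_bucket (hinp : inp.Lists db) {g : Fin n → List (Word D) → Prop}
    {i : Fin n} {ws : List (Word D)} {m a : ℕ} (ha : a ∈ C.bucket γ g db inp i ws m) :
    tupleAt b inp i a ∈ db (b i).rel ∧ C.Good γ g db i (tupleAt b inp i a) ∧
      C.proj i (tupleAt b inp i a) = ws := by
  obtain ⟨-, t, ht, hg, hp⟩ := Pass.mem_bucket.1 ha
  have : tupleAt b inp i a = t := by simp [tupleAt, ht]
  rw [this]
  exact ⟨((hinp _).2 t).1 (List.mem_of_getElem? ht), hg, hp⟩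

variable {J : RootedJoinTree fun i => (b i).vars \ C.U} {Rs : Set (Instance S D)}
  {g : Fin n → List (Word D) → Prop}

/-- The positions of the good tuples with a given projection. -/
noncomputable def Pass.positions (C : Pass b) (γ : V → D) (g : Fin n → List (Word D) → Prop)
    (db : Instance S D) (inp : Input S D) (i : Fin n) (ws : List (Word D)) : List ℕ :=
  C.bucket γ g db inp i ws (inp (b i).rel).length

theorem Pass.exists_mem_positions (hinp : inp.Lists db) {i : Fin n} {t : Tuple S D (b i).rel}
    (ht : t ∈ db (b i).rel) (hg : C.Good γ g db i t) :
    ∃ a ∈ C.positions γ g db inp i (C.proj i t), tupleAt b inp i a = t := by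
  obtain ⟨a, ha, rfl⟩ := List.getElem_of_mem (((hinp _).2 t).2 ht)
  exact ⟨a, Pass.mem_bucket.2 ⟨ha, _, List.getElem?_eq_getElem ha, hg, rfl⟩, by
    simp [tupleAt, List.getElem?_eq_getElem ha]⟩

/-- The tuple chosen for a parent is good, so the list of each child at the corresponding key is
nonempty; at the root this is the hypothesis on `g`. Thus the bottom-up reduction is what excludes
backtracking. -/
theorem Pass.Fits.noDeadEnd (h : C.Fits J γ db Rs) (hsol : C.Solves γ g db)
    (hroot : C.sh J.root = []) (hg : g J.root []) (hinp : inp.Lists db) (l : List (Fin n))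
    (hl : TopDown J.root J.par l) (T : Choice b) (hT : T.Joins C γ g db J.root J.par l) :
    NoDeadEnd inp J.par C.sh (C.positions γ g db inp) l T := by
  induction l generalizing T with
  | nil => trivial
  | cons i l ih =>
    obtain ⟨-, hpar, hl⟩ := hl
    refine ⟨?_, fun a ha => ?_⟩
    · have hgi : g i (T.key J.par C.sh i) := by
        by_cases hi : i = J.root
        · subst hi
          rwa [Choice.key, hroot]
        · exact (hT.good _ (hpar hi) _ (hT.mem _ (hpar hi)) fun _ _ => rfl).2.2 i
            ((h.mem_children _ _).2 ⟨hi, rfl⟩)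
      obtain ⟨t, ht, hp, hgood⟩ := (hsol _ _).1 hgi
      obtain ⟨a, ha, -⟩ := Pass.exists_mem_positions hinp ht hgood
      rw [hp] at ha
      exact List.ne_nil_of_mem ha
    · obtain ⟨ht, hgood, hp⟩ := Pass.tupleAt_of_mem_bucket hinp ha
      exact ih hl _ (hT.update hroot hpar ht hgood hp)

theorem Pass.Fits.mem_choices (hroot : C.sh J.root = []) (hinp : inp.Lists db)
    (l : List (Fin n)) (hl : TopDown J.root J.par l) (T : Choice b)
    (hT : T.Joins C γ g db J.root J.par l) (T' : Choice b) :
    T' ∈ choices inp J.par C.sh (C.positions γ g db inp) l T ↔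
      (∀ x, x ∉ l → T' x = T x) ∧ T'.Joins C γ g db J.root J.par [] := by
  induction l generalizing T with
  | nil =>
    simp only [choices, List.mem_singleton, List.not_mem_nil, not_false_eq_true, forall_const]
    exact ⟨fun h => ⟨fun x => by rw [h], h ▸ hT⟩, fun h => funext h.1⟩
  | cons i l ih =>
    obtain ⟨hil, hpar, hl⟩ := hl
    simp only [choices, List.mem_flatMap]
    constructor
    · rintro ⟨a, ha, hT'⟩
      obtain ⟨ht, hgood, hp⟩ := Pass.tupleAt_of_mem_bucket hinp ha
      obtain ⟨h₁, h₂⟩ := (ih hl _ (hT.update hroot hpar ht hgood hp)).1 hT'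
      refine ⟨fun x hx => ?_, h₂⟩
      rw [h₁ x fun h => hx (List.mem_cons_of_mem _ h), Function.update_of_ne]
      rintro rfl
      simp at hx
    · rintro ⟨h₁, h₂⟩
      have hi : i ∉ ([] : List (Fin n)) := List.not_mem_nil
      obtain ⟨a, ha, hta⟩ := Pass.exists_mem_positions hinp (h₂.mem i hi) (h₂.good i hi)
      have hkey : C.proj i (T' i) = T.key J.par C.sh i := by
        by_cases hr : i = J.root
        · subst hr
          simp [Pass.proj, Choice.key, hroot]
        · rw [h₂.proj i hi hr, Choice.key, Choice.key, h₁ _ (hpar hr)]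
      refine ⟨a, hkey ▸ ha, (ih hl _ ?_).2 ⟨fun x hx => ?_, h₂⟩⟩
      · rw [hta]
        exact hT.update hroot hpar (h₂.mem i hi) (h₂.good i hi) hkey
      · by_cases hxi : x = i
        · subst hxi
          rw [Function.update_self, hta]
        · rw [Function.update_of_ne hxi]
          exact h₁ x (by simp [hxi, hx])

/-- Branches for different positions give `i` different tuples, since the input lists no tuple
twice, and deeper levels do not change the tuple of `i`. -/
theorem Pass.Fits.nodup_choices (hroot : C.sh J.root = []) (hinp : inp.Lists db)
    (l : List (Fin n)) (hl : TopDown J.root J.par l) (T : Choice b)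
    (hT : T.Joins C γ g db J.root J.par l) :
    (choices inp J.par C.sh (C.positions γ g db inp) l T).Nodup := by
  induction l generalizing T with
  | nil => simp [choices]
  | cons i l ih =>
    obtain ⟨hil, hpar, hl⟩ := hl
    have hup : ∀ a ∈ C.positions γ g db inp i (T.key J.par C.sh i),
        Choice.Joins (Function.update T i (tupleAt b inp i a)) C γ g db J.root J.par l := by
      intro a ha
      obtain ⟨ht, hgood, hp⟩ := Pass.tupleAt_of_mem_bucket hinp ha
      exact hT.update hroot hpar ht hgood hp
    rw [choices, List.nodup_flatMap]
    refine ⟨fun a ha => ih hl _ (hup a ha), ?_⟩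
    refine (List.Pairwise.imp_of_mem ?_
      (Pass.nodup_bucket : (C.positions γ g db inp i (T.key J.par C.sh i)).Nodup))
    intro a a' ha ha' hne T' h₁ h₂
    have e₁ := ((mem_choices hroot hinp l hl _ (hup a ha) T').1 h₁).1 i hil
    have e₂ := ((mem_choices hroot hinp l hl _ (hup a' ha') T').1 h₂).1 i hil
    rw [Function.update_self] at e₁ e₂
    obtain ⟨hlt, t, ht, -⟩ := Pass.mem_bucket.1 ha
    obtain ⟨hlt', t', ht', -⟩ := Pass.mem_bucket.1 ha'
    rw [e₁, tupleAt, tupleAt, ht, ht', Option.getD_some, Option.getD_some] at e₂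
    rw [← e₂, ← ht] at ht'
    exact hne ((List.getElem?_inj hlt (hinp _).1).1 ht'.symm)

end Choices

/-! ### Full queries: from choices of tuples to answers -/

section Full

variable {S : Schema} {V D : Type*} {n k : ℕ} {b : Body S V D (Fin n)} {C : Pass b}
  {γ : V → D} {db : Instance S D} {J : RootedJoinTree fun i => (b i).vars \ C.U}
  {Rs : Set (Instance S D)} {g : Fin n → List (Word D) → Prop}

/-- Valuations of the single atoms that agree along the edges of the tree agree. -/
theorem RootedJoinTree.eq_of_eq_par {vs : Fin n → Set V} (J : RootedJoinTree vs)
    (θ : Fin n → V → D)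
    (h : ∀ x, x ≠ J.root → ∀ v ∈ vs x, v ∈ vs (J.par x) → θ x v = θ (J.par x) v)
    {x y : Fin n} {v : V} (hx : v ∈ vs x) (hy : v ∈ vs y) : θ x v = θ y v := by
  induction hm : J.depth x + J.depth y using Nat.strong_induction_on generalizing x y with
  | _ m ih =>
  -- If `y` is outside the subtree of `x`, separation shows that the parent of `x` also contains
  -- `v`, and replacing `x` by its parent lowers the sum of depths. Distinct atoms cannot lie in
  -- each other's subtrees, so the step applies to one of the two.
  have step : ∀ {x y}, v ∈ vs x → v ∈ vs y → J.depth x + J.depth y = m → y ∉ J.sub x →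
      θ x v = θ y v := by
    intro x y hx hy hm hyx
    have hr : x ≠ J.root := by
      rintro rfl
      exact hyx (J.mem_sub_root y)
    have hp := (J.sep x hr x (J.mem_sub_self x) y hyx v hx hy).2
    rw [h x hr v hx hp]
    have := J.depth_par_lt x hr
    exact ih _ (by omega) hp hy rfl
  by_cases hyx : y ∈ J.sub x
  · by_cases hxy : x ∈ J.sub y
    · rw [J.sub_antisymm x y hxy hyx]
    · exact (step hy hx (by omega) hxy).symm
  · exact step hx hy hm hyx

/-- Each tuple matches its atom through a valuation of its own. Equal projections make these agree
along the edges of the tree, hence on all common variables, so they merge into one valuation. -/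
theorem Pass.Fits.exists_valuation [Nonempty D] (h : C.Fits J γ db Rs) (hU : C.U = ∅)
    {T : Choice b} (hT : T.Joins C γ g db J.root J.par []) :
    ∃ θ : V → D, ∀ i, (b i).fact θ = T i := by
  classical
  have hmatch : ∀ i, ∃ θ : V → D, (b i).fact θ = T i := by
    intro i
    have hi : i ∉ ([] : List (Fin n)) := List.not_mem_nil
    obtain ⟨θ, -, hθ⟩ :=
      Atom.matches_iff.1 (hT.good i hi _ (hT.mem i hi) fun _ _ => rfl).1
    exact ⟨θ, hθ⟩
  choose Θ hΘ using hmatch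
  have hedge : ∀ x, x ≠ J.root → ∀ v ∈ (b x).vars \ C.U, v ∈ (b (J.par x)).vars \ C.U →
      Θ x v = Θ (J.par x) v := by
    intro x hx v hv hv'
    have := hT.proj x List.not_mem_nil hx
    rw [Pass.proj, Choice.key, ← hΘ x, ← hΘ (J.par x)] at this
    have := List.map_inj_left.1 this v ((h.mem_sh x hx v).2 ⟨hv.1, hv'.1⟩)
    rw [Atom.look_fact hv.1, Atom.look_fact hv'.1] at this
    exact Sum.inl.inj this
  refine ⟨fun v => if hv : ∃ i, v ∈ (b i).vars then Θ hv.choose v else Classical.arbitrary D,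
    fun i => ?_⟩
  rw [← hΘ i]
  refine Atom.fact_congr fun v hv => ?_
  have hex : ∃ i, v ∈ (b i).vars := ⟨i, hv⟩
  rw [dif_pos hex]
  exact J.eq_of_eq_par Θ hedge ⟨hex.choose_spec, by simp [hU]⟩ ⟨hv, by simp [hU]⟩

/-- A fact of the consistent part is alone in its block, so goodness only asks that the children
join, and the same valuation `θ` witnesses this through `Pass.Fits.solves_iff`. -/
theorem Pass.Fits.joins_fact (h : C.Fits J γ db {db.consistentPart})
    (hK : ∀ i, C.K i = S.key (b i).rel) (hU : C.U = ∅)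
    (hsol : C.Solves γ g db) {θ : V → D} (hθ : ∀ i, (b i).Holds θ db.consistentPart) :
    Choice.Joins (fun i => (b i).fact θ) C γ g db J.root J.par [] := by
  refine ⟨fun i _ => (Instance.mem_consistentPart.1 (hθ i)).1, fun i _ t' ht' hk => ?_,
    fun _ _ _ => List.not_mem_nil, fun i _ hi => ?_⟩
  · have ht : t' = (b i).fact θ :=
      (Instance.mem_consistentPart.1 (hθ i)).2 t' ht' fun p hp => hk p (by rwa [hK])
    subst ht
    refine ⟨Atom.matches_iff.2 ⟨θ, by simp [hU], rfl⟩, fun _ _ => rfl, fun j hj => ?_⟩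
    rw [h.look_child hj, h.solves_iff hsol]
    rintro r rfl
    exact ⟨θ, by simp [hU], fun _ _ => rfl, fun x _ => hθ x⟩
  · rw [h.proj_fact, Choice.key]
    exact (h.look_child ((h.mem_children _ _).2 ⟨hi, rfl⟩) θ).symm

theorem Choice.Joins.mem_consistentPart {T : Choice b} {root : Fin n} {par : Fin n → Fin n}
    (hT : T.Joins C γ g db root par []) (hK : ∀ i, C.K i = S.key (b i).rel)
    (hW : ∀ i, C.W i = Finset.univ) (i : Fin n) : T i ∈ db.consistentPart (b i).rel := by
  have hi : i ∉ ([] : List (Fin n)) := List.not_mem_nil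
  refine Instance.mem_consistentPart.2 ⟨hT.mem i hi, fun t' ht' hk => funext fun p => ?_⟩
  exact (hT.good i hi t' ht' fun p hp => hk p (by rwa [hK] at hp)).2.1 p (by simp [hW])

theorem exists_computes_of_isFull [Nonempty D] [Fintype S.Rel] (q : Query S V D k)
    (hac : q.IsAcyclic) (hfull : q.IsFull) :
    ∃ (P : Program S D) (C : ℕ), P.Computes q.consistentAnswers
      (fun db => C * max 1 (db.size + (q.consistentAnswers db).ncard)) := by
  classical
  obtain ⟨i₀⟩ := hac.nonempty
  obtain ⟨J, -⟩ := hac.exists_rootedJoinTree ∅ i₀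
  let C := Pass.singleton (b := q.body) ∅ J
  have hU : C.U = ∅ := rfl
  have hsh : C.sh J.root = [] := Pass.ofTree_sh_root
  -- Each free variable is output from one fixed occurrence `p j` in the atom `a j`.
  choose a p hp using q.head_safe
  let regs : List ℕ := List.ofFn fun j => rTup (a j) (p j)
  let ans : Choice q.body → Fin k → D := fun T j => T (a j) (p j)
  let word : Choice q.body → List (Word D) := fun T => List.ofFn fun j => .inl (ans T j)
  let E : Program S D := enumerate q.body J.par C.sh regs J.order
  set m₁ := C.passCost q.valReg J.order + 1
  set m₂ := enumerateCost q.body J.order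
  refine ⟨.seq (.instr (.lit rOne (.inr 1))) (.seq (newPass C q.valReg J.order)
    (.seq (loadCell rX 2 J.root rStamp []) (.ite rX rZero .skip E))), 2 * m₁ + m₂ + 5,
    fun db inp hinp => ?_⟩
  let γ : V → D := fun _ => Classical.arbitrary D
  have hfits : C.Fits J γ db {db.consistentPart} := Pass.fits_singleton ∅ J γ db
  set s₀ : State D := (State.init D).set rOne (.inr 1) with hs₀
  obtain ⟨s₁, ⟨t₁, ht₁, e₁⟩, hout, hst, -, hreg, -, hchain, hsol⟩ :=
    hfits.exec_newPass (ρ := q.valReg) (σ := 0) (s := s₀) (N := db.size) hinp q.rkind_valReg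
      hinp.length_le_size (by simp [hs₀, State.set_reg, rStamp, rOne, State.init])
      (by simp [hs₀, State.set_reg, rZero, rOne, State.init]) (State.set_reg_self _ _ _)
      (by simp [hU]) (fun _ _ _ _ _ => rfl)
  set g := Pass.heads s₁.mem (0 + 1) (n := q.n) with hg
  have hz₁ : s₁.reg rZero = .inr 0 := by
    rw [hreg _ (by simp [rZero, passKinds]) (by simp [rZero])]
    simp [hs₀, State.set_reg, rZero, rOne, State.init]
  have hload : (loadCell rX 2 J.root rStamp []).run inp s₁ =
      (s₁.set rTag (.inr (Nat.pair 2 J.root))).set rX (s₁.mem (cell 2 J.root (0 + 1) [])) := by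
    rw [run_loadCell hst (by simp [rStamp, rTag]) (by simp)]
    rfl
  obtain ⟨t₂, ht₂, e₂⟩ := (loopFree_loadCell (S := S) (r := rX) (k := 2) (i := J.root)
    (st := rStamp) (a := [])).exec (inp := inp) s₁
  rw [hload] at e₂
  set s₂ := (s₁.set rTag (.inr (Nat.pair 2 J.root))).set rX
    (s₁.mem (cell 2 J.root (0 + 1) [])) with hs₂
  have hsame : State.SameExcept scratch s₂ s₁ :=
    ((State.SameExcept.refl _ _).set (by simp [rTag, scratch]) _).set (by simp [rX, scratch]) _
  have hz₂ : s₂.reg rZero = .inr 0 := by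
    rw [hsame.reg _ (by simp [rZero, scratch]), hz₁]
  have hX₂ : s₂.reg rX = s₁.mem (cell 2 J.root (0 + 1) []) := State.set_reg_self _ _ _
  have hout₂ : s₂.out = [] := by
    rw [hsame.out, hout]
    rfl
  have hans : q.consistentAnswers db = q.answers db.consistentPart :=
    q.consistentAnswers_eq_of_isFull hfull db
  have hroot : g J.root [] ↔ ∃ c, c ∈ q.consistentAnswers db := by
    have := hfits.solves_iff hsol J.root γ
    rw [hsh, List.map_nil] at this
    rw [this, hans]
    constructor
    · intro h
      obtain ⟨θ, -, -, hθ⟩ := h _ rfl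
      exact ⟨_, θ, fun i => hθ i (J.mem_sub_root i), fun _ => rfl⟩
    · rintro ⟨c, θ, hθ, -⟩ r rfl
      exact ⟨θ, by simp [hU], by simp [hsh], fun i _ => hθ i⟩
  have hcost : t₁ + t₂ ≤ 2 * m₁ * max 1 db.size + 2 := by
    change t₁ ≤ m₁ * (db.size + 1) at ht₁
    have : m₁ * (db.size + 1) ≤ m₁ * (2 * max 1 db.size) := Nat.mul_le_mul_left _ (by omega)
    simp only [Program.cost, loadCell] at ht₂
    have : m₁ * (2 * max 1 db.size) = 2 * m₁ * max 1 db.size := by ring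
    omega
  -- By `hroot`, the list at the root is empty exactly if there is no answer. Otherwise the
  -- enumeration can start and has no dead ends.
  by_cases h0 : g J.root []
  -- The starting choice is arbitrary: all atoms are still to be assigned, so nothing is required of
  -- it.
  · let T₀ : Choice q.body := fun _ _ => Classical.arbitrary D
    have hT₀ : T₀.Joins C γ g db J.root J.par J.order :=
      ⟨fun i hi => absurd (J.mem_order i) hi, fun i hi => absurd (J.mem_order i) hi,
        fun i hi => absurd (J.mem_order i) hi, fun i hi => absurd (J.mem_order i) hi⟩
    set L := choices inp J.par C.sh (C.positions γ g db inp) J.order T₀ with hL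
    have hmem : ∀ T, T ∈ L ↔ Choice.Joins T C γ g db J.root J.par [] := by
      intro T
      rw [hL, Pass.Fits.mem_choices hsh hinp J.order J.topDown T₀ hT₀]
      exact and_iff_right fun x hx => absurd (J.mem_order x) hx
    have hval : ∀ T ∈ L, ∃ θ : V → D, (∀ i, (q.body i).fact θ = T i) ∧
        ∀ j, θ (q.head j) = ans T j := by
      intro T hT
      obtain ⟨θ, hθ⟩ := hfits.exists_valuation hU ((hmem T).1 hT)
      refine ⟨θ, hθ, fun j => ?_⟩
      simp only [ans]
      rw [← hθ (a j)]
      simp [Atom.fact, hp, Term.eval]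
    obtain ⟨s₃, t₃, e₃, ht₃, -, -, hout₃⟩ := enumerates_choices (σ := 0 + 1) (mem := s₁.mem)
      (regs := regs) (word := word) (sh := C.sh) (bk := C.positions γ g db inp)
      (fun T s hs => by
        simp only [regs, word, ans, List.map_ofFn]
        congr 1
        funext j
        exact hs.tup (a j) List.not_mem_nil (p j))
      hchain (fun i ws x hx => (Pass.mem_bucket.1 hx).1) hsh J.order J.topDown T₀
      (hfits.noDeadEnd hsol hsh h0 hinp J.order J.topDown T₀ hT₀) s₂
      ⟨hsame.mem, by rw [hsame.reg _ (by simp [rStamp, scratch]), hst], hz₂,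
        fun i hi => absurd (J.mem_order i) hi⟩
    have hmemL : ∀ c, c ∈ L.map ans ↔ c ∈ q.consistentAnswers db := by
      intro c
      rw [List.mem_map, hans]
      constructor
      · rintro ⟨T, hT, rfl⟩
        obtain ⟨θ, hθ, hθ'⟩ := hval T hT
        refine ⟨θ, fun i => ?_, hθ'⟩
        rw [Atom.holds_iff, hθ i]
        exact ((hmem T).1 hT).mem_consistentPart (fun _ => rfl) (fun _ => rfl) i
      · rintro ⟨θ, hθ, hθ'⟩
        refine ⟨fun i => (q.body i).fact θ, (hmem _).2
          (hfits.joins_fact (fun _ => rfl) hU hsol hθ), funext fun j => ?_⟩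
        simp [ans, Atom.fact, hp, Term.eval, hθ']
    -- Fullness enters here: the values of the free variables determine every fact, so different
    -- choices yield different answers.
    have hnd : (L.map ans).Nodup := by
      refine List.Nodup.map_on ?_
        (Pass.Fits.nodup_choices hsh hinp J.order J.topDown T₀ hT₀)
      intro T hT T' hT' h
      obtain ⟨θ, hθ, hh⟩ := hval T hT
      obtain ⟨θ', hθ', hh'⟩ := hval T' hT'
      funext i
      rw [← hθ, ← hθ']
      refine Atom.fact_congr fun v hv => ?_
      obtain ⟨j, rfl⟩ := hfull i hv
      rw [hh, hh', h]
    refine ⟨s₃, 1 + (t₁ + (t₂ + (t₃ + 1))), L.map ans, .seq (.instr _ _) (.seq e₁ (.seq e₂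
      (.ite_ne ?_ e₃))), ?_, ?_, hnd, hmemL⟩
    · rw [hX₂, hz₂]
      exact h0
    · have hcard : (q.consistentAnswers db).ncard = L.length := by
        rw [← List.length_map (f := ans), ← List.toFinset_card_of_nodup hnd,
          ← Set.ncard_coe_finset]
        congr 1
        ext c
        simp only [List.coe_toFinset, Set.mem_ofPred_eq]
        exact (hmemL c).symm
      change _ ≤ (2 * m₁ + m₂ + 5) * max 1 (db.size + (q.consistentAnswers db).ncard)
      rw [hcard]
      change t₃ ≤ m₂ * L.length at ht₃
      set M := max 1 (db.size + L.length)
      have h₁ : 2 * m₁ * max 1 db.size ≤ 2 * m₁ * M := Nat.mul_le_mul_left _ (by omega)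
      have h₂ : m₂ * L.length ≤ m₂ * M := Nat.mul_le_mul_left _ (by omega)
      have h₃ : 1 ≤ M := le_max_left _ _
      rw [Nat.add_mul, Nat.add_mul]
      omega
    · rw [hout₃, hout₂, List.nil_append, List.map_map]
      rfl
  · have hempty : ∀ c, c ∉ q.consistentAnswers db := fun c hc => h0 (hroot.2 ⟨c, hc⟩)
    refine ⟨s₂, 1 + (t₁ + (t₂ + (1 + 1))), [], .seq (.instr _ _) (.seq e₁ (.seq e₂
      (.ite_eq ?_ ?_))), ?_, by rw [hout₂]; rfl, List.nodup_nil, by simpa using hempty⟩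
    · rw [hX₂, hz₂]
      exact not_not.1 h0
    · have := Exec.instr (inp := inp) (Instr.copy 0 0) s₂
      rwa [show (Instr.copy 0 0).step inp s₂ = s₂ from Program.run_skip inp s₂] at this
    · change _ ≤ (2 * m₁ + m₂ + 5) * max 1 (db.size + (q.consistentAnswers db).ncard)
      set M := max 1 (db.size + (q.consistentAnswers db).ncard)
      have h₁ : 2 * m₁ * max 1 db.size ≤ 2 * m₁ * M := Nat.mul_le_mul_left _ (by omega)
      have h₃ : 1 ≤ M := le_max_left _ _
      rw [Nat.add_mul, Nat.add_mul]
      omega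

end Full

end CQA

theorem mainTheorem2 {S : CQA.Schema} [Fintype S.Rel] {V D : Type*} [Infinite D] {k : ℕ}
    (q : CQA.Query S V D k) (hacyclic : q.IsAcyclic) (hsjf : q.SelfJoinFree)
    (hppjt : q.AdmitsPPJT) :
    (∃ (P : CQA.Program S D) (C : ℕ),
      P.Computes q.consistentAnswers
        (fun db => C * (max 1 db.size * max 1 (q.possibleAnswers db).ncard))) ∧
    (q.IsFull →
      (∃ (P : CQA.Program S D) (C : ℕ),
        P.Computes q.consistentAnswers
          (fun db => C * max 1 (db.size + (q.consistentAnswers db).ncard))) ∧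
      ∀ db : CQA.Instance S D, q.consistentAnswers db = q.answers db.consistentPart) :=
  ⟨CQA.exists_computes_consistentAnswers q hacyclic hsjf hppjt, fun hfull =>
    ⟨CQA.exists_computes_of_isFull q hacyclic hfull,
      q.consistentAnswers_eq_of_isFull hfull⟩⟩
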